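/- Consider the randomized LOCAL model: the nodes of a finite simple graph $G$ have distinct identifiers from $\mathbb N$ and independent private sources of randomness; initially every node knows only its own identifier, its own randomness and a common number $N\ge |V(G)|$ (for instance $N=n:=|V(G)|$); in each synchronous round every node performs arbitrary computation and exchanges messages of arbitrary size with its neighbours; at the end every node outputs its partner in the matching, or that it is unmatched. For every constant $\delta>0$ there are a randomized LOCAL algorithm and constants $C,c>0$ and $n_0$, depending only on $\delta$, such that for all $N\ge n_0$ the algorithm takes at most $C\,\frac{\log N}{(\log\log N)^2}$ rounds, and for every $\varepsilon\in(0,1)$ (which may depend on $N$ and on $n$), every graph with at most $N$ nodes and every assignment of identifiers, with probability at least $$1-\frac1\varepsilon\, e^{-c\,(\log N)^{1-\delta}}$$ its output is a $(2+\varepsilon)$-approximate maximum cardinality matching, i.e. the outputs of the nodes consistently describe a matching $M$ of $G$ such that every matching $M'$ of $G$ satisfies $|M'|\le(2+\varepsilon)|M|$. In particular, when $n$ is known ($N=n$), or known up to a polynomial, this takes $O\big(\frac{\log n}{\log^2\log n}\big)$ rounds and succeeds with probability at least $1-\frac1\varepsilon e^{-\Omega(\log^{1-\delta}n)}$. -/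

import Mathlib

open MeasureTheory

/-- The private randomness of one node: an unbounded supply of real numbers in `[0,1]`. -/
abbrev Seed : Type := ℕ → unitInterval

/-- The law of the private randomness of one node: independent uniform numbers in `[0,1]`. -/
noncomputable def seedMeasure : Measure Seed :=
  Measure.infinitePi fun _ : ℕ => (volume : Measure unitInterval)

instance : IsProbabilityMeasure seedMeasure := by
  unfold seedMeasure; infer_instance

/-- A randomized algorithm in the LOCAL model, in which every node ends by naming at most one
partner. Local computation is arbitrary and messages are of arbitrary size. Nodes are addressed by
unique identifiers (natural numbers). Initially a node knows a common upper bound on the number of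
nodes, its own identifier and its own random seed, and nothing about the graph. -/
structure LocalAlgorithm where
  /-- local states of a node -/
  State : Type
  /-- messages -/
  Msg : Type
  /-- number of communication rounds, given the upper bound on the number of nodes -/
  rounds : ℕ → ℕ
  /-- initial state, given the upper bound on the number of nodes, the identifier of the node and
  its random seed -/
  init : ℕ → ℕ → Seed → State
  /-- message that a node in the given state sends to its neighbour with the given identifier -/
  send : State → ℕ → Msg
  /-- new state, given the old state and the received messages, each with its sender's
  identifier -/
  receive : State → Set (ℕ × Msg) → State
  /-- output of a node: `some i` if it is matched to its neighbour with identifier `i`,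
  `none` if it is unmatched -/
  output : State → Option ℕ

namespace LocalAlgorithm

variable {V : Type*}

/-- The states of all nodes after `t` synchronous rounds on the graph `G` with identifiers `ident`
and random seeds `ω`, when all nodes are given the upper bound `N`. -/
def run (A : LocalAlgorithm) (N : ℕ) (G : SimpleGraph V) (ident : V → ℕ) (ω : V → Seed) :
    ℕ → V → A.State
  | 0, v => A.init N (ident v) (ω v)
  | t + 1, v => A.receive (run A N G ident ω t v)
      {p | ∃ u, G.Adj v u ∧ p = (ident u, A.send (run A N G ident ω t u) (ident v))}

/-- The outputs of all nodes once the algorithm has finished. -/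
def result (A : LocalAlgorithm) (N : ℕ) (G : SimpleGraph V) (ident : V → ℕ) (ω : V → Seed)
    (v : V) : Option ℕ :=
  A.output (A.run N G ident ω (A.rounds N) v)

end LocalAlgorithm

/-- `M` is a `ρ`-approximate maximum cardinality matching of `G`: a matching such that no matching
of `G` has more than `ρ` times as many edges. -/
def IsApproxMaxMatching {V : Type*} (G : SimpleGraph V) (ρ : ℝ) (M : G.Subgraph) : Prop :=
  M.IsMatching ∧
    ∀ M' : G.Subgraph, M'.IsMatching → (M'.edgeSet.ncard : ℝ) ≤ ρ * (M.edgeSet.ncard : ℝ)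

/-- The local outputs `out` are consistent and describe the matching `M`: the output of a node
is the identifier of its partner in `M`, and `none` for a node that has no partner in `M`. -/
def Describes {V : Type*} {G : SimpleGraph V} (ident : V → ℕ) (out : V → Option ℕ)
    (M : G.Subgraph) : Prop :=
  ∀ (v : V) (i : ℕ), out v = some i ↔ ∃ u, M.Adj v u ∧ ident u = i

/-- The event, over the random seeds of all nodes, that the algorithm outputs a `ρ`-approximate
maximum cardinality matching. -/
def LocalAlgorithm.successEvent {V : Type*} (A : LocalAlgorithm) (N : ℕ) (G : SimpleGraph V)
    (ident : V → ℕ) (ρ : ℝ) : Set (V → Seed) :=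
  {ω | ∃ M : G.Subgraph, Describes ident (A.result N G ident ω) M ∧ IsApproxMaxMatching G ρ M}

/-! A vertex cover is obtained by peeling off vertices of decreasing degree; it exceeds a maximum
matching by a factor of at most `4 * P * B` (`card_cover_le`, `card_cover_le_matching`). Then `T`
steps of random proposals from unmatched cover vertices (senders) to their neighbours (receivers)
are run. The proposal probabilities come from learners of types `ρ < R`. A learner sees the senders
within distance `ρ` of its centre, keeps multiplicative weights on both sides, and plans the
distribution on its edges that maximizes `τ` times the negative relative entropy of the sender
marginal plus that of the receiver marginal. Each sender averages the conditional distributions of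
the learners around it. A receiver that is matched or has load at least 1 loses a factor `K` of its
weight. A sender that is matched, or that the learner directs to free receivers with mass at least
`1 / K`, is gold and loses a factor `e`.

Learning. At most `1 / K` of a plan avoids both gold senders and killed receivers, so each update
lowers the optimum of a learner by `τ / (2 * K)`, or by `log (K / 3)` while almost all of the plan
is on killed receivers (`value_succ_le_or`). A matching left between unmatched vertices of low
activity is an admissible plan and bounds the optimum from below. The first kind of drop is rare
because `τ` is much larger than `K`. The second kind happens only when the plan lives on the few
receivers that were ever hit; the remaining gap is then small, except for the growth of balls from
radius `ρ` to `ρ + 2`. Averaging over the learners by the log sum inequality and summing over `ρ`,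
this growth telescopes to `2 * log N`, so that all types together make little more than `2 * log N /
log (K / 3)` updates (`sum_card_times_le`).

Time. Type `ρ` updates only in steps divisible by `ρ + 1`. This is slow enough for the dependence
radius to grow by 4 per step (`state_congr`), yet there are at least `T * log (R + 1)` updates in
total. As `R` and `K` are of the order of powers of `log N`, both logarithms are of order `log log
N`, and `T` of order `log N / (log log N) ^ 2` already exceeds what a large residual matching
permits (`card_residualPairs_le`).

Randomness. An unmatched vertex is matched in a step with probability at least its activity divided
by `8 * R ^ 2` (`card_newPtn_ge`). An exponential potential then shows that few vertices stay
unmatched despite much activity (`sum_card_lateIdx_le`). Each edge of a maximum matching touches a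
matched vertex, touches such a late vertex, or is residual. The first case accounts for the factor 2
(`ncard_edgeSet_le`), the other two are controlled by Markov's inequality (`success_probability`).
-/

/-! ### Relative entropy objectives and their maximizers -/

section Entropy

universe x

open scoped Classical in
/-- The marginal of the weights `y` on `E` under the map `p`. -/
noncomputable def marg {ι α : Type*} (E : Finset ι) (p : ι → α) (y : ι → ℝ) (a : α) : ℝ :=
  ∑ e ∈ E.filter (fun e => p e = a), y e

/-- `y` is a probability distribution supported on `E`. -/
structure IsDist {ι : Type*} (E : Finset ι) (y : ι → ℝ) : Prop where
  nonneg : ∀ e, 0 ≤ y e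
  supp : ∀ e, e ∉ E → y e = 0
  sum_eq : ∑ e ∈ E, y e = 1

variable {ι : Type*} {α β : Type x} {E E' : Finset ι} {p : ι → α} {q : ι → β} {y z : ι → ℝ}

theorem IsDist.mono (hy : IsDist E' y) (h : E' ⊆ E) : IsDist E y :=
  ⟨hy.nonneg, fun e he => hy.supp e fun h' => he (h h'), by
    rw [← hy.sum_eq]; exact (Finset.sum_subset h fun e _ h' => hy.supp e h').symm⟩

theorem marg_nonneg (hy : ∀ e, 0 ≤ y e) (a : α) : 0 ≤ marg E p y a :=
  Finset.sum_nonneg fun e _ => hy e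

theorem le_marg (hy : ∀ e, 0 ≤ y e) {e : ι} (he : e ∈ E) : y e ≤ marg E p y (p e) := by
  classical
  exact Finset.single_le_sum (f := y) (fun e _ => hy e) (by simp [he])

theorem marg_mono_set (hy : ∀ e, e ∉ E' → y e = 0) (h : E' ⊆ E) (a : α) :
    marg E p y a = marg E' p y a := by
  classical
  refine (Finset.sum_subset (Finset.filter_subset_filter _ h) fun e he h' => ?_).symm
  apply hy; intro h''
  exact h' (Finset.mem_filter.2 ⟨h'', (Finset.mem_filter.1 he).2⟩)

/-- Gibbs' inequality for a marginal. -/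
theorem sum_mul_log_div_marg_le (hy : IsDist E y) (v : α → ℝ)
    (hv : ∀ a, 0 ≤ v a) (hpos : ∀ e ∈ E, 0 < y e → 0 < v (p e)) {Z : ℝ}
    {A : Finset α} (hA : ∀ e ∈ E, p e ∈ A) (hZ : ∑ a ∈ A, v a ≤ Z) :
    ∑ e ∈ E, y e * (Real.log (v (p e)) - Real.log (marg E p y (p e))) ≤ Real.log Z := by
  classical
  have hZ0 : 0 < Z := by
    obtain ⟨e, he, hye⟩ : ∃ e ∈ E, 0 < y e := by
      by_contra! h
      have := Finset.sum_nonpos h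
      rw [hy.sum_eq] at this; linarith
    refine lt_of_lt_of_le (hpos e he hye) (le_trans ?_ hZ)
    exact Finset.single_le_sum (fun a _ => hv a) (hA e he)
  have key : ∀ e ∈ E, y e * (Real.log (v (p e)) - Real.log (marg E p y (p e)) - Real.log Z) ≤
      y e * (v (p e) / (marg E p y (p e)) / Z) - y e := by
    intro e he
    rcases (hy.nonneg e).eq_or_lt with h0 | h0
    · simp [← h0]
    · have hm : 0 < marg E p y (p e) := h0.trans_le (le_marg hy.nonneg he)
      have hve := hpos e he h0
      rw [← Real.log_div hve.ne' hm.ne', ← Real.log_div (by positivity) hZ0.ne']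
      have := Real.log_le_sub_one_of_pos (x := v (p e) / marg E p y (p e) / Z) (by positivity)
      nlinarith
  have h2 : ∑ e ∈ E, y e * (v (p e) / (marg E p y (p e)) / Z) ≤ 1 := by
    rw [← Finset.sum_fiberwise_of_maps_to hA]
    calc _ ≤ ∑ a ∈ A, v a / Z := by
          refine Finset.sum_le_sum fun a _ => ?_
          have : ∑ e ∈ E.filter (fun e => p e = a), y e * (v (p e) / marg E p y (p e) / Z)
              = marg E p y a * (v a / marg E p y a / Z) := by
            rw [marg, Finset.sum_mul]
            refine Finset.sum_congr rfl fun e he => ?_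
            rw [(Finset.mem_filter.1 he).2]; rfl
          rw [this]
          rcases (marg_nonneg hy.nonneg a : 0 ≤ marg E p y a).eq_or_lt with h0 | h0
          · rw [← h0]; simpa using div_nonneg (hv a) hZ0.le
          · apply le_of_eq; field_simp
      _ ≤ 1 := by rw [← Finset.sum_div, div_le_one hZ0]; exact hZ
  have h3 := Finset.sum_le_sum key
  rw [Finset.sum_sub_distrib, hy.sum_eq] at h3
  have h4 : ∑ e ∈ E, y e * (Real.log (v (p e)) - Real.log (marg E p y (p e)) - Real.log Z) =
      ∑ e ∈ E, y e * (Real.log (v (p e)) - Real.log (marg E p y (p e))) - Real.log Z := by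
    simp_rw [mul_sub _ _ (Real.log Z)]
    rw [Finset.sum_sub_distrib, ← Finset.sum_mul, hy.sum_eq, one_mul]
  linarith

/-- The objective of a learner: relative entropies of the two marginals to the weights. -/
noncomputable def obj (E : Finset ι) (p : ι → α) (q : ι → β) (τ : ℝ) (u : α → ℝ) (w : β → ℝ)
    (y : ι → ℝ) : ℝ :=
  ∑ e ∈ E, y e * (τ * (Real.log (u (p e)) - Real.log (marg E p y (p e))) +
    (Real.log (w (q e)) - Real.log (marg E q y (q e))))

theorem sum_mul_log_marg (E : Finset ι) (p : ι → α) (y : ι → ℝ) {A : Finset α}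
    (hA : ∀ e ∈ E, p e ∈ A) :
    ∑ e ∈ E, y e * Real.log (marg E p y (p e)) = - ∑ a ∈ A, Real.negMulLog (marg E p y a) := by
  classical
  rw [← Finset.sum_fiberwise_of_maps_to hA, ← Finset.sum_neg_distrib]
  refine Finset.sum_congr rfl fun a _ => ?_
  rw [Real.negMulLog, neg_mul, neg_neg]
  have : marg E p y a * Real.log (marg E p y a) =
      ∑ e ∈ E.filter (fun e => p e = a), y e * Real.log (marg E p y a) := by
    rw [← Finset.sum_mul]; rfl
  rw [this]
  refine Finset.sum_congr rfl fun e he => ?_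
  rw [(Finset.mem_filter.1 he).2]

/-- Grouping by fibres turns the terms with `log (marg ..)` into `negMulLog` of the marginals, which
is continuous even where a marginal vanishes. -/
theorem continuous_obj (E : Finset ι) (p : ι → α) (q : ι → β) (τ : ℝ) (u : α → ℝ) (w : β → ℝ) :
    Continuous (obj E p q τ u w) := by
  classical
  have hm : ∀ {γ : Type x} (f : ι → γ) (a : γ), Continuous fun y : ι → ℝ => marg E f y a := by
    intro γ f a; unfold marg; fun_prop
  have : obj E p q τ u w = fun y => ∑ e ∈ E, y e * (τ * Real.log (u (p e)) + Real.log (w (q e)))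
      + τ * ∑ a ∈ E.image p, Real.negMulLog (marg E p y a)
      + ∑ b ∈ E.image q, Real.negMulLog (marg E q y b) := by
    funext y
    have h1 := sum_mul_log_marg E p y (A := E.image p) fun e he => Finset.mem_image_of_mem _ he
    have h2 := sum_mul_log_marg E q y (A := E.image q) fun e he => Finset.mem_image_of_mem _ he
    rw [eq_neg_iff_add_eq_zero, add_eq_zero_iff_neg_eq] at h1 h2
    rw [← h1, ← h2, obj, mul_neg, Finset.mul_sum, ← sub_eq_add_neg, ← sub_eq_add_neg,
      ← Finset.sum_sub_distrib, ← Finset.sum_sub_distrib]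
    exact Finset.sum_congr rfl fun e _ => by ring
  rw [this]
  have c1 : ∀ a, Continuous fun y : ι → ℝ => Real.negMulLog (marg E p y a) :=
    fun a => Real.continuous_negMulLog.comp (hm p a)
  have c2 : ∀ a, Continuous fun y : ι → ℝ => Real.negMulLog (marg E q y a) :=
    fun a => Real.continuous_negMulLog.comp (hm q a)
  fun_prop

theorem exists_isDist_max (hE : E.Nonempty) (p : ι → α) (q : ι → β) (τ : ℝ) (u : α → ℝ)
    (w : β → ℝ) :
    ∃ y, IsDist E y ∧ ∀ z, IsDist E z → obj E p q τ u w z ≤ obj E p q τ u w y := by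
  classical
  have hc : IsCompact {y : ι → ℝ | IsDist E y} := by
    refine IsCompact.of_isClosed_subset
      (isCompact_univ_pi (s := fun e => if e ∈ E then Set.Icc (0 : ℝ) 1 else {0}) ?_) ?_ ?_
    · intro e; split_ifs
      · exact isCompact_Icc
      · exact isCompact_singleton
    · have : {y : ι → ℝ | IsDist E y} = (⋂ e, {y | 0 ≤ y e}) ∩ (⋂ e, ⋂ (_ : e ∉ E), {y | y e = 0})
          ∩ {y | ∑ e ∈ E, y e = 1} := by
        ext y
        simp only [Set.mem_ofPred_eq, Set.mem_inter_iff, Set.mem_iInter]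
        exact ⟨fun h => ⟨⟨h.1, h.2⟩, h.3⟩, fun h => ⟨h.1.1, h.1.2, h.2⟩⟩
      rw [this]
      refine IsClosed.inter (IsClosed.inter (isClosed_iInter fun e => ?_)
        (isClosed_iInter fun e => isClosed_iInter fun _ => ?_)) ?_
      · exact isClosed_le continuous_const (continuous_apply e)
      · exact isClosed_eq (continuous_apply e) continuous_const
      · exact isClosed_eq (by fun_prop) continuous_const
    · intro y hy e _
      simp only
      split_ifs with he
      · refine ⟨hy.nonneg e, ?_⟩
        rw [← hy.sum_eq]
        exact Finset.single_le_sum (fun e _ => hy.nonneg e) he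
      · exact hy.supp e he
  have hne : {y : ι → ℝ | IsDist E y}.Nonempty := by
    obtain ⟨e, he⟩ := hE
    refine ⟨Pi.single e 1, fun x => ?_, fun x hx => ?_, ?_⟩
    · by_cases h : x = e
      · subst h; simp
      · simp [h]
    · have : x ≠ e := fun h => hx (h ▸ he)
      simp [this]
    · simp [he]
  obtain ⟨y, hy, hmax⟩ := hc.exists_isMaxOn hne (continuous_obj E p q τ u w).continuousOn
  exact ⟨y, hy, fun z hz => hmax hz⟩

theorem IsDist.comb (hy : IsDist E y) (hz : IsDist E z) {x : ℝ} (h0 : 0 ≤ x) (h1 : x ≤ 1) :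
    IsDist E (fun e => (1 - x) * y e + x * z e) := by
  refine ⟨fun e => ?_, fun e he => ?_, ?_⟩
  · have := hy.nonneg e
    have := hz.nonneg e
    have : 0 ≤ 1 - x := by linarith
    positivity
  · simp [hy.supp e he, hz.supp e he]
  · rw [Finset.sum_add_distrib, ← Finset.mul_sum, ← Finset.mul_sum, hy.sum_eq, hz.sum_eq]; ring

theorem sum_marg_mul (y : ι → ℝ) (f : α → ℝ) {A : Finset α} (hA : ∀ e ∈ E, p e ∈ A) :
    ∑ a ∈ A, marg E p y a * f a = ∑ e ∈ E, y e * f (p e) := by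
  classical
  rw [← Finset.sum_fiberwise_of_maps_to hA]
  refine Finset.sum_congr rfl fun a _ => ?_
  rw [marg, Finset.sum_mul]
  refine Finset.sum_congr rfl fun e he => ?_
  rw [(Finset.mem_filter.1 he).2]

/-- First-order optimality, with the marginals of a slightly perturbed maximizer. -/
theorem sum_mul_log_div_marg_comb_le {τ : ℝ} (hτ : 0 ≤ τ) {u : α → ℝ} {w : β → ℝ}
    (hy : IsDist E y) (hmax : ∀ z, IsDist E z → obj E p q τ u w z ≤ obj E p q τ u w y)
    (hz : IsDist E z) {x : ℝ} (h0 : 0 < x) (h1 : x < 1) :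
    ∑ e ∈ E, z e * (τ * (Real.log (u (p e)) -
        Real.log (marg E p (fun e => (1 - x) * y e + x * z e) (p e))) +
      (Real.log (w (q e)) - Real.log (marg E q (fun e => (1 - x) * y e + x * z e) (q e)))) ≤
    obj E p q τ u w y := by
  classical
  set Y : ι → ℝ := fun e => (1 - x) * y e + x * z e with hY
  have hYd : IsDist E Y := hy.comb hz h0.le h1.le
  have hle : obj E p q τ u w Y ≤ obj E p q τ u w y := hmax _ hYd
  have gibbs : ∀ {γ : Type x} (f : ι → γ), ∑ e ∈ E, y e * (Real.log (marg E f Y (f e)) -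
      Real.log (marg E f y (f e))) ≤ 0 := by
    intro γ f
    have h := sum_mul_log_div_marg_le (p := f) hy (marg E f Y) (fun a => marg_nonneg hYd.nonneg a)
      (fun e he hpos => lt_of_lt_of_le (show 0 < Y e by
        have := hz.nonneg e
        have : 0 < 1 - x := by linarith
        simp only [hY]; positivity) (le_marg hYd.nonneg he)) (Z := 1)
      (A := E.image f) (fun e he => Finset.mem_image_of_mem _ he) (by
        have := sum_marg_mul (E := E) (p := f) Y (fun _ => 1) (A := E.image f)
          (fun e he => Finset.mem_image_of_mem _ he)
        simp only [mul_one] at this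
        rw [this, hYd.sum_eq])
    simpa using h
  set F : ι → ℝ := fun e => τ * (Real.log (u (p e)) - Real.log (marg E p Y (p e))) +
      (Real.log (w (q e)) - Real.log (marg E q Y (q e))) with hF
  have e1 : obj E p q τ u w Y = (1 - x) * ∑ e ∈ E, y e * F e + x * ∑ e ∈ E, z e * F e := by
    rw [Finset.mul_sum, Finset.mul_sum, ← Finset.sum_add_distrib]
    refine Finset.sum_congr rfl fun e _ => ?_
    simp only [hF, hY]; ring
  -- By Gibbs' inequality, replacing the marginals of `y` by those of `Y` inside the logarithms can
  -- only increase the average over `y`. Optimality of `y` against the mixture `Y` then leaves the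
  -- bound for the `z` part.
  have e2 : obj E p q τ u w y ≤ ∑ e ∈ E, y e * F e := by
    have g1 := gibbs p
    have g2 := gibbs q
    have : obj E p q τ u w y - ∑ e ∈ E, y e * F e =
        τ * ∑ e ∈ E, y e * (Real.log (marg E p Y (p e)) - Real.log (marg E p y (p e))) +
        ∑ e ∈ E, y e * (Real.log (marg E q Y (q e)) - Real.log (marg E q y (q e))) := by
      rw [obj, ← Finset.sum_sub_distrib, Finset.mul_sum, ← Finset.sum_add_distrib]
      refine Finset.sum_congr rfl fun e _ => ?_
      simp only [hF]; ring
    nlinarith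
  change ∑ e ∈ E, z e * F e ≤ _
  have : x * ∑ e ∈ E, z e * F e ≤ x * obj E p q τ u w y := by nlinarith
  exact le_of_mul_le_mul_left this h0

/-- Passing from an optimal distribution on `E` to any distribution on a subset `E'`, after the
weights have been damped by `exp (-φ)` and `exp (-ψ)`, the objective drops. -/
theorem obj_damped_le {τ : ℝ} (hτ : 0 ≤ τ) {u u' φ : α → ℝ} {w w' ψ : β → ℝ}
    (hy : IsDist E y) (hmax : ∀ z, IsDist E z → obj E p q τ u w z ≤ obj E p q τ u w y)
    (hE : E' ⊆ E) (hz : IsDist E' z)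
    (hu : ∀ e ∈ E', Real.log (u' (p e)) = Real.log (u (p e)) - φ (p e))
    (hw : ∀ e ∈ E', Real.log (w' (q e)) = Real.log (w (q e)) - ψ (q e)) :
    obj E' p q τ u' w' z ≤ obj E p q τ u w y +
      τ * Real.log (∑ e ∈ E, y e * Real.exp (-φ (p e))) +
      Real.log (∑ e ∈ E, y e * Real.exp (-ψ (q e))) := by
  classical
  have hz' := hz.mono hE
  -- The maximizer may vanish where `z` is positive; a marginal could then be zero and its `log` the
  -- default value 0. Mixing in a little `z` avoids this, and `x → 0` is taken at the end.
  have key : ∀ x : ℝ, 0 < x → x < 1 → obj E' p q τ u' w' z ≤ obj E p q τ u w y +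
      τ * Real.log (∑ e ∈ E, ((1 - x) * y e + x * z e) * Real.exp (-φ (p e))) +
      Real.log (∑ e ∈ E, ((1 - x) * y e + x * z e) * Real.exp (-ψ (q e))) := by
    intro x h0 h1
    set Y : ι → ℝ := fun e => (1 - x) * y e + x * z e with hY
    have hYd : IsDist E Y := hy.comb hz' h0.le h1.le
    have h3 := sum_mul_log_div_marg_comb_le hτ hy hmax hz' h0 h1
    have hpos : ∀ e ∈ E, 0 < z e → 0 < Y e := by
      intro e _ hpos
      have := hy.nonneg e
      have : 0 < 1 - x := by linarith
      simp only [hY]; positivity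
    have gibbs : ∀ {γ : Type x} (f : ι → γ) (χ : γ → ℝ), ∑ e ∈ E, z e * (Real.log
        (marg E f Y (f e)) - χ (f e) - Real.log (marg E f z (f e))) ≤
        Real.log (∑ e ∈ E, Y e * Real.exp (-χ (f e))) := by
      intro γ f χ
      have h := sum_mul_log_div_marg_le (p := f) hz'
        (fun a => marg E f Y a * Real.exp (-χ a))
        (fun a => mul_nonneg (marg_nonneg hYd.nonneg a) (Real.exp_pos _).le)
        (fun e he hp => mul_pos (lt_of_lt_of_le (hpos e he hp) (le_marg hYd.nonneg he))
          (Real.exp_pos _))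
        (A := E.image f) (fun e he => Finset.mem_image_of_mem _ he)
        (sum_marg_mul (E := E) (p := f) Y (fun a => Real.exp (-χ a)) (A := E.image f)
          (fun e he => Finset.mem_image_of_mem _ he)).le
      refine le_trans (le_of_eq (Finset.sum_congr rfl fun e he => ?_)) h
      rcases (hz.nonneg e).eq_or_lt with h0 | h0
      · simp [← h0]
      · have hm : 0 < marg E f Y (f e) := lt_of_lt_of_le (hpos e he h0) (le_marg hYd.nonneg he)
        rw [Real.log_mul hm.ne' (Real.exp_pos _).ne', Real.log_exp]
        ring
    have g1 := gibbs p φ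
    have g2 := gibbs q ψ
    have e0 : obj E' p q τ u' w' z = ∑ e ∈ E, z e * (τ * (Real.log (u (p e)) - φ (p e) -
        Real.log (marg E p z (p e))) + (Real.log (w (q e)) - ψ (q e) -
        Real.log (marg E q z (q e)))) := by
      rw [obj, Finset.sum_subset hE fun e _ h' => by rw [hz.supp e h', zero_mul]]
      refine Finset.sum_congr rfl fun e _ => ?_
      by_cases h : e ∈ E'
      · rw [hu e h, hw e h, marg_mono_set hz.supp hE, marg_mono_set hz.supp hE]
      · rw [hz.supp e h, zero_mul, zero_mul]
    have e1 : obj E' p q τ u' w' z = (∑ e ∈ E, z e * (τ * (Real.log (u (p e)) -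
        Real.log (marg E p Y (p e))) + (Real.log (w (q e)) - Real.log (marg E q Y (q e))))) +
        τ * ∑ e ∈ E, z e * (Real.log (marg E p Y (p e)) - φ (p e) - Real.log (marg E p z (p e))) +
        ∑ e ∈ E, z e * (Real.log (marg E q Y (q e)) - ψ (q e) - Real.log (marg E q z (q e))) := by
      rw [e0, Finset.mul_sum, ← Finset.sum_add_distrib, ← Finset.sum_add_distrib]
      exact Finset.sum_congr rfl fun e _ => by ring
    rw [e1]
    have := mul_le_mul_of_nonneg_left g1 hτ
    linarith
  have hpos : ∀ {γ : Type x} (f : ι → γ) (χ : γ → ℝ),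
      0 < ∑ e ∈ E, y e * Real.exp (-χ (f e)) := by
    intro γ f χ
    obtain ⟨e, he, hye⟩ : ∃ e ∈ E, 0 < y e := by
      by_contra! h
      have := Finset.sum_nonpos h
      rw [hy.sum_eq] at this; linarith
    exact Finset.sum_pos' (fun e _ => mul_nonneg (hy.nonneg e) (Real.exp_pos _).le)
      ⟨e, he, mul_pos hye (Real.exp_pos _)⟩
  have hlim : ∀ {γ : Type x} (f : ι → γ) (χ : γ → ℝ), Filter.Tendsto (fun x : ℝ => Real.log
      (∑ e ∈ E, ((1 - x) * y e + x * z e) * Real.exp (-χ (f e)))) (nhdsWithin 0 (Set.Ioi 0))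
      (nhds (Real.log (∑ e ∈ E, y e * Real.exp (-χ (f e))))) := by
    intro γ f χ
    have hc : Continuous fun x : ℝ => ∑ e ∈ E, ((1 - x) * y e + x * z e) * Real.exp (-χ (f e)) := by
      fun_prop
    have := (hc.tendsto 0).mono_left (nhdsWithin_le_nhds (s := Set.Ioi 0))
    simp only [sub_zero, one_mul, zero_mul, add_zero] at this
    exact this.log (hpos f χ).ne'
  have hl := (((hlim p φ).const_mul τ).const_add (obj E p q τ u w y)).add (hlim q ψ)
  refine ge_of_tendsto hl ?_
  have : Set.Ioo (0 : ℝ) 1 ∈ nhdsWithin (0 : ℝ) (Set.Ioi 0) := Ioo_mem_nhdsGT one_pos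
  filter_upwards [this] with x hx
  exact key x hx.1 hx.2

/-- An antitone sequence bounded below by `f` has few steps of drop at least `a`, and few steps of
drop at least `b` if these occur only close to the bound. -/
theorem card_steps_le {O : ℕ → ℝ} {T : ℕ} {f a b X0 X1 : ℝ} (S : Finset ℕ) (hS : ∀ t ∈ S, t < T)
    (ha : 0 < a) (hb : 0 < b) (hX1 : 0 ≤ X1) (hanti : ∀ t < T, O (t + 1) ≤ O t)
    (hf : f ≤ O T) (h0 : O 0 - f ≤ X0)
    (hstep : ∀ t ∈ S, O (t + 1) ≤ O t - a ∨ (O (t + 1) ≤ O t - b ∧ O t - f ≤ X1)) :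
    (S.card : ℝ) ≤ X0 / a + X1 / b := by
  classical
  have hanti' : ∀ i j, i ≤ j → j ≤ T → O j ≤ O i := by
    intro i j hij
    induction j, hij using Nat.le_induction with
    | base => intro _; exact le_rfl
    | succ j _ ih => intro hj; exact (hanti j hj).trans (ih (by omega))
  -- counting drops of size `a`
  have cnt : ∀ (a : ℝ) (A : Finset ℕ) (i : ℕ), (∀ t ∈ A, i ≤ t ∧ t < T) →
      (∀ t ∈ A, O (t + 1) ≤ O t - a) → i ≤ T → A.card * a ≤ O i - O T := by
    intro a A i h1 h2 hi
    have : ∑ t ∈ A, a ≤ ∑ t ∈ Finset.Ico i T, (O t - O (t + 1)) := by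
      refine (Finset.sum_le_sum fun t ht => ?_).trans (Finset.sum_le_sum_of_subset_of_nonneg
        (f := fun t => O t - O (t + 1)) (fun t ht => Finset.mem_Ico.2 (h1 t ht))
        fun t ht _ => ?_)
      · have := h2 t ht; linarith
      · have := hanti t (Finset.mem_Ico.1 ht).2; linarith
    rw [Finset.sum_const, nsmul_eq_mul] at this
    have tel : ∑ t ∈ Finset.Ico i T, (O t - O (t + 1)) = O i - O T := by
      rw [← neg_inj, ← Finset.sum_neg_distrib]
      simp only [neg_sub]
      exact Finset.sum_Ico_sub O hi
    linarith
  set A := S.filter fun t => O (t + 1) ≤ O t - a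
  set D := S.filter fun t => ¬ O (t + 1) ≤ O t - a
  have hA : (A.card : ℝ) ≤ X0 / a := by
    rw [le_div_iff₀ ha]
    have := cnt a A 0 (fun t ht => ⟨by omega, hS t (Finset.mem_filter.1 ht).1⟩)
      (fun t ht => (Finset.mem_filter.1 ht).2) (by omega)
    linarith
  have hD : (D.card : ℝ) ≤ X1 / b := by
    rw [le_div_iff₀ hb]
    rcases D.eq_empty_or_nonempty with h | h
    · rw [h]; simpa using hX1
    · have hDm : ∀ t ∈ D, O (t + 1) ≤ O t - b ∧ O t - f ≤ X1 := fun t ht => by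
        have := Finset.mem_filter.1 ht
        exact (hstep t this.1).resolve_left this.2
      -- From the earliest of these steps on, only `X1` is left above the bound `f`.
      have hm := D.min'_mem h
      have := cnt b D (D.min' h) (fun t ht => ⟨D.min'_le t ht, hS t (Finset.mem_filter.1 ht).1⟩)
        (fun t ht => (hDm t ht).1) (hS _ (Finset.mem_filter.1 hm).1).le
      have := (hDm _ hm).2
      linarith
  have : S.card = A.card + D.card := (Finset.card_filter_add_card_filter_not _).symm
  rw [this]; push_cast; linarith

end Entropy

/-! ### The proposal process -/

/-- The ball of radius `r` in the graph with neighbourhoods `nb`. -/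
def ball (nb : ℕ → Finset ℕ) : ℕ → ℕ → Finset ℕ
  | 0, v => {v}
  | r + 1, v => insert v ((nb v).biUnion (ball nb r))

/-- Parameters: `R` learner types, `M` indices for sampling, `B` and `P` the threshold base and the
number of phases of the vertex cover, `N` the bound on the number of vertices, `K` and `τ` the
learning parameters. -/
structure Par where
  R : ℕ
  M : ℕ
  B : ℕ
  P : ℕ
  N : ℕ
  K : ℝ
  τ : ℝ

/-- Labels: a role (`true` for senders), a learner type and an index. -/
abbrev Lab : Type := Bool × ℕ × ℕ

/-- State of the process: partners, snapshots of the unmatched vertices for each learner type, and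
the weights of the learners. -/
structure St where
  ptn : ℕ → Option ℕ
  al : ℕ → ℕ → Prop
  u : ℕ → ℕ → ℕ → ℝ
  w : ℕ → ℕ → ℝ

namespace Proposal

open scoped Classical

variable (nb : ℕ → Finset ℕ) (par : Par)

/-- Peeling off the vertices of high degree, with decreasing thresholds. -/
def remains : ℕ → ℕ → Prop
  | 0, _ => True
  | t + 1, v => remains t v ∧ ((nb v).filter (remains t)).card * par.B ^ (t + 1) < par.N

def inCover (v : ℕ) : Prop := ¬ remains nb par par.P v

/-- A maximizer of the objective, or the zero function if there is none. -/
noncomputable def opt (E : Finset (ℕ × ℕ)) (τ : ℝ) (u w : ℕ → ℝ) : ℕ × ℕ → ℝ :=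
  if h : ∃ y, IsDist E y ∧ ∀ z, IsDist E z →
      obj E Prod.fst Prod.snd τ u w z ≤ obj E Prod.fst Prod.snd τ u w y
  then h.choose else 0

/-- A map which takes each value `b ∈ s` exactly `k b` times on `0, …, M - 1`, if there is one. -/
noncomputable def pick (M : ℕ) (s : Finset ℕ) (k : ℕ → ℕ) : ℕ → Option ℕ :=
  if h : ∃ φ : ℕ → Option ℕ, (∀ b ∈ s, ((Finset.range M).filter (fun i => φ i = some b)).card = k b)
      ∧ ∀ i b, φ i = some b → b ∈ s
  then h.choose else fun _ => none

variable (st : St)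

/-- Eligibility is read from the snapshot `al` and not from the current partners, so that a plan
does not change between two updates of its type. -/
noncomputable def edges (ρ c : ℕ) : Finset (ℕ × ℕ) :=
  (ball nb ρ c ×ˢ ball nb (ρ + 1) c).filter fun e =>
    e.2 ∈ nb e.1 ∧ inCover nb par e.1 ∧ st.al ρ e.1 ∧ st.al ρ e.2

noncomputable def plan (ρ c : ℕ) : ℕ × ℕ → ℝ :=
  opt (edges nb par st ρ c) par.τ (st.u ρ c) (st.w ρ)

/-- The conditional distribution that learner `c` proposes to the sender `a`. -/
noncomputable def send (ρ c a b : ℕ) : ℝ :=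
  plan nb par st ρ c (a, b) / marg (edges nb par st ρ c) Prod.fst (plan nb par st ρ c) a

/-- The average of the proposals of the learners around `a`. -/
noncomputable def avg (ρ a b : ℕ) : ℝ :=
  (∑ c ∈ ball nb ρ a, send nb par st ρ c a b) / (ball nb ρ a).card

noncomputable def num (ρ a b : ℕ) : ℕ := ⌊par.M * avg nb par st ρ a b⌋₊

/-- The proposal of `a`, rounded down to a multiple of `1 / M`. -/
noncomputable def qt (ρ a b : ℕ) : ℝ := num nb par st ρ a b / par.M

def alive (v : ℕ) : Prop := st.ptn v = none

noncomputable def senders (b : ℕ) : Finset ℕ :=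
  (nb b).filter fun a => alive st a ∧ inCover nb par a

noncomputable def load (ρ b : ℕ) : ℝ := ∑ a ∈ senders nb par st b, qt nb par st ρ a b

/-- Load below 1 means that a proposer meets no competitor with probability at least one half; load
at least 1 means that `b` itself has a fair chance of an offer. -/
def free (ρ b : ℕ) : Prop := alive st b ∧ load nb par st ρ b < 1

noncomputable def slack (ρ c a : ℕ) : ℝ :=
  ∑ b ∈ (nb a).filter (free nb par st ρ), send nb par st ρ c a b

/-- Such a sender needs no further attention from the learner: it is matched, or the proposal of
this learner reaches free receivers with substantial mass. -/
def gold (ρ c a : ℕ) : Prop := ¬ alive st a ∨ 1 / par.K ≤ slack nb par st ρ c a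

variable (t : ℕ) (d : ℕ → Lab)

noncomputable def target (a : ℕ) : Option ℕ :=
  if alive st a ∧ inCover nb par a ∧ (d a).1 = true ∧ (d a).2.1 < par.R ∧ (d a).2.1 + 1 ∣ t
  then pick par.M (nb a) (num nb par st (d a).2.1 a) (d a).2.2 else none

noncomputable def offers (b : ℕ) : Finset ℕ :=
  (nb b).filter fun a => target nb par st t d a = some b ∧ (d a).2.1 = (d b).2.1

noncomputable def accept (b : ℕ) : Option ℕ :=
  if h : (alive st b ∧ (d b).1 = false) ∧ (offers nb par st t d b).Nonempty
  then some ((offers nb par st t d b).min' h.2) else none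

noncomputable def newPtn (v : ℕ) : Option ℕ :=
  if (accept nb par st t d v).isSome then accept nb par st t d v
  else if ∃ b, target nb par st t d v = some b ∧ accept nb par st t d b = some v
  then target nb par st t d v else none

/-- One step of the process. -/
noncomputable def step : St where
  ptn v := if st.ptn v = none then newPtn nb par st t d v else st.ptn v
  al ρ v := if ρ + 1 ∣ t then alive st v else st.al ρ v
  u ρ c a := if ρ + 1 ∣ t ∧ gold nb par st ρ c a then st.u ρ c a * Real.exp (-1) else st.u ρ c a
  w ρ b := if ρ + 1 ∣ t ∧ ¬ free nb par st ρ b then st.w ρ b / par.K else st.w ρ b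

/-- With these weights every vertex distributes a total of one over the learners that see it. -/
noncomputable def start : St where
  ptn _ := none
  al _ _ := True
  u ρ _ a := 1 / (ball nb ρ a).card
  w ρ b := 1 / (ball nb (ρ + 1) b).card

/-- The state after `t` steps, when vertex `v` uses the label `lab v t` in step `t`. -/
noncomputable def state (lab : ℕ → ℕ → Lab) : ℕ → St
  | 0 => start nb
  | t + 1 => step nb par (state lab t) t fun v => lab v t

end Proposal

/-! ### Locality: how far each quantity depends on the graph -/

/-- A labelled graph on `ℕ`. -/
structure Conf where
  nb : ℕ → Finset ℕ
  lab : ℕ → ℕ → Lab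

namespace Conf

/-- `C` and `C'` look alike from `v` up to distance `r`. -/
def agree (C C' : Conf) : ℕ → ℕ → Prop
  | 0, v => C.lab v = C'.lab v
  | r + 1, v => agree C C' r v ∧ C.nb v = C'.nb v ∧ ∀ u ∈ C.nb v, agree C C' r u

variable {C C' : Conf}

theorem agree.mono {m n v : ℕ} (h : agree C C' n v) (hmn : m ≤ n) : agree C C' m v := by
  induction n, hmn using Nat.le_induction with
  | base => exact h
  | succ n _ ih => exact ih h.1

theorem agree.lab {n v : ℕ} (h : agree C C' n v) : C.lab v = C'.lab v :=
  h.mono (Nat.zero_le n)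

theorem agree.nb {n v : ℕ} (h : agree C C' n v) (hn : 1 ≤ n) : C.nb v = C'.nb v :=
  (h.mono hn).2.1

theorem agree.adj {n v u : ℕ} (h : agree C C' (n + 1) v) (hu : u ∈ C.nb v) : agree C C' n u :=
  h.2.2 u hu

theorem agree.ball {n j v : ℕ} (h : agree C C' n v) (hj : j ≤ n) :
    ball C.nb j v = ball C'.nb j v := by
  induction j generalizing n v with
  | zero => rfl
  | succ j ih =>
    have h' := h.mono hj
    rw [_root_.ball, _root_.ball, ← h'.2.1]
    congr 1
    exact Finset.biUnion_congr rfl fun u hu => ih (h'.2.2 u hu) le_rfl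

theorem agree.of_mem_ball {n j v u : ℕ} (h : agree C C' (n + j) v) (hu : u ∈ _root_.ball C.nb j v) :
    agree C C' n u := by
  induction j generalizing v with
  | zero => rw [_root_.ball, Finset.mem_singleton] at hu; exact hu ▸ h
  | succ j ih =>
    rw [_root_.ball, Finset.mem_insert, Finset.mem_biUnion] at hu
    rcases hu with rfl | ⟨x, hx, hu⟩
    · exact h.mono (by omega)
    · exact ih (h.2.2 x hx) hu

end Conf

namespace Proposal

open scoped Classical
open Conf

variable {C C' : Conf} {par : Par} {st st' : St}

theorem remains_congr {t n v : ℕ} (h : agree C C' n v) (ht : t ≤ n) :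
    remains C.nb par t v ↔ remains C'.nb par t v := by
  induction t generalizing n v with
  | zero => rfl
  | succ t ih =>
    have h' := h.mono ht
    rw [remains, remains, ih h (by omega), ← h'.2.1]
    rw [Finset.filter_congr fun u hu => ih (h'.2.2 u hu) le_rfl]

theorem inCover_congr {n v : ℕ} (h : agree C C' n v) (ht : par.P ≤ n) :
    inCover C.nb par v ↔ inCover C'.nb par v :=
  not_congr (remains_congr h ht)

theorem obj_congr {E : Finset (ℕ × ℕ)} {τ : ℝ} {u u' w w' : ℕ → ℝ}
    (hu : ∀ e ∈ E, u e.1 = u' e.1) (hw : ∀ e ∈ E, w e.2 = w' e.2) :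
    obj E Prod.fst Prod.snd τ u w = obj E Prod.fst Prod.snd τ u' w' := by
  funext y
  exact Finset.sum_congr rfl fun e he => by rw [hu e he, hw e he]

/-- The maximizer is selected by choice, but the selection depends only on the edge set and the
objective; nodes that simulate the same learner therefore obtain the same plan. -/
theorem opt_congr {E : Finset (ℕ × ℕ)} {τ : ℝ} {u u' w w' : ℕ → ℝ}
    (hu : ∀ e ∈ E, u e.1 = u' e.1) (hw : ∀ e ∈ E, w e.2 = w' e.2) :
    opt E τ u w = opt E τ u' w' := by
  rw [opt, opt, obj_congr hu hw]

theorem pick_congr {M : ℕ} {s : Finset ℕ} {k k' : ℕ → ℕ} (h : ∀ b ∈ s, k b = k' b) :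
    pick M s k = pick M s k' := by
  have : ∀ φ : ℕ → Option ℕ, (∀ b ∈ s,
      ((Finset.range M).filter (fun i => φ i = some b)).card = k b) ↔ (∀ b ∈ s,
      ((Finset.range M).filter (fun i => φ i = some b)).card = k' b) :=
    fun φ => forall₂_congr fun b hb => by rw [h b hb]
  unfold pick
  simp only [this]

section

/-- The data of the learners of type `ρ` coincide wherever the views of radius `m` do. -/
structure DataEq (C C' : Conf) (st st' : St) (ρ m : ℕ) : Prop where
  al : ∀ v, agree C C' m v → (st.al ρ v ↔ st'.al ρ v)
  u : ∀ c, agree C C' m c → ∀ a ∈ ball C.nb ρ c, st.u ρ c a = st'.u ρ c a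
  w : ∀ v, agree C C' m v → st.w ρ v = st'.w ρ v

/-- The partners coincide wherever the views of radius `m` do. -/
def PtnEq (C C' : Conf) (st st' : St) (m : ℕ) : Prop :=
  ∀ v, agree C C' m v → st.ptn v = st'.ptn v

variable {ρ m n t : ℕ}

theorem edges_congr (h : DataEq C C' st st' ρ m) {c : ℕ} (hm : par.P ≤ m) (hm' : 1 ≤ m)
    (hc : agree C C' (m + (ρ + 1)) c) :
    edges C.nb par st ρ c = edges C'.nb par st' ρ c := by
  rw [edges, edges, hc.ball (j := ρ) (by omega), hc.ball (j := ρ + 1) (by omega)]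
  refine Finset.filter_congr fun e he => ?_
  rw [Finset.mem_product, ← hc.ball (j := ρ) (by omega), ← hc.ball (j := ρ + 1) (by omega)] at he
  have h1 : agree C C' m e.1 := (hc.mono (by omega) : agree C C' (m + ρ) c).of_mem_ball he.1
  have h2 : agree C C' m e.2 := hc.of_mem_ball he.2
  rw [h1.nb hm', inCover_congr h1 hm, h.al _ h1, h.al _ h2]

theorem plan_congr (h : DataEq C C' st st' ρ m) {c : ℕ} (hm : par.P ≤ m) (hm' : 1 ≤ m)
    (hc : agree C C' (m + (ρ + 1)) c) :
    plan C.nb par st ρ c = plan C'.nb par st' ρ c := by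
  rw [plan, plan, ← edges_congr h hm hm' hc]
  refine opt_congr (fun e he => ?_) fun e he => ?_
  · have := Finset.mem_product.1 (Finset.mem_filter.1 he).1
    exact h.u c (hc.mono (by omega)) _ this.1
  · have := Finset.mem_product.1 (Finset.mem_filter.1 he).1
    exact h.w _ (hc.of_mem_ball this.2)

theorem send_congr (h : DataEq C C' st st' ρ m) {c : ℕ} (hm : par.P ≤ m) (hm' : 1 ≤ m)
    (hc : agree C C' (m + (ρ + 1)) c) (a b : ℕ) :
    send C.nb par st ρ c a b = send C'.nb par st' ρ c a b := by
  rw [send, send, plan_congr h hm hm' hc, edges_congr h hm hm' hc]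

/-- A sender consults learners at distance `ρ`, and these use data at distance `ρ + 1` from their
centres. -/
theorem num_congr (h : DataEq C C' st st' ρ m) {a : ℕ} (hm : par.P ≤ m) (hm' : 1 ≤ m)
    (ha : agree C C' (m + (2 * ρ + 1)) a) (b : ℕ) :
    num C.nb par st ρ a b = num C'.nb par st' ρ a b := by
  rw [num, num, avg, avg, ← ha.ball (j := ρ) (by omega)]
  congr 3
  refine Finset.sum_congr rfl fun c hc => ?_
  exact send_congr h hm hm'
    ((ha.mono (by omega) : agree C C' (m + (ρ + 1) + ρ) a).of_mem_ball hc) a b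

theorem free_congr (h : DataEq C C' st st' ρ m) (h' : PtnEq C C' st st' n) {b : ℕ}
    (hm : par.P ≤ m) (hm' : 1 ≤ m) (hmb : agree C C' (m + (2 * ρ + 2)) b)
    (hnb : agree C C' (n + 1) b) :
    free C.nb par st ρ b ↔ free C'.nb par st' ρ b := by
  have : load C.nb par st ρ b = load C'.nb par st' ρ b := by
    have hs : senders C.nb par st b = senders C'.nb par st' b := by
      rw [senders, senders, ← hmb.nb (by omega)]
      refine Finset.filter_congr fun a ha => ?_
      rw [alive, alive, h' a (hnb.adj ha),
        inCover_congr ((hmb.adj ha).mono (Nat.le_add_right m _)) hm]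
    rw [load, load, ← hs]
    refine Finset.sum_congr rfl fun a ha => ?_
    rw [qt, qt, num_congr h hm hm' (hmb.adj (Finset.mem_filter.1 ha).1)]
  rw [free, free, this, alive, alive, h' b (hnb.mono (by omega))]

/-- The distances add up: `ρ` from the centre to `a`, one to a receiver, one to the senders that
load it, and `2 * ρ + 1` for their proposals. -/
theorem gold_congr (h : DataEq C C' st st' ρ m) (h' : PtnEq C C' st st' n) {c a : ℕ}
    (hm : par.P ≤ m) (hm' : 1 ≤ m) (hmc : agree C C' (m + (3 * ρ + 3)) c)
    (hnc : agree C C' (n + (ρ + 2)) c) (ha : a ∈ ball C.nb ρ c) :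
    gold C.nb par st ρ c a ↔ gold C'.nb par st' ρ c a := by
  have h1 : agree C C' (m + (2 * ρ + 3)) a :=
    (hmc.mono (by omega) : agree C C' (m + (2 * ρ + 3) + ρ) c).of_mem_ball ha
  have h2 : agree C C' (n + 2) a :=
    (hnc.mono (by omega) : agree C C' (n + 2 + ρ) c).of_mem_ball ha
  have : slack C.nb par st ρ c a = slack C'.nb par st' ρ c a := by
    rw [slack, slack, ← h1.nb (by omega)]
    refine Finset.sum_congr (Finset.filter_congr fun b hb => ?_) fun b _ => ?_
    · exact free_congr h h' hm hm' (h1.adj hb) (h2.adj hb)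
    · exact send_congr h hm hm' (hmc.mono (by omega)) a b
  rw [gold, gold, this, alive, alive, h' a (h2.mono (by omega))]

variable {d d' : ℕ → Lab}

theorem target_congr (h : ∀ ρ < par.R, ρ + 1 ∣ t → ∃ m, DataEq C C' st st' ρ m ∧ par.P ≤ m ∧ 1 ≤ m ∧
    m + (2 * ρ + 1) ≤ n) (h' : PtnEq C C' st st' n) (hP : par.P ≤ n) (hn : 1 ≤ n)
    (hd : ∀ v n, agree C C' n v → d v = d' v) {a : ℕ} (ha : agree C C' n a) :
    target C.nb par st t d a = target C'.nb par st' t d' a := by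
  have e : alive st a ↔ alive st' a := by rw [alive, alive, h' a ha]
  rw [target, target, hd a n ha]
  by_cases hc : alive st' a ∧ inCover C'.nb par a ∧ (d' a).1 = true ∧ (d' a).2.1 < par.R ∧
      (d' a).2.1 + 1 ∣ t
  · rw [if_pos hc, if_pos (by rwa [e, inCover_congr ha hP])]
    obtain ⟨m, hdat, h1, h2, h3⟩ := h _ hc.2.2.2.1 hc.2.2.2.2
    rw [pick_congr fun b _ => num_congr hdat h1 h2 (ha.mono h3) b, ha.nb hn]
  · rw [if_neg hc, if_neg (by rwa [e, inCover_congr ha hP])]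

theorem accept_congr (h : ∀ ρ < par.R, ρ + 1 ∣ t → ∃ m, DataEq C C' st st' ρ m ∧ par.P ≤ m ∧ 1 ≤ m ∧
    m + (2 * ρ + 1) ≤ n) (h' : PtnEq C C' st st' n) (hP : par.P ≤ n) (hn : 1 ≤ n)
    (hd : ∀ v n, agree C C' n v → d v = d' v) {b : ℕ} (hb : agree C C' (n + 1) b) :
    accept C.nb par st t d b = accept C'.nb par st' t d' b := by
  have : offers C.nb par st t d b = offers C'.nb par st' t d' b := by
    rw [offers, offers, ← hb.nb (by omega), hd b _ hb]
    refine Finset.filter_congr fun a ha => ?_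
    rw [target_congr h h' hP hn hd (hb.adj ha), hd a _ (hb.adj ha)]
  have e : alive st b ↔ alive st' b := by rw [alive, alive, h' b (hb.mono (by omega))]
  simp only [accept, this, e, hd b _ hb]

theorem pick_mem {M : ℕ} {s : Finset ℕ} {k : ℕ → ℕ} {i b : ℕ} (h : pick M s k i = some b) :
    b ∈ s := by
  unfold pick at h
  split_ifs at h with hc
  exact hc.choose_spec.2 i b h

theorem target_mem {nb : ℕ → Finset ℕ} {a b : ℕ} (h : target nb par st t d a = some b) :
    b ∈ nb a := by
  unfold target at h
  split_ifs at h
  exact pick_mem h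

/-- One of the two extra units of radius tells a receiver what its neighbours target, the other
tells a sender whether it was accepted. -/
theorem step_ptn_congr (h : ∀ ρ < par.R, ρ + 1 ∣ t → ∃ m, DataEq C C' st st' ρ m ∧ par.P ≤ m ∧
    1 ≤ m ∧ m + (2 * ρ + 1) ≤ n) (h' : PtnEq C C' st st' n) (hP : par.P ≤ n) (hn : 1 ≤ n)
    (hd : ∀ v n, agree C C' n v → d v = d' v) :
    PtnEq C C' (step C.nb par st t d) (step C'.nb par st' t d') (n + 2) := by
  intro v hv
  have e1 := accept_congr h h' hP hn hd (hv.mono (by omega) : agree C C' (n + 1) v)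
  have e2 := target_congr h h' hP hn hd (hv.mono (by omega) : agree C C' n v)
  have : newPtn C.nb par st t d v = newPtn C'.nb par st' t d' v := by
    have : (∃ b, target C'.nb par st' t d' v = some b ∧ accept C.nb par st t d b = some v) ↔
        ∃ b, target C'.nb par st' t d' v = some b ∧ accept C'.nb par st' t d' b = some v := by
      refine exists_congr fun b => and_congr_right fun hb => ?_
      rw [← e2] at hb
      rw [accept_congr h h' hP hn hd (hv.adj (target_mem hb))]
    simp only [newPtn, e1, e2, this]
  simp only [step, this, h' v (hv.mono (by omega))]

theorem step_data_congr (h : DataEq C C' st st' ρ m) (h' : PtnEq C C' st st' n)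
    (hP : par.P ≤ m) (hm : 1 ≤ m) {k : ℕ} (hk : m + (3 * ρ + 3) ≤ k) (hk' : n + (ρ + 2) ≤ k) :
    DataEq C C' (step C.nb par st t d) (step C'.nb par st' t d') ρ k := by
  refine ⟨fun v hv => ?_, fun c hc a ha => ?_, fun v hv => ?_⟩
  · simp only [step, alive, h' v (hv.mono (by omega)), h.al v (hv.mono (by omega))]
  · simp only [step, gold_congr h h' hP hm (hc.mono hk) (hc.mono hk') ha,
      h.u c (hc.mono (by omega)) a ha]
  · simp only [step, free_congr h h' hP hm (hv.mono (by omega)) (hv.mono (by omega)),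
      h.w v (hv.mono (by omega))]

theorem step_data_congr_of_not_dvd (h : DataEq C C' st st' ρ m) (ht : ¬ ρ + 1 ∣ t) :
    DataEq C C' (step C.nb par st t d) (step C'.nb par st' t d') ρ m := by
  refine ⟨fun v hv => ?_, fun c hc a ha => ?_, fun v hv => ?_⟩
  · simp only [step, ht, if_false, h.al v hv]
  · simp only [step, ht, false_and, if_false, h.u c hc a ha]
  · simp only [step, ht, false_and, if_false, h.w v hv]

/-- The number of rounds that suffices for `t` steps. -/
def radius (par : Par) (t : ℕ) : ℕ := par.P + 4 * par.R + 1 + 4 * t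

/-- The term `(ρ + 1) * ((t + ρ) / (ρ + 1))` is `t` rounded up to a multiple of `ρ + 1`. An update
of type `ρ` may extend the radius by `4 * (ρ + 1)` but occurs only once in `ρ + 1` steps, so no type
gets ahead of 4 per step. The constant offsets leave room for `2 * ρ + 1` when the partners use the
data, and for `ρ + 2` when the data use the partners. -/
theorem state_congr (t : ℕ) : PtnEq C C' (state C.nb par C.lab t) (state C'.nb par C'.lab t)
      (radius par t) ∧
    ∀ ρ < par.R, DataEq C C' (state C.nb par C.lab t) (state C'.nb par C'.lab t) ρ
      (par.P + 4 * (par.R - (ρ + 1)) + 1 + 2 * (ρ + 1) + 4 * ((ρ + 1) * ((t + ρ) / (ρ + 1)))) := by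
  induction t with
  | zero =>
    refine ⟨fun v _ => rfl, fun ρ hρ => ?_⟩
    have : (0 + ρ) / (ρ + 1) = 0 := Nat.div_eq_of_lt (by omega)
    rw [this]
    refine ⟨fun v _ => Iff.rfl, fun c hc a ha => ?_, fun v hv => ?_⟩
    · have : agree C C' ρ a :=
        (hc.mono (by omega) : agree C C' (ρ + ρ) c).of_mem_ball ha
      simp only [state, start, this.ball le_rfl]
    · simp only [state, start, hv.ball (show ρ + 1 ≤ _ by omega)]
  | succ t ih =>
    obtain ⟨ih1, ih2⟩ := ih
    have hexec : ∀ ρ, ρ + 1 ∣ t → (ρ + 1) * ((t + ρ) / (ρ + 1)) = t ∧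
        (ρ + 1) * ((t + 1 + ρ) / (ρ + 1)) = t + (ρ + 1) := by
      rintro ρ ⟨k, rfl⟩
      rw [Nat.mul_add_div (by omega), Nat.div_eq_of_lt (show ρ < ρ + 1 by omega), add_assoc,
        Nat.mul_add_div (by omega), add_comm 1 ρ, Nat.div_self (by omega)]
      constructor <;> ring
    have hd : ∀ v n, agree C C' n v → C.lab v t = C'.lab v t := fun v n h => by rw [h.lab]
    constructor
    · have := step_ptn_congr (t := t) (n := radius par t) (d := fun v => C.lab v t)
        (d' := fun v => C'.lab v t) (fun ρ hρ hdvd => ⟨_, ih2 ρ hρ, by omega, by omega, by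
          rw [(hexec ρ hdvd).1, radius]; omega⟩) ih1 (by rw [radius]; omega)
        (by rw [radius]; omega) hd
      exact fun v hv => this v (hv.mono (by simp only [radius]; omega))
    · intro ρ hρ
      by_cases hdvd : ρ + 1 ∣ t
      · rw [(hexec ρ hdvd).2]
        refine step_data_congr (ih2 ρ hρ) ih1 (by omega) (by omega) ?_ ?_
        · rw [(hexec ρ hdvd).1]; omega
        · rw [radius]; omega
      · have : (t + 1 + ρ) / (ρ + 1) = (t + ρ) / (ρ + 1) := by
          have h1 : t + 1 + ρ = t + (ρ + 1) := by ring
          rw [h1, Nat.add_div_right _ (by omega)]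
          have h2 := Nat.div_add_mod t (ρ + 1)
          have h3 : 0 < t % (ρ + 1) := Nat.pos_of_ne_zero fun h => hdvd (Nat.dvd_of_mod_eq_zero h)
          have h4 := Nat.mod_lt t (show ρ + 1 > 0 by omega)
          symm
          apply Nat.div_eq_of_lt_le
          · rw [Nat.succ_mul, mul_comm]; omega
          · rw [Nat.succ_mul, Nat.succ_mul, mul_comm]; omega
        rw [this]
        exact step_data_congr_of_not_dvd (ih2 ρ hρ) hdvd

end

end Proposal

/-! ### Collecting views in the LOCAL model -/

section Wrapper

open scoped Classical in
/-- The labelled graph on identifiers given by a graph, identifiers and labels of the vertices. -/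
noncomputable def confOf {V : Type*} [Fintype V] (G : SimpleGraph V) (ident : V → ℕ)
    (lab : V → ℕ → Lab) : Conf where
  nb x := (Finset.univ.filter fun u => ∃ v, ident v = x ∧ G.Adj v u).image ident
  lab := Function.extend ident lab fun _ _ => default

/-- The algorithm that collects all information within the given distance and then evaluates
a function of labelled graphs. -/
noncomputable def gather (rounds : ℕ → ℕ) (label : ℕ → Seed → ℕ → Lab)
    (alg : ℕ → Conf → ℕ → Option ℕ) : LocalAlgorithm where
  State := ℕ × ℕ × Set Conf
  Msg := Set Conf
  rounds := rounds
  init N i ω := (N, i, {C | C.lab i = label N ω})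
  send s _ := s.2.2
  receive s msgs := (s.1, s.2.1, {C | C ∈ s.2.2 ∧ (∀ u, u ∈ C.nb s.2.1 ↔ ∃ m, (u, m) ∈ msgs) ∧
    ∀ p ∈ msgs, C ∈ p.2})
  output s := open scoped Classical in
    if h : s.2.2.Nonempty then alg s.1 h.choose s.2.1 else none

variable {V : Type*} [Fintype V] {G : SimpleGraph V} {ident : V → ℕ}

theorem mem_confOf_nb (hid : Function.Injective ident) (lab : V → ℕ → Lab) {v : V} {x : ℕ} :
    x ∈ (confOf G ident lab).nb (ident v) ↔ ∃ u, G.Adj v u ∧ ident u = x := by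
  classical
  simp only [confOf, Finset.mem_image, Finset.mem_filter, Finset.mem_univ, true_and]
  constructor
  · rintro ⟨u, ⟨v', hv', h⟩, rfl⟩
    exact ⟨u, hid hv' ▸ h, rfl⟩
  · rintro ⟨u, h, rfl⟩
    exact ⟨u, ⟨v, rfl, h⟩, rfl⟩

/-- A node stores the set of all labelled graphs compatible with what it knows. Intersecting it with
the sets of the neighbours, and with the condition that these are all the neighbours, extends the
radius of agreement by one. -/
theorem gather_run (hid : Function.Injective ident) (rounds : ℕ → ℕ)
    (label : ℕ → Seed → ℕ → Lab) (alg : ℕ → Conf → ℕ → Option ℕ) (N : ℕ) (ω : V → Seed) (r : ℕ)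
    (v : V) : (gather rounds label alg).run N G ident ω r v = (N, ident v,
      {C | Conf.agree C (confOf G ident fun v => label N (ω v)) r (ident v)}) := by
  induction r generalizing v with
  | zero =>
    simp only [LocalAlgorithm.run, gather, Conf.agree, confOf, hid.extend_apply]
  | succ r ih =>
    rw [LocalAlgorithm.run]
    simp only [ih]
    simp only [gather]
    congr 2
    ext C
    simp only [Set.mem_ofPred_eq, Conf.agree, Prod.mk.injEq]
    refine and_congr_right fun _ => ?_
    have h1 : (∀ x, x ∈ C.nb (ident v) ↔ ∃ m u, G.Adj v u ∧ x = ident u ∧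
        m = {C | Conf.agree C (confOf G ident fun v => label N (ω v)) r (ident u)}) ↔
        C.nb (ident v) = (confOf G ident fun v => label N (ω v)).nb (ident v) := by
      rw [Finset.ext_iff]
      refine forall_congr' fun x => ?_
      rw [mem_confOf_nb hid]
      refine iff_congr Iff.rfl ⟨?_, ?_⟩
      · rintro ⟨_, u, h, rfl, _⟩; exact ⟨u, h, rfl⟩
      · rintro ⟨u, h, rfl⟩; exact ⟨_, u, h, rfl, rfl⟩
    rw [h1]
    refine and_congr_right fun hnb => ?_
    rw [hnb]
    constructor
    · intro h x hx
      obtain ⟨u, hu, rfl⟩ := (mem_confOf_nb hid _).1 hx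
      exact h _ ⟨u, hu, rfl⟩
    · rintro h _ ⟨u, hu, rfl⟩
      exact h _ ((mem_confOf_nb hid _).2 ⟨u, hu, rfl⟩)

/-- The final evaluation takes an arbitrary compatible graph; by `halg` the value is the same as for
the true one. -/
theorem gather_result (hid : Function.Injective ident) {rounds : ℕ → ℕ}
    {label : ℕ → Seed → ℕ → Lab} {alg : ℕ → Conf → ℕ → Option ℕ} (N : ℕ)
    (halg : ∀ C C' v, Conf.agree C C' (rounds N) v → alg N C v = alg N C' v)
    (ω : V → Seed) (v : V) : (gather rounds label alg).result N G ident ω v =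
      alg N (confOf G ident fun v => label N (ω v)) (ident v) := by
  have hne : {C | Conf.agree C (confOf G ident fun v => label N (ω v)) (rounds N)
      (ident v)}.Nonempty := by
    refine ⟨confOf G ident fun v => label N (ω v), ?_⟩
    have : ∀ (C : Conf) r x, Conf.agree C C r x := by
      intro C r
      induction r with
      | zero => exact fun _ => rfl
      | succ r ih => exact fun x => ⟨ih x, rfl, fun u _ => ih u⟩
    exact this _ _ _
  have := gather_run (G := G) hid rounds label alg N ω (rounds N) v
  rw [LocalAlgorithm.result]
  change (gather rounds label alg).output
    ((gather rounds label alg).run N G ident ω (rounds N) v) = _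
  rw [this]
  simp only [gather, dif_pos hne]
  exact halg _ _ _ hne.choose_spec

end Wrapper

/-! ### Balls in graphs on identifiers -/

/-- `nb` is the neighbourhood function of a simple graph on `V`. -/
structure IsGraph (nb : ℕ → Finset ℕ) (V : Finset ℕ) : Prop where
  symm : ∀ {a b}, a ∈ nb b → b ∈ nb a
  irrefl : ∀ a, a ∉ nb a
  sub : ∀ v, nb v ⊆ V

section Ball

variable {nb : ℕ → Finset ℕ} {V : Finset ℕ}

theorem mem_ball_self (r v : ℕ) : v ∈ ball nb r v := by
  cases r <;> simp [ball]

theorem ball_adj_subset {a b : ℕ} (h : b ∈ nb a) (r : ℕ) : ball nb r b ⊆ ball nb (r + 1) a :=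
  fun x hx => by
    rw [ball, Finset.mem_insert, Finset.mem_biUnion]; exact Or.inr ⟨b, h, hx⟩

theorem adj_mem_ball {u v x r : ℕ} (h : u ∈ ball nb r v) (hx : x ∈ nb u) :
    x ∈ ball nb (r + 1) v := by
  induction r generalizing v with
  | zero =>
    rw [ball, Finset.mem_singleton] at h; subst h
    exact ball_adj_subset hx 0 (mem_ball_self 0 x)
  | succ r ih =>
    rw [ball, Finset.mem_insert, Finset.mem_biUnion] at h
    rcases h with rfl | ⟨y, hy, h⟩
    · exact ball_adj_subset hx _ (mem_ball_self _ x)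
    · exact ball_adj_subset hy _ (ih h)

theorem IsGraph.ball_symm (hG : IsGraph nb V) {u v r : ℕ} (h : u ∈ ball nb r v) :
    v ∈ ball nb r u := by
  induction r generalizing v with
  | zero => rw [ball, Finset.mem_singleton] at *; exact h.symm
  | succ r ih =>
    rw [ball, Finset.mem_insert, Finset.mem_biUnion] at h
    rcases h with rfl | ⟨y, hy, h⟩
    · exact mem_ball_self _ _
    · exact adj_mem_ball (ih h) (hG.symm hy)

theorem IsGraph.ball_subset (hG : IsGraph nb V) {v : ℕ} (hv : v ∈ V) (r : ℕ) :
    ball nb r v ⊆ V := by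
  induction r generalizing v with
  | zero => rw [ball]; simpa using hv
  | succ r ih =>
    rw [ball]
    refine Finset.insert_subset hv (Finset.biUnion_subset.2 fun x hx => ih (hG.sub v hx))

theorem IsGraph.mem_of_mem_ball (hG : IsGraph nb V) {c v r : ℕ} (h : c ∈ ball nb r v)
    (hv : v ∈ V) : c ∈ V := hG.ball_subset hv r h

theorem ball_card_pos (r v : ℕ) : 0 < (ball nb r v).card :=
  Finset.card_pos.2 ⟨v, mem_ball_self r v⟩

end Ball

namespace Proposal

open scoped Classical

variable {nb : ℕ → Finset ℕ} {V : Finset ℕ} {par : Par}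

/-! ### The vertex cover -/

section Cover

/-- The vertex cover. -/
noncomputable def cover (nb : ℕ → Finset ℕ) (par : Par) (V : Finset ℕ) : Finset ℕ :=
  V.filter (inCover nb par)

/-- A vertex surviving the last phase has fewer than `N / B ^ P ≤ 1` neighbours that survived the
phases before, hence none; so two survivors are never adjacent. -/
theorem inCover_or (hG : IsGraph nb V) (hV : V.card ≤ par.N) (hB : par.N ≤ par.B ^ par.P) {a b : ℕ}
    (hab : a ∈ nb b) : inCover nb par a ∨ inCover nb par b := by
  by_contra! h
  simp only [inCover, not_not] at h
  have h2 : 2 ≤ V.card := by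
    have hne : a ≠ b := fun e => hG.irrefl b (e ▸ hab)
    rw [← Finset.card_pair hne]
    refine Finset.card_le_card (Finset.insert_subset (hG.sub _ hab) ?_)
    simpa using hG.sub _ (hG.symm hab)
  rcases hP : par.P with _ | p
  · rw [hP] at hB; simp at hB; omega
  · rw [hP] at h hB
    have h3 := h.2.2
    have : 0 < ((nb b).filter (remains nb par p)).card :=
      Finset.card_pos.2 ⟨a, Finset.mem_filter.2 ⟨hab, h.1.1⟩⟩
    nlinarith

theorem remains_degree_le (hG : IsGraph nb V) (hV : V.card ≤ par.N) {t x : ℕ}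
    (h : remains nb par t x) : ((nb x).filter (remains nb par t)).card * par.B ^ t ≤ par.N := by
  rcases t with _ | t
  · rw [pow_zero, mul_one]
    exact ((Finset.card_filter_le _ _).trans (Finset.card_le_card (hG.sub x))).trans hV
  · refine le_trans (Nat.mul_le_mul_right _ (Finset.card_le_card ?_)) h.2.le
    exact Finset.monotone_filter_right _ fun v _ h => h.1

/-- The cover is not much larger than any other vertex cover. -/
theorem card_cover_le (hG : IsGraph nb V) (hV : V.card ≤ par.N) (W : Finset ℕ)
    (hW : ∀ a b, a ∈ nb b → a ∈ W ∨ b ∈ W) :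
    (cover nb par V).card ≤ par.P * (2 * par.B * W.card) := by
  rcases Nat.eq_zero_or_pos par.N with h0 | hN
  · have : V = ∅ := Finset.card_eq_zero.1 (by omega)
    simp [cover, this]
  set Yt : ℕ → Finset ℕ := fun t =>
    V.filter fun v => remains nb par t v ∧ ¬ remains nb par (t + 1) v
  have hsub : cover nb par V ⊆ (Finset.range par.P).biUnion Yt := by
    intro v hv
    obtain ⟨hvV, hv⟩ := Finset.mem_filter.1 hv
    have hex : ∃ t, ¬ remains nb par t v := ⟨_, hv⟩
    have h1 := Nat.find_spec hex
    rcases hf : Nat.find hex with _ | t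
    · rw [hf] at h1; exact absurd trivial h1
    · rw [hf] at h1
      have h2 : remains nb par t v := not_not.1 (Nat.find_min hex (m := t) (by omega))
      have h3 : Nat.find hex ≤ par.P := Nat.find_min' hex hv
      exact Finset.mem_biUnion.2 ⟨t, Finset.mem_range.2 (by omega),
        Finset.mem_filter.2 ⟨hvV, h2, h1⟩⟩
  refine (Finset.card_le_card hsub).trans ?_
  refine (Finset.card_biUnion_le_card_mul _ _ (2 * par.B * W.card) fun t _ => ?_).trans
    (by rw [Finset.card_range])
  set D := fun v => (nb v).filter (remains nb par t) with hD
  have h1 : (Yt t).card * par.N ≤ (∑ v ∈ Yt t, (D v).card) * par.B ^ (t + 1) := by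
    rw [← smul_eq_mul, ← Finset.sum_const, Finset.sum_mul]
    refine Finset.sum_le_sum fun v hv => ?_
    obtain ⟨_, h2, h3⟩ := Finset.mem_filter.1 hv
    rw [remains, not_and, not_lt] at h3
    exact h3 h2
  -- Every remaining edge at a removed vertex has an endpoint in `W`, so the degrees in `W` count it
  -- in one of its two directions. Removed degrees are at least `N / B ^ (t + 1)` and remaining
  -- degrees at most `N / B ^ t`; this gives the factor `2 * B`.
  have h2 : ∑ v ∈ Yt t, (D v).card ≤ 2 * ∑ x ∈ W.filter (remains nb par t), (D x).card := by
    rw [two_mul]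
    have e1 : ∑ v ∈ Yt t, (D v).card = ((Yt t).sigma D).card := (Finset.card_sigma _ _).symm
    have e2 : ∑ x ∈ W.filter (remains nb par t), (D x).card =
      ((W.filter (remains nb par t)).sigma D).card := (Finset.card_sigma _ _).symm
    rw [e1, e2]
    have hs : (Yt t).sigma D ⊆ (W.filter (remains nb par t)).sigma D ∪
        ((W.filter (remains nb par t)).sigma D).image fun p => ⟨p.2, p.1⟩ := by
      rintro ⟨v, x⟩ hp
      rw [Finset.mem_sigma] at hp
      have hx := Finset.mem_filter.1 hp.2
      have hv := Finset.mem_filter.1 hp.1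
      rw [Finset.mem_union]
      rcases hW x v hx.1 with h | h
      · right
        refine Finset.mem_image.2 ⟨⟨x, v⟩, ?_, rfl⟩
        exact Finset.mem_sigma.2 ⟨Finset.mem_filter.2 ⟨h, hx.2⟩,
          Finset.mem_filter.2 ⟨hG.symm hx.1, hv.2.1⟩⟩
      · left
        exact Finset.mem_sigma.2 ⟨Finset.mem_filter.2 ⟨h, hv.2.1⟩, hp.2⟩
    refine (Finset.card_le_card hs).trans ((Finset.card_union_le _ _).trans ?_)
    have := Finset.card_image_le (s := (W.filter (remains nb par t)).sigma D)
      (f := fun p => (⟨p.2, p.1⟩ : (_ : ℕ) × ℕ))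
    omega
  have h3 : (∑ x ∈ W.filter (remains nb par t), (D x).card) * par.B ^ t ≤ W.card * par.N := by
    rw [Finset.sum_mul]
    refine (Finset.sum_le_card_nsmul _ _ par.N fun x hx => ?_).trans ?_
    · exact remains_degree_le hG hV (Finset.mem_filter.1 hx).2
    · rw [smul_eq_mul]
      exact Nat.mul_le_mul_right _ (Finset.card_filter_le _ _)
  refine Nat.le_of_mul_le_mul_right ?_ hN
  calc _ ≤ _ := h1
    _ ≤ (2 * ∑ x ∈ W.filter (remains nb par t), (D x).card) * par.B ^ (t + 1) :=
      Nat.mul_le_mul_right _ h2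
    _ = 2 * par.B * ((∑ x ∈ W.filter (remains nb par t), (D x).card) * par.B ^ t) := by ring
    _ ≤ 2 * par.B * (W.card * par.N) := Nat.mul_le_mul_left _ h3
    _ = _ := by ring

end Cover

/-! ### Plans and proposals -/

section Plan

variable {st : St}

theorem edges_subset_adj {ρ c : ℕ} {e : ℕ × ℕ} (h : e ∈ edges nb par st ρ c) : e.2 ∈ nb e.1 :=
  (Finset.mem_filter.1 h).2.1

theorem plan_spec {ρ c : ℕ} (h : (edges nb par st ρ c).Nonempty) :
    IsDist (edges nb par st ρ c) (plan nb par st ρ c) ∧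
    ∀ z, IsDist (edges nb par st ρ c) z →
      obj (edges nb par st ρ c) Prod.fst Prod.snd par.τ (st.u ρ c) (st.w ρ) z ≤
      obj (edges nb par st ρ c) Prod.fst Prod.snd par.τ (st.u ρ c) (st.w ρ)
        (plan nb par st ρ c) := by
  have := exists_isDist_max h Prod.fst Prod.snd par.τ (st.u ρ c) (st.w ρ)
  rw [plan, opt, dif_pos this]
  exact this.choose_spec

theorem plan_eq_zero {ρ c : ℕ} (h : edges nb par st ρ c = ∅) : plan nb par st ρ c = 0 := by
  rw [plan, opt, dif_neg]
  rintro ⟨y, hy, _⟩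
  have := hy.sum_eq
  rw [h, Finset.sum_empty] at this
  exact zero_ne_one this

theorem plan_nonneg (ρ c : ℕ) (e : ℕ × ℕ) : 0 ≤ plan nb par st ρ c e := by
  rcases (edges nb par st ρ c).eq_empty_or_nonempty with h | h
  · rw [plan_eq_zero h]; rfl
  · exact (plan_spec h).1.nonneg e

theorem plan_supp (ρ c : ℕ) {e : ℕ × ℕ} (he : e ∉ edges nb par st ρ c) :
    plan nb par st ρ c e = 0 := by
  rcases (edges nb par st ρ c).eq_empty_or_nonempty with h | h
  · rw [plan_eq_zero h]; rfl
  · exact (plan_spec h).1.supp e he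

theorem marg_fst_plan (ρ c a : ℕ) :
    marg (edges nb par st ρ c) Prod.fst (plan nb par st ρ c) a =
      ∑ b ∈ nb a, plan nb par st ρ c (a, b) := by
  rw [marg]
  have : ∑ b ∈ nb a, plan nb par st ρ c (a, b) =
      ∑ e ∈ (nb a).image (fun b => (a, b)), plan nb par st ρ c e := by
    rw [Finset.sum_image fun x _ y _ h => (Prod.mk.inj h).2]
  rw [this]
  refine Finset.sum_subset_zero_on_sdiff ?_ ?_ fun _ _ => rfl
  · intro e he
    simp only [Finset.mem_filter] at he
    obtain ⟨h1, rfl⟩ := he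
    exact Finset.mem_image.2 ⟨e.2, edges_subset_adj h1, rfl⟩
  · intro e he
    rw [Finset.mem_sdiff, Finset.mem_image] at he
    obtain ⟨⟨b, _, rfl⟩, h2⟩ := he
    exact plan_supp _ _ fun h => h2 (by simp only [Finset.mem_filter]; exact ⟨h, trivial⟩)

theorem send_nonneg (ρ c a b : ℕ) : 0 ≤ send nb par st ρ c a b :=
  div_nonneg (plan_nonneg _ _ _) (marg_nonneg (plan_nonneg _ _) _)

theorem sum_send_le (ρ c a : ℕ) : ∑ b ∈ nb a, send nb par st ρ c a b ≤ 1 := by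
  simp only [send]
  rw [← Finset.sum_div, ← marg_fst_plan]
  exact div_self_le_one _

theorem avg_nonneg (ρ a b : ℕ) : 0 ≤ avg nb par st ρ a b :=
  div_nonneg (Finset.sum_nonneg fun _ _ => send_nonneg _ _ _ _) (Nat.cast_nonneg _)

theorem sum_avg_le (ρ a : ℕ) : ∑ b ∈ nb a, avg nb par st ρ a b ≤ 1 := by
  simp only [avg]
  rw [← Finset.sum_div, Finset.sum_comm, div_le_one (by exact_mod_cast ball_card_pos ρ a)]
  refine (Finset.sum_le_card_nsmul _ _ 1 fun c _ => sum_send_le ρ c a).trans ?_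
  simp

theorem sum_num_le (ρ a : ℕ) : ∑ b ∈ nb a, num nb par st ρ a b ≤ par.M := by
  have : (∑ b ∈ nb a, (num nb par st ρ a b : ℝ)) ≤ par.M := by
    calc _ ≤ ∑ b ∈ nb a, par.M * avg nb par st ρ a b :=
          Finset.sum_le_sum fun b _ => Nat.floor_le (mul_nonneg (Nat.cast_nonneg _)
            (avg_nonneg _ _ _))
      _ ≤ par.M := by
          rw [← Finset.mul_sum]
          exact mul_le_of_le_one_right (Nat.cast_nonneg _) (sum_avg_le ρ a)
  exact_mod_cast this

theorem qt_nonneg (ρ a b : ℕ) : 0 ≤ qt nb par st ρ a b := by unfold qt; positivity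

theorem sum_qt_le (ρ a : ℕ) : ∑ b ∈ nb a, qt nb par st ρ a b ≤ 1 := by
  simp only [qt]
  rw [← Finset.sum_div]
  refine div_le_one_of_le₀ ?_ (Nat.cast_nonneg _)
  exact_mod_cast sum_num_le ρ a

theorem avg_le_qt_add (hM : 0 < par.M) (ρ a b : ℕ) :
    avg nb par st ρ a b ≤ qt nb par st ρ a b + 1 / par.M := by
  have hM' : (0 : ℝ) < par.M := by exact_mod_cast hM
  rw [qt, ← add_div, le_div_iff₀ hM', mul_comm]
  exact (Nat.lt_floor_add_one _).le

/-- Induction over `s`: the values treated so far occupy few enough indices to leave room for the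
next. A uniformly random index then produces `b` with probability exactly `k b / M`. -/
theorem exists_pick {M : ℕ} (s : Finset ℕ) (k : ℕ → ℕ) (h : ∑ b ∈ s, k b ≤ M) :
    ∃ φ : ℕ → Option ℕ, (∀ b ∈ s, ((Finset.range M).filter (fun i => φ i = some b)).card = k b)
      ∧ ∀ i b, φ i = some b → b ∈ s := by
  induction s using Finset.induction_on with
  | empty => exact ⟨fun _ => none, by simp, by simp⟩
  | insert x s hx ih =>
    rw [Finset.sum_insert hx] at h
    obtain ⟨φ, h1, h2⟩ := ih (by omega)
    have hfree : k x ≤ ((Finset.range M).filter fun i => φ i = none).card := by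
      have e : (Finset.range M).filter (fun i => ¬ φ i = none) =
          s.biUnion fun b => (Finset.range M).filter fun i => φ i = some b := by
        ext i
        simp only [Finset.mem_filter, Finset.mem_biUnion]
        constructor
        · rintro ⟨hi, hne⟩
          obtain ⟨b, hb⟩ := Option.ne_none_iff_exists'.1 hne
          exact ⟨b, h2 i b hb, hi, hb⟩
        · rintro ⟨b, _, hi, hb⟩
          exact ⟨hi, by rw [hb]; exact Option.some_ne_none b⟩
      have hc : ((Finset.range M).filter (fun i => ¬ φ i = none)).card ≤ ∑ b ∈ s, k b := by
        rw [e]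
        refine Finset.card_biUnion_le.trans (Finset.sum_le_sum fun b hb => (h1 b hb).le)
      have := Finset.card_filter_add_card_filter_not (s := Finset.range M) (fun i => φ i = none)
      rw [Finset.card_range] at this
      omega
    obtain ⟨S, hS, hcard⟩ := Finset.exists_subset_card_eq hfree
    refine ⟨fun i => if i ∈ S then some x else φ i, ?_, ?_⟩
    · intro b hb
      rw [Finset.mem_insert] at hb
      by_cases hbx : b = x
      · subst hbx
        rw [← hcard]
        congr 1
        ext i
        rw [Finset.mem_filter]
        constructor
        · rintro ⟨_, h⟩
          by_contra hi
          simp only [if_neg hi] at h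
          exact hx (h2 i b h)
        · intro hi
          exact ⟨(Finset.mem_filter.1 (hS hi)).1, if_pos hi⟩
      · have hb' := hb.resolve_left hbx
        rw [← h1 b hb']
        congr 1
        refine Finset.filter_congr fun i _ => ?_
        by_cases hi : i ∈ S
        · simp [if_pos hi, (Finset.mem_filter.1 (hS hi)).2, Ne.symm hbx]
        · simp only [if_neg hi]
    · intro i b hib
      rw [Finset.mem_insert]
      by_cases hi : i ∈ S
      · simp only [if_pos hi] at hib
        exact Or.inl (Option.some.inj hib).symm
      · simp only [if_neg hi] at hib
        exact Or.inr (h2 i b hib)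

theorem card_pick {ρ a b : ℕ} (hb : b ∈ nb a) :
    ((Finset.range par.M).filter fun i =>
      pick par.M (nb a) (num nb par st ρ a) i = some b).card = num nb par st ρ a b := by
  have h := exists_pick (nb a) (num nb par st ρ a) (sum_num_le (par := par) (st := st) ρ a)
  rw [pick, dif_pos h]
  exact h.choose_spec.1 b hb

end Plan

/-! ### Consistency of the partners -/

section Partner

variable {st : St} {t : ℕ} {d : ℕ → Lab}

theorem target_spec {a b : ℕ} (h : target nb par st t d a = some b) :
    alive st a ∧ inCover nb par a ∧ (d a).1 = true ∧ (d a).2.1 < par.R ∧ (d a).2.1 + 1 ∣ t := by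
  unfold target at h
  split_ifs at h with hc
  exact hc

theorem accept_spec {a b : ℕ} (h : accept nb par st t d b = some a) :
    alive st b ∧ (d b).1 = false ∧ b ∈ nb a ∧ target nb par st t d a = some b := by
  unfold accept at h
  split_ifs at h with hc
  have := Finset.min'_mem _ hc.2
  rw [Option.some.inj h] at this
  have := (Finset.mem_filter.1 this).2.1
  exact ⟨hc.1.1, hc.1.2, target_mem this, this⟩

/-- The branches of the definition cannot compete: a vertex that accepts has the receiver role, a
vertex with a target has the sender role. -/
theorem newPtn_eq_some {v x : ℕ} : newPtn nb par st t d v = some x ↔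
    accept nb par st t d v = some x ∨
      (target nb par st t d v = some x ∧ accept nb par st t d x = some v) := by
  unfold newPtn
  split_ifs with h1 h2
  · constructor
    · exact Or.inl
    · rintro (h | ⟨h, _⟩)
      · exact h
      · obtain ⟨y, hy⟩ := Option.isSome_iff_exists.1 h1
        have e1 := (accept_spec hy).2.1
        have e2 := (target_spec h).2.2.1
        rw [e1] at e2; exact absurd e2 Bool.false_ne_true
  · rw [Option.not_isSome_iff_eq_none] at h1
    rw [h1]
    constructor
    · intro h
      obtain ⟨b, hb, hb'⟩ := h2
      rw [h] at hb
      exact Or.inr ⟨h, (Option.some.inj hb) ▸ hb'⟩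
    · rintro (h | ⟨h, _⟩)
      · exact absurd h (by simp)
      · exact h
  · rw [Option.not_isSome_iff_eq_none] at h1
    rw [h1]
    constructor
    · intro h; exact absurd h (by simp)
    · rintro (h | ⟨h, h'⟩)
      · exact absurd h (by simp)
      · exact absurd ⟨x, h, h'⟩ h2

/-- The partners describe a matching all of whose edges meet the cover. -/
structure IsPartial (nb : ℕ → Finset ℕ) (par : Par) (ptn : ℕ → Option ℕ) : Prop where
  symm : ∀ {v x}, ptn v = some x → ptn x = some v
  adj : ∀ {v x}, ptn v = some x → x ∈ nb v
  cover : ∀ {v x}, ptn v = some x → inCover nb par v ∨ inCover nb par x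

theorem newPtn_symm {v x : ℕ} (h : newPtn nb par st t d v = some x) :
    newPtn nb par st t d x = some v ∧ alive st v ∧ alive st x := by
  rw [newPtn_eq_some] at *
  rcases h with h | ⟨h, h'⟩
  · have := accept_spec h
    exact ⟨Or.inr ⟨this.2.2.2, h⟩, this.1, (target_spec this.2.2.2).1⟩
  · have := accept_spec h'
    exact ⟨Or.inl h', (target_spec h).1, this.1⟩

theorem step_isPartial (hG : IsGraph nb V) (h : IsPartial nb par st.ptn) :
    IsPartial nb par (step nb par st t d).ptn := by
  have key : ∀ {v x}, (step nb par st t d).ptn v = some x ↔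
      st.ptn v = some x ∨ (st.ptn v = none ∧ newPtn nb par st t d v = some x) := by
    intro v x
    simp only [step]
    by_cases hv : st.ptn v = none
    · simp [hv]
    · rw [if_neg hv]; simp [hv]
  refine ⟨fun {v x} hv => ?_, fun {v x} hv => ?_, fun {v x} hv => ?_⟩
  · rw [key] at *
    rcases hv with hv | ⟨_, hv⟩
    · exact Or.inl (h.symm hv)
    · have := newPtn_symm hv
      exact Or.inr ⟨this.2.2, this.1⟩
  · rcases key.1 hv with hv | ⟨_, hv⟩
    · exact h.adj hv
    · rcases newPtn_eq_some.1 hv with h' | ⟨h', _⟩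
      · exact hG.symm (accept_spec h').2.2.1
      · exact target_mem h'
  · rcases key.1 hv with hv | ⟨_, hv⟩
    · exact h.cover hv
    · rcases newPtn_eq_some.1 hv with h' | ⟨h', _⟩
      · exact Or.inr (target_spec (accept_spec h').2.2.2).2.1
      · exact Or.inl (target_spec h').2.1

theorem state_isPartial (hG : IsGraph nb V) (lab : ℕ → ℕ → Lab) (t : ℕ) :
    IsPartial nb par (state nb par lab t).ptn := by
  induction t with
  | zero => exact ⟨fun h => by simp [state, start] at h, fun h => by simp [state, start] at h,
      fun h => by simp [state, start] at h⟩
  | succ t ih => exact step_isPartial hG ih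

theorem alive_of_alive_step {v : ℕ} (h : alive (step nb par st t d) v) : alive st v := by
  simp only [alive, step] at *
  by_contra hv
  rw [if_neg hv] at h
  exact hv h

theorem alive_anti {lab : ℕ → ℕ → Lab} {s t v : ℕ} (hst : s ≤ t)
    (h : alive (state nb par lab t) v) : alive (state nb par lab s) v := by
  induction t, hst using Nat.le_induction with
  | base => exact h
  | succ t _ ih => exact ih (alive_of_alive_step h)

end Partner

end Proposal

namespace Proposal

open scoped Classical

variable {nb : ℕ → Finset ℕ} {V : Finset ℕ} {par : Par} {lab : ℕ → ℕ → Lab}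

/-! ### Weights as counts of gold and kill events -/

section Weights

/-- The steps before `T` in which the learners of type `ρ` are updated. -/
def times (ρ T : ℕ) : Finset ℕ := (Finset.range T).filter (ρ + 1 ∣ ·)

noncomputable def goldCount (nb : ℕ → Finset ℕ) (par : Par) (lab : ℕ → ℕ → Lab) (ρ T c a : ℕ) : ℕ :=
  ((times ρ T).filter fun t => gold nb par (state nb par lab t) ρ c a).card

noncomputable def killCount (nb : ℕ → Finset ℕ) (par : Par) (lab : ℕ → ℕ → Lab) (ρ T b : ℕ) : ℕ :=
  ((times ρ T).filter fun t => ¬ free nb par (state nb par lab t) ρ b).card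

theorem times_succ (ρ T : ℕ) :
    times ρ (T + 1) = if ρ + 1 ∣ T then insert T (times ρ T) else times ρ T := by
  rw [times, Finset.range_add_one, Finset.filter_insert]; rfl

theorem not_mem_times (ρ T : ℕ) : T ∉ times ρ T := by simp [times]

theorem u_pos (t ρ c a : ℕ) : 0 < (state nb par lab t).u ρ c a := by
  induction t with
  | zero =>
    have : 0 < (ball nb ρ a).card := ball_card_pos ρ a
    simp only [state, start]; positivity
  | succ t ih =>
    simp only [state, step]
    split_ifs
    · positivity
    · exact ih

theorem w_pos (hK : 0 < par.K) (t ρ b : ℕ) : 0 < (state nb par lab t).w ρ b := by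
  induction t with
  | zero =>
    have : 0 < (ball nb (ρ + 1) b).card := ball_card_pos _ b
    simp only [state, start]; positivity
  | succ t ih =>
    simp only [state, step]
    split_ifs
    · positivity
    · exact ih

theorem log_u (t ρ c a : ℕ) : Real.log ((state nb par lab t).u ρ c a) =
    Real.log (1 / (ball nb ρ a).card) - goldCount nb par lab ρ t c a := by
  induction t with
  | zero => simp [state, start, goldCount, times]
  | succ t ih =>
    have hpos := u_pos (nb := nb) (par := par) (lab := lab) t ρ c a
    have hmem := not_mem_times ρ t
    simp only [state, step]
    rw [goldCount, times_succ]
    by_cases h1 : ρ + 1 ∣ t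
    · rw [if_pos h1, Finset.filter_insert]
      by_cases h2 : gold nb par (state nb par lab t) ρ c a
      · rw [if_pos ⟨h1, h2⟩, if_pos h2, Finset.card_insert_of_notMem (by simp [hmem]),
          Real.log_mul hpos.ne' (Real.exp_pos _).ne', Real.log_exp, ih, goldCount]
        push_cast; ring
      · rw [if_neg (fun h => h2 h.2), if_neg h2, ih, goldCount]
    · rw [if_neg (fun h => h1 h.1), if_neg h1, ih, goldCount]

theorem log_w (hK : 0 < par.K) (t ρ b : ℕ) : Real.log ((state nb par lab t).w ρ b) =
    Real.log (1 / (ball nb (ρ + 1) b).card) - killCount nb par lab ρ t b * Real.log par.K := by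
  induction t with
  | zero => simp [state, start, killCount, times]
  | succ t ih =>
    have hpos := w_pos (nb := nb) (par := par) (lab := lab) hK t ρ b
    have hmem := not_mem_times ρ t
    simp only [state, step]
    rw [killCount, times_succ]
    by_cases h1 : ρ + 1 ∣ t
    · rw [if_pos h1, Finset.filter_insert]
      by_cases h2 : ¬ free nb par (state nb par lab t) ρ b
      · rw [if_pos ⟨h1, h2⟩, if_pos h2, Finset.card_insert_of_notMem (by simp [hmem]),
          Real.log_div hpos.ne' hK.ne', ih, killCount]
        push_cast; ring
      · rw [if_neg (fun h => h2 h.2), if_neg h2, ih, killCount]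
    · rw [if_neg (fun h => h1 h.1), if_neg h1, ih, killCount]

theorem u_le (t ρ c a : ℕ) : (state nb par lab t).u ρ c a ≤ 1 / (ball nb ρ a).card := by
  have hb : (0 : ℝ) < 1 / (ball nb ρ a).card := by
    have := ball_card_pos (nb := nb) ρ a; positivity
  rw [← Real.log_le_log_iff (u_pos t ρ c a) hb, log_u]
  simp

theorem w_le (hK : 1 ≤ par.K) (t ρ b : ℕ) :
    (state nb par lab t).w ρ b ≤ 1 / (ball nb (ρ + 1) b).card := by
  have hb : (0 : ℝ) < 1 / (ball nb (ρ + 1) b).card := by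
    have := ball_card_pos (nb := nb) (ρ + 1) b; positivity
  rw [← Real.log_le_log_iff (w_pos (by linarith) t ρ b) hb, log_w (by linarith)]
  have := mul_nonneg (Nat.cast_nonneg (α := ℝ) (killCount nb par lab ρ t b)) (Real.log_nonneg hK)
  linarith

/-- Snapshots lie in the past, and a vertex that is unmatched now was unmatched then. So an outdated
snapshot never excludes an unmatched vertex. -/
theorem al_of_alive {t v : ℕ} (ρ : ℕ) (h : alive (state nb par lab t) v) :
    (state nb par lab t).al ρ v := by
  induction t with
  | zero => trivial
  | succ t ih =>
    have h' : alive (state nb par lab t) v := alive_anti (Nat.le_succ t) h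
    simp only [state, step]
    split_ifs
    · exact h'
    · exact ih h'

theorem al_of_al_succ {t ρ v : ℕ} (h : (state nb par lab (t + 1)).al ρ v) :
    (state nb par lab t).al ρ v := by
  simp only [state, step] at h
  split_ifs at h
  · exact al_of_alive ρ h
  · exact h

theorem edges_succ_subset (t ρ c : ℕ) :
    edges nb par (state nb par lab (t + 1)) ρ c ⊆ edges nb par (state nb par lab t) ρ c := by
  intro e he
  simp only [edges, Finset.mem_filter] at he ⊢
  exact ⟨he.1, he.2.1, he.2.2.1, al_of_al_succ he.2.2.2.1, al_of_al_succ he.2.2.2.2⟩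

end Weights

/-! ### The drop of a learner's optimum in one update -/

section Value

/-- The optimal value of a learner. -/
noncomputable def value (nb : ℕ → Finset ℕ) (par : Par) (lab : ℕ → ℕ → Lab) (ρ c t : ℕ) : ℝ :=
  obj (edges nb par (state nb par lab t) ρ c) Prod.fst Prod.snd par.τ
    ((state nb par lab t).u ρ c) ((state nb par lab t).w ρ) (plan nb par (state nb par lab t) ρ c)

theorem value_succ_of_not_dvd {ρ c t : ℕ} (h : ¬ ρ + 1 ∣ t) :
    value nb par lab ρ c (t + 1) = value nb par lab ρ c t := by
  have h1 : (state nb par lab (t + 1)).al ρ = (state nb par lab t).al ρ := by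
    funext v; simp only [state, step, if_neg h]
  have h2 : (state nb par lab (t + 1)).u ρ c = (state nb par lab t).u ρ c := by
    funext v; simp only [state, step, h, false_and, if_false]
  have h3 : (state nb par lab (t + 1)).w ρ = (state nb par lab t).w ρ := by
    funext v; simp only [state, step, h, false_and, if_false]
  simp only [value, plan, edges, h1, h2, h3]

/-- Plan mass on edges whose first endpoint is gold. -/
noncomputable def goldMass (nb : ℕ → Finset ℕ) (par : Par) (lab : ℕ → ℕ → Lab) (ρ c t : ℕ) : ℝ :=
  ∑ e ∈ edges nb par (state nb par lab t) ρ c, plan nb par (state nb par lab t) ρ c e *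
    if gold nb par (state nb par lab t) ρ c e.1 then 1 else 0

/-- Plan mass on edges whose second endpoint is not free. -/
noncomputable def killMass (nb : ℕ → Finset ℕ) (par : Par) (lab : ℕ → ℕ → Lab) (ρ c t : ℕ) : ℝ :=
  ∑ e ∈ edges nb par (state nb par lab t) ρ c, plan nb par (state nb par lab t) ρ c e *
    if free nb par (state nb par lab t) ρ e.2 then 0 else 1

/-- An update shrinks the edge set and damps the weights, by `exp (-1)` at gold senders and by `1 /
K` at receivers that are not free. `obj_damped_le` applies, and the averages of the damping factors
under the old plan become the arguments of the two logarithms. -/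
theorem value_succ_le (hK : 0 < par.K) (hτ : 0 ≤ par.τ) {ρ c t : ℕ} (h : ρ + 1 ∣ t)
    (hne : (edges nb par (state nb par lab (t + 1)) ρ c).Nonempty) :
    value nb par lab ρ c (t + 1) ≤ value nb par lab ρ c t +
      par.τ * Real.log (1 - (1 - Real.exp (-1)) * goldMass nb par lab ρ c t) +
      Real.log (1 - (1 - 1 / par.K) * killMass nb par lab ρ c t) := by
  have hsub := edges_succ_subset (nb := nb) (par := par) (lab := lab) t ρ c
  have h0 := plan_spec (hne.mono hsub)
  have h1 := plan_spec hne
  have key := obj_damped_le (p := Prod.fst) (q := Prod.snd) hτ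
    (φ := fun a => if gold nb par (state nb par lab t) ρ c a then 1 else 0)
    (ψ := fun b => if free nb par (state nb par lab t) ρ b then 0 else Real.log par.K)
    h0.1 h0.2 hsub h1.1 (u' := (state nb par lab (t + 1)).u ρ c)
    (w' := (state nb par lab (t + 1)).w ρ) ?_ ?_
  · have e1 : ∑ e ∈ edges nb par (state nb par lab t) ρ c, plan nb par (state nb par lab t) ρ c e *
        Real.exp (-if gold nb par (state nb par lab t) ρ c e.1 then 1 else 0) =
        1 - (1 - Real.exp (-1)) * goldMass nb par lab ρ c t := by
      conv_rhs => lhs; rw [← h0.1.sum_eq]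
      rw [goldMass, Finset.mul_sum, ← Finset.sum_sub_distrib]
      refine Finset.sum_congr rfl fun e _ => ?_
      split_ifs
      · ring
      · simp
    have e2 : ∑ e ∈ edges nb par (state nb par lab t) ρ c, plan nb par (state nb par lab t) ρ c e *
        Real.exp (-if free nb par (state nb par lab t) ρ e.2 then 0 else Real.log par.K) =
        1 - (1 - 1 / par.K) * killMass nb par lab ρ c t := by
      conv_rhs => lhs; rw [← h0.1.sum_eq]
      rw [killMass, Finset.mul_sum, ← Finset.sum_sub_distrib]
      refine Finset.sum_congr rfl fun e _ => ?_
      split_ifs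
      · simp
      · rw [Real.exp_neg, Real.exp_log hK]; ring
    rw [e1, e2] at key
    exact key
  · intro e _
    simp only [state, step]
    by_cases h2 : gold nb par (state nb par lab t) ρ c e.1
    · rw [if_pos ⟨h, h2⟩, if_pos h2, Real.log_mul (u_pos _ _ _ _).ne' (Real.exp_pos _).ne',
        Real.log_exp]; ring
    · rw [if_neg (fun h => h2 h.2), if_neg h2, sub_zero]
  · intro e _
    simp only [state, step]
    by_cases h2 : free nb par (state nb par lab t) ρ e.2
    · rw [if_neg (fun h => h.2 h2), if_pos h2, sub_zero]
    · rw [if_pos ⟨h, h2⟩, if_neg h2, Real.log_div (w_pos hK _ _ _).ne' hK.ne']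

theorem goldMass_nonneg (ρ c t : ℕ) : 0 ≤ goldMass nb par lab ρ c t :=
  Finset.sum_nonneg fun e _ => mul_nonneg (plan_nonneg _ _ _) (by split_ifs <;> norm_num)

theorem killMass_nonneg (ρ c t : ℕ) : 0 ≤ killMass nb par lab ρ c t :=
  Finset.sum_nonneg fun e _ => mul_nonneg (plan_nonneg _ _ _) (by split_ifs <;> norm_num)

theorem killMass_le {ρ c t : ℕ} (hne : (edges nb par (state nb par lab t) ρ c).Nonempty) :
    killMass nb par lab ρ c t ≤ 1 := by
  rw [← (plan_spec hne).1.sum_eq]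
  refine Finset.sum_le_sum fun e _ => mul_le_of_le_one_right (plan_nonneg _ _ _) ?_
  split_ifs <;> norm_num

theorem goldMass_le {ρ c t : ℕ} (hne : (edges nb par (state nb par lab t) ρ c).Nonempty) :
    goldMass nb par lab ρ c t ≤ 1 := by
  rw [← (plan_spec hne).1.sum_eq]
  refine Finset.sum_le_sum fun e _ => mul_le_of_le_one_right (plan_nonneg _ _ _) ?_
  split_ifs <;> norm_num

/-- Almost all of the plan mass is on gold or killed vertices. -/
theorem one_sub_le_goldMass_add_killMass (hK : 0 < par.K) {ρ c t : ℕ}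
    (hne : (edges nb par (state nb par lab t) ρ c).Nonempty) :
    1 - 1 / par.K ≤ goldMass nb par lab ρ c t + killMass nb par lab ρ c t := by
  set st := state nb par lab t with hst
  have hd := (plan_spec hne).1
  set E := edges nb par st ρ c with hE
  set y := plan nb par st ρ c with hy
  have h1 : 1 - (goldMass nb par lab ρ c t + killMass nb par lab ρ c t) ≤
      ∑ e ∈ E, y e * if ¬ gold nb par st ρ c e.1 ∧ free nb par st ρ e.2 then 1 else 0 := by
    conv_lhs => lhs; rw [← hd.sum_eq]
    rw [goldMass, killMass, ← Finset.sum_add_distrib, ← Finset.sum_sub_distrib]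
    refine Finset.sum_le_sum fun e _ => ?_
    have := hd.nonneg e
    rw [← hst, ← hy]
    by_cases h1 : gold nb par st ρ c e.1 <;> by_cases h2 : free nb par st ρ e.2 <;>
      simp [h1, h2, this]
  have h2 : ∑ e ∈ E, y e * (if ¬ gold nb par st ρ c e.1 ∧ free nb par st ρ e.2 then 1 else 0) ≤
      1 / par.K := by
    rw [← Finset.sum_fiberwise_of_maps_to (t := E.image Prod.fst)
      (fun e he => Finset.mem_image_of_mem Prod.fst he)]
    -- For a sender that is not gold, the share of its plan mass on free receivers is its slack,
    -- which is below `1 / K`.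
    have h3 : ∀ a ∈ E.image Prod.fst, ∑ e ∈ E.filter (fun e => e.1 = a),
        y e * (if ¬ gold nb par st ρ c e.1 ∧ free nb par st ρ e.2 then 1 else 0) ≤
        marg E Prod.fst y a * (1 / par.K) := by
      intro a _
      have hr := marg_nonneg (E := E) (p := Prod.fst) hd.nonneg a
      by_cases hg : gold nb par st ρ c a
      · rw [Finset.sum_eq_zero]
        · positivity
        · intro e he
          rw [(Finset.mem_filter.1 he).2, if_neg (fun h => h.1 hg), mul_zero]
      · have hs : slack nb par st ρ c a < 1 / par.K := not_le.1 fun h => hg (Or.inr h)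
        have : ∑ e ∈ E.filter (fun e => e.1 = a),
            y e * (if ¬ gold nb par st ρ c e.1 ∧ free nb par st ρ e.2 then 1 else 0) =
            marg E Prod.fst y a * slack nb par st ρ c a := by
          have e1 : ∀ b, marg E Prod.fst y a * send nb par st ρ c a b = y (a, b) := by
            intro b
            rw [send, ← hE, ← hy]
            rcases hr.eq_or_lt with h0 | h0
            · have : y (a, b) = 0 := by
                by_cases hm : (a, b) ∈ E
                · have := le_marg (p := Prod.fst) hd.nonneg hm
                  exact le_antisymm (this.trans h0.symm.le) (hd.nonneg _)
                · exact hd.supp _ hm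
              rw [← h0, this, zero_mul]
            · field_simp
          rw [slack, Finset.mul_sum]
          simp_rw [e1]
          have e2 : ∑ b ∈ (nb a).filter (free nb par st ρ), y (a, b) =
              ∑ e ∈ ((nb a).filter (free nb par st ρ)).image (fun b => (a, b)), y e := by
            rw [Finset.sum_image fun x _ y _ h => (Prod.mk.inj h).2]
          rw [e2]
          simp only [mul_ite, mul_one, mul_zero]
          rw [← Finset.sum_filter]
          refine Finset.sum_subset_zero_on_sdiff ?_ ?_ fun _ _ => rfl
          · intro e he
            simp only [Finset.mem_filter] at he
            obtain ⟨⟨h1, rfl⟩, h2⟩ := he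
            exact Finset.mem_image.2 ⟨e.2, Finset.mem_filter.2 ⟨edges_subset_adj h1, h2.2⟩, rfl⟩
          · intro e he
            simp only [Finset.mem_sdiff, Finset.mem_image, Finset.mem_filter] at he
            obtain ⟨⟨b, ⟨hb, hb'⟩, rfl⟩, h2⟩ := he
            exact hd.supp _ fun h => h2 ⟨⟨h, rfl⟩, hg, hb'⟩
        rw [this]
        exact mul_le_mul_of_nonneg_left hs.le hr
    refine (Finset.sum_le_sum h3).trans (le_of_eq ?_)
    rw [sum_marg_mul (E := E) (p := Prod.fst) y (fun _ => 1 / par.K)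
      (fun e he => Finset.mem_image_of_mem Prod.fst he), ← Finset.sum_mul, hd.sum_eq, one_mul]
  linarith

/-- If the gold mass is at least `1 / K`, the first logarithm yields the drop because `1 - exp (-1)
> 1 / 2`. Otherwise the killed mass is at least `1 - 2 / K`, and the argument of the second
logarithm is at most `3 / K`. -/
theorem value_succ_le_or (hK : 3 < par.K) (hτ : 0 ≤ par.τ) {ρ c t : ℕ} (h : ρ + 1 ∣ t)
    (hne : (edges nb par (state nb par lab (t + 1)) ρ c).Nonempty) :
    value nb par lab ρ c (t + 1) ≤ value nb par lab ρ c t - par.τ / (2 * par.K) ∨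
    (value nb par lab ρ c (t + 1) ≤ value nb par lab ρ c t - Real.log (par.K / 3) ∧
      1 - 2 / par.K ≤ killMass nb par lab ρ c t) := by
  have hK0 : 0 < par.K := by linarith
  have hKi : 1 / par.K < 1 / 3 := one_div_lt_one_div_of_lt (by norm_num) hK
  have hKp : 0 < 1 / par.K := by positivity
  have hv := value_succ_le hK0 hτ h hne
  have hne' := hne.mono (edges_succ_subset t ρ c)
  have hsum := one_sub_le_goldMass_add_killMass hK0 hne'
  have hg0 := goldMass_nonneg (nb := nb) (par := par) (lab := lab) ρ c t
  have hg1 := goldMass_le hne'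
  have hk0 := killMass_nonneg (nb := nb) (par := par) (lab := lab) ρ c t
  have hk1 := killMass_le hne'
  have hexp : Real.exp (-1) < 1 / 2 := by
    have := Real.exp_neg_one_lt_d9; norm_num at this ⊢; linarith
  have hexp0 := Real.exp_pos (-1)
  set g := goldMass nb par lab ρ c t
  set k := killMass nb par lab ρ c t
  have hlg : Real.log (1 - (1 - Real.exp (-1)) * g) ≤ -(g / 2) := by
    have := Real.log_le_sub_one_of_pos (x := 1 - (1 - Real.exp (-1)) * g) (by nlinarith)
    nlinarith
  have hpk : 0 < 1 - (1 - 1 / par.K) * k := by nlinarith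
  by_cases hg : 1 / par.K ≤ g
  · left
    have hlk : Real.log (1 - (1 - 1 / par.K) * k) ≤ 0 :=
      Real.log_nonpos hpk.le (by nlinarith)
    have : par.τ * Real.log (1 - (1 - Real.exp (-1)) * g) ≤ par.τ * (-(1 / par.K / 2)) :=
      mul_le_mul_of_nonneg_left (by linarith) hτ
    have e : par.τ * (-(1 / par.K / 2)) = -(par.τ / (2 * par.K)) := by field_simp
    linarith
  · right
    have h2 : 2 / par.K = 2 * (1 / par.K) := by ring
    have hk : 1 - 2 / par.K ≤ k := by rw [h2]; linarith
    refine ⟨?_, hk⟩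
    have hlk : Real.log (1 - (1 - 1 / par.K) * k) ≤ - Real.log (par.K / 3) := by
      rw [← Real.log_inv]
      refine Real.log_le_log hpk ?_
      rw [inv_div, show 3 / par.K = 3 * (1 / par.K) by ring]
      nlinarith
    have : par.τ * Real.log (1 - (1 - Real.exp (-1)) * g) ≤ 0 :=
      mul_nonpos_of_nonneg_of_nonpos hτ (by linarith)
    linarith

theorem value_anti (hK : 3 < par.K) (hτ : 0 ≤ par.τ) {ρ c t : ℕ}
    (hne : (edges nb par (state nb par lab (t + 1)) ρ c).Nonempty) :
    value nb par lab ρ c (t + 1) ≤ value nb par lab ρ c t := by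
  by_cases h : ρ + 1 ∣ t
  · have h1 : 0 ≤ par.τ / (2 * par.K) := div_nonneg hτ (by linarith)
    have h2 : 0 ≤ Real.log (par.K / 3) := Real.log_nonneg (by linarith)
    rcases value_succ_le_or hK hτ h hne with h | h <;> linarith [h]
  · exact (value_succ_of_not_dvd h).le

end Value

end Proposal

/-! ### A residual matching bounds the number of updates of one learner -/

namespace Proposal

open scoped Classical

variable {nb : ℕ → Finset ℕ} {V : Finset ℕ} {par : Par} {lab : ℕ → ℕ → Lab} {T : ℕ}
  {Mb : Finset (ℕ × ℕ)}

/-- A matching between unmatched vertices, given by pairs whose first entry is in the cover. -/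
structure Residual (nb : ℕ → Finset ℕ) (par : Par) (st : St) (Mb : Finset (ℕ × ℕ)) : Prop where
  adj : ∀ e ∈ Mb, e.2 ∈ nb e.1
  cover : ∀ e ∈ Mb, inCover nb par e.1
  alive_fst : ∀ e ∈ Mb, alive st e.1
  alive_snd : ∀ e ∈ Mb, alive st e.2
  fst_inj : ∀ e ∈ Mb, ∀ e' ∈ Mb, e.1 = e'.1 → e = e'
  snd_inj : ∀ e ∈ Mb, ∀ e' ∈ Mb, e.2 = e'.2 → e = e'

noncomputable def wt (nb : ℕ → Finset ℕ) (r v : ℕ) : ℝ := 1 / (ball nb r v).card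

theorem wt_pos (r v : ℕ) : 0 < wt nb r v := by
  have := ball_card_pos (nb := nb) r v
  unfold wt; positivity

/-- The pairs known to the learner at `c`. -/
noncomputable def near (nb : ℕ → Finset ℕ) (Mb : Finset (ℕ × ℕ)) (ρ c : ℕ) : Finset (ℕ × ℕ) :=
  Mb.filter fun e => e.1 ∈ ball nb ρ c

/-- This and the three sums below are local totals. Summed over all centres they become the numbers
of residual pairs, cover vertices, vertices, and hit vertices. -/
noncomputable def mass (nb : ℕ → Finset ℕ) (Mb : Finset (ℕ × ℕ)) (ρ c : ℕ) : ℝ :=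
  ∑ e ∈ near nb Mb ρ c, wt nb ρ e.1

noncomputable def uSum (nb : ℕ → Finset ℕ) (par : Par) (ρ c : ℕ) : ℝ :=
  ∑ a ∈ (ball nb ρ c).filter (inCover nb par), wt nb ρ a

noncomputable def wSum (nb : ℕ → Finset ℕ) (ρ c : ℕ) : ℝ :=
  ∑ b ∈ ball nb (ρ + 1) c, wt nb (ρ + 1) b

/-- `b` is not free in some step. -/
def hit (nb : ℕ → Finset ℕ) (par : Par) (lab : ℕ → ℕ → Lab) (ρ T b : ℕ) : Prop :=
  ∃ t ∈ times ρ T, ¬ free nb par (state nb par lab t) ρ b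

noncomputable def hitSum (nb : ℕ → Finset ℕ) (par : Par) (lab : ℕ → ℕ → Lab) (ρ T c : ℕ) : ℝ :=
  ∑ b ∈ (ball nb (ρ + 1) c).filter (hit nb par lab ρ T), wt nb (ρ + 1) b

/-- What the pair `e` subtracts from the objective `(τ + 1) * log mass` of the residual matching:
the damping of the weights at its two ends, and the mismatch of their initial weights. -/
noncomputable def cost (nb : ℕ → Finset ℕ) (par : Par) (lab : ℕ → ℕ → Lab) (ρ T c : ℕ)
    (e : ℕ × ℕ) : ℝ :=
  par.τ * goldCount nb par lab ρ T c e.1 + (Real.log (wt nb ρ e.1) - Real.log (wt nb (ρ + 1) e.2)) +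
    killCount nb par lab ρ T e.2 * Real.log par.K

noncomputable def costSum (nb : ℕ → Finset ℕ) (par : Par) (lab : ℕ → ℕ → Lab)
    (Mb : Finset (ℕ × ℕ)) (ρ T c : ℕ) : ℝ :=
  ∑ e ∈ near nb Mb ρ c, wt nb ρ e.1 * cost nb par lab ρ T c e

/-- Vertices unmatched at time `T` occur in all earlier snapshots, so the residual pairs are at the
learner's disposal throughout. -/
theorem near_subset_edges (hM : Residual nb par (state nb par lab T) Mb) {ρ c t : ℕ} (ht : t ≤ T) :
    near nb Mb ρ c ⊆ edges nb par (state nb par lab t) ρ c := by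
  intro e he
  obtain ⟨h1, h2⟩ := Finset.mem_filter.1 he
  exact Finset.mem_filter.2 ⟨Finset.mem_product.2 ⟨h2, adj_mem_ball h2 (hM.adj e h1)⟩, hM.adj e h1,
    hM.cover e h1, al_of_alive ρ (alive_anti ht (hM.alive_fst e h1)),
    al_of_alive ρ (alive_anti ht (hM.alive_snd e h1))⟩

theorem mass_pos {ρ c : ℕ} (h : (near nb Mb ρ c).Nonempty) : 0 < mass nb Mb ρ c :=
  Finset.sum_pos (fun _ _ => wt_pos _ _) h

theorem mass_nonneg (ρ c : ℕ) : 0 ≤ mass nb Mb ρ c :=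
  Finset.sum_nonneg fun _ _ => (wt_pos _ _).le

theorem mass_le_uSum (hM : Residual nb par (state nb par lab T) Mb) (ρ c : ℕ) :
    mass nb Mb ρ c ≤ uSum nb par ρ c := by
  have : mass nb Mb ρ c = ∑ a ∈ (near nb Mb ρ c).image Prod.fst, wt nb ρ a := by
    rw [Finset.sum_image]; · rfl
    exact fun x hx y hy h => hM.fst_inj x (Finset.mem_filter.1 hx).1 y (Finset.mem_filter.1 hy).1 h
  rw [this]
  refine Finset.sum_le_sum_of_subset_of_nonneg ?_ fun _ _ _ => (wt_pos _ _).le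
  intro a ha
  obtain ⟨e, he, rfl⟩ := Finset.mem_image.1 ha
  obtain ⟨h1, h2⟩ := Finset.mem_filter.1 he
  exact Finset.mem_filter.2 ⟨h2, hM.cover e h1⟩

theorem obj_eq_add {E : Finset (ℕ × ℕ)} (τ : ℝ) (u w : ℕ → ℝ) (y : ℕ × ℕ → ℝ) :
    obj E Prod.fst Prod.snd τ u w y =
      τ * ∑ e ∈ E, y e * (Real.log (u e.1) - Real.log (marg E Prod.fst y e.1)) +
      ∑ e ∈ E, y e * (Real.log (w e.2) - Real.log (marg E Prod.snd y e.2)) := by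
  rw [obj, Finset.mul_sum, ← Finset.sum_add_distrib]
  exact Finset.sum_congr rfl fun e _ => by ring

theorem edges_mem {st : St} {ρ c : ℕ} {e : ℕ × ℕ} (h : e ∈ edges nb par st ρ c) :
    e.1 ∈ (ball nb ρ c).filter (inCover nb par) ∧ e.2 ∈ ball nb (ρ + 1) c := by
  obtain ⟨h1, h2⟩ := Finset.mem_filter.1 h
  obtain ⟨h3, h4⟩ := Finset.mem_product.1 h1
  exact ⟨Finset.mem_filter.2 ⟨h3, h2.2.1⟩, h4⟩

theorem sum_log_u_le {ρ c t : ℕ} (hne : (edges nb par (state nb par lab t) ρ c).Nonempty) :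
    ∑ e ∈ edges nb par (state nb par lab t) ρ c, plan nb par (state nb par lab t) ρ c e *
      (Real.log ((state nb par lab t).u ρ c e.1) - Real.log (marg
        (edges nb par (state nb par lab t) ρ c) Prod.fst (plan nb par (state nb par lab t) ρ c)
          e.1)) ≤ Real.log (uSum nb par ρ c) :=
  sum_mul_log_div_marg_le (plan_spec hne).1 ((state nb par lab t).u ρ c)
    (fun a => (u_pos t ρ c a).le) (fun _ _ _ => u_pos _ _ _ _) (fun _ he => (edges_mem he).1)
    (Finset.sum_le_sum fun a _ => u_le t ρ c a)

theorem value_le (hK : 1 ≤ par.K) (hτ : 0 ≤ par.τ) {ρ c t : ℕ}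
    (hne : (edges nb par (state nb par lab t) ρ c).Nonempty) :
    value nb par lab ρ c t ≤
      par.τ * Real.log (uSum nb par ρ c) + Real.log (wSum nb ρ c) := by
  rw [value, obj_eq_add]
  refine add_le_add (mul_le_mul_of_nonneg_left (sum_log_u_le hne) hτ) ?_
  exact sum_mul_log_div_marg_le (plan_spec hne).1 ((state nb par lab t).w ρ)
    (fun b => (w_pos (by linarith) t ρ b).le) (fun e _ _ => w_pos (by linarith) _ _ _)
    (fun e he => (edges_mem he).2) (Finset.sum_le_sum fun b _ => w_le hK t ρ b)

/-- The value bound when most of the plan is on vertices that are not free. -/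
theorem value_le_of_killMass (hK : 3 < par.K) (hτ : 0 ≤ par.τ) {ρ c t : ℕ} {m : ℝ} (hm : 0 < m)
    (ht : t ∈ times ρ T) (hne : (edges nb par (state nb par lab t) ρ c).Nonempty)
    (hk : 1 - 2 / par.K ≤ killMass nb par lab ρ c t) :
    value nb par lab ρ c t ≤ par.τ * Real.log (uSum nb par ρ c) + Real.log 2 +
      Real.log (m + hitSum nb par lab ρ T c) +
      2 / par.K * (Real.log (m + wSum nb ρ c) - Real.log m) := by
  set H := hitSum nb par lab ρ T c with hH
  set W := wSum nb ρ c with hW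
  have hH0 : 0 ≤ H := Finset.sum_nonneg fun _ _ => (wt_pos _ _).le
  have hHW : H ≤ W := Finset.sum_le_sum_of_subset_of_nonneg (Finset.filter_subset _ _)
    fun _ _ _ => (wt_pos _ _).le
  set E := edges nb par (state nb par lab t) ρ c
  set y := plan nb par (state nb par lab t) ρ c
  have hd := (plan_spec hne).1
  -- Gibbs' inequality against reference weights in which the hit and the other receivers are each
  -- normalized to total at most 1; this is the origin of `log 2`. The summand `m` keeps the
  -- normalizers positive when nothing is hit.
  have g := sum_mul_log_div_marg_le (p := Prod.snd) hd
    (fun b => wt nb (ρ + 1) b / if hit nb par lab ρ T b then m + H else m + W)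
    (fun b => div_nonneg (wt_pos _ _).le (by split_ifs <;> linarith))
    (fun e _ _ => div_pos (wt_pos _ _) (by split_ifs <;> linarith))
    (A := ball nb (ρ + 1) c) (Z := 2) (fun e he => (edges_mem he).2) (by
      rw [← Finset.sum_filter_add_sum_filter_not _ (hit nb par lab ρ T)]
      have h1 : ∑ b ∈ (ball nb (ρ + 1) c).filter (hit nb par lab ρ T),
          (wt nb (ρ + 1) b / if hit nb par lab ρ T b then m + H else m + W) ≤ 1 := by
        have : ∑ b ∈ (ball nb (ρ + 1) c).filter (hit nb par lab ρ T),
          (wt nb (ρ + 1) b / if hit nb par lab ρ T b then m + H else m + W) = H / (m + H) := by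
          rw [hH, hitSum, Finset.sum_div]
          refine Finset.sum_congr rfl fun b hb => ?_
          rw [if_pos (Finset.mem_filter.1 hb).2]
        rw [this, div_le_one (by linarith)]; linarith
      have h2 : ∑ b ∈ (ball nb (ρ + 1) c).filter (fun b => ¬ hit nb par lab ρ T b),
          (wt nb (ρ + 1) b / if hit nb par lab ρ T b then m + H else m + W) ≤ 1 := by
        have : ∑ b ∈ (ball nb (ρ + 1) c).filter (fun b => ¬ hit nb par lab ρ T b),
          (wt nb (ρ + 1) b / if hit nb par lab ρ T b then m + H else m + W) ≤ W / (m + W) := by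
          rw [hW, wSum, Finset.sum_div]
          refine (Finset.sum_le_sum fun b hb => ?_).trans
            (Finset.sum_le_sum_of_subset_of_nonneg (Finset.filter_subset _ _)
              fun b _ _ => div_nonneg (wt_pos _ _).le ?_)
          · rw [if_neg (Finset.mem_filter.1 hb).2]
          · change 0 ≤ m + W; linarith
        refine this.trans ?_
        rw [div_le_one (by linarith)]; linarith
      linarith)
  have hkill : killMass nb par lab ρ c t ≤
      ∑ e ∈ E, y e * if hit nb par lab ρ T e.2 then 1 else 0 := by
    refine Finset.sum_le_sum fun e _ => mul_le_mul_of_nonneg_left ?_ (hd.nonneg e)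
    by_cases hf : free nb par (state nb par lab t) ρ e.2
    · rw [if_pos hf]; split_ifs <;> norm_num
    · rw [if_neg hf, if_pos ⟨t, ht, hf⟩]
  have hs : ∑ e ∈ E, y e * (Real.log ((state nb par lab t).w ρ e.2) -
      Real.log (marg E Prod.snd y e.2)) ≤
      ∑ e ∈ E, y e *
        (Real.log (wt nb (ρ + 1) e.2 / if hit nb par lab ρ T e.2 then m + H else m + W) -
        Real.log (marg E Prod.snd y e.2)) + (Real.log (m + W) -
        (∑ e ∈ E, y e * if hit nb par lab ρ T e.2 then 1 else 0) *
          (Real.log (m + W) - Real.log (m + H))) := by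
    have : Real.log (m + W) = ∑ e ∈ E, y e * Real.log (m + W) := by
      rw [← Finset.sum_mul, hd.sum_eq, one_mul]
    conv_rhs => rhs; lhs; rw [this]
    rw [Finset.sum_mul, ← Finset.sum_sub_distrib, ← Finset.sum_add_distrib]
    refine Finset.sum_le_sum fun e _ => ?_
    have h1 : Real.log ((state nb par lab t).w ρ e.2) ≤ Real.log (wt nb (ρ + 1) e.2) :=
      Real.log_le_log (w_pos (by linarith) _ _ _) (w_le (by linarith) t ρ e.2)
    have h2 : Real.log (wt nb (ρ + 1) e.2 / if hit nb par lab ρ T e.2 then m + H else m + W) =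
        Real.log (wt nb (ρ + 1) e.2) -
          Real.log (if hit nb par lab ρ T e.2 then m + H else m + W) :=
      Real.log_div (wt_pos _ _).ne' (by split_ifs <;> linarith)
    rw [h2]
    have hy := hd.nonneg e
    split_ifs <;> nlinarith
  have hl1 : Real.log (m + H) ≤ Real.log (m + W) := Real.log_le_log (by linarith) (by linarith)
  have hl2 : Real.log m ≤ Real.log (m + H) := Real.log_le_log hm (by linarith)
  have hK2 : 0 < 2 / par.K := div_pos two_pos (by linarith)
  -- At most `2 / K` of the plan lies outside the hit receivers, so the large normalizer `m + W`
  -- enters with this small factor only.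
  have h3 : (1 - 2 / par.K) * (Real.log (m + W) - Real.log (m + H)) ≤
      (∑ e ∈ E, y e * if hit nb par lab ρ T e.2 then 1 else 0) *
          (Real.log (m + W) - Real.log (m + H)) :=
    mul_le_mul_of_nonneg_right (hk.trans hkill) (by linarith)
  have h4 : 2 / par.K * (Real.log (m + W) - Real.log (m + H)) ≤
      2 / par.K * (Real.log (m + W) - Real.log m) :=
    mul_le_mul_of_nonneg_left (by linarith) hK2.le
  rw [value, obj_eq_add]
  have h5 := mul_le_mul_of_nonneg_left (sum_log_u_le hne) hτ
  linarith

/-- The ball of radius `ρ` at one end of an edge lies in the ball of radius `ρ + 1` at the other,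
which orders the initial weights. -/
theorem cost_nonneg (hG : IsGraph nb V) (hK : 1 ≤ par.K) (hτ : 0 ≤ par.τ) (ρ c : ℕ) {e : ℕ × ℕ}
    (he : e.2 ∈ nb e.1) : 0 ≤ cost nb par lab ρ T c e := by
  have h1 : wt nb (ρ + 1) e.2 ≤ wt nb ρ e.1 := by
    unfold wt
    refine one_div_le_one_div_of_le (by exact_mod_cast ball_card_pos _ _) ?_
    exact_mod_cast Finset.card_le_card (ball_adj_subset (hG.symm he) ρ)
  have h2 := Real.log_le_log (wt_pos _ _) h1
  have h3 := Real.log_nonneg hK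
  unfold cost
  have : 0 ≤ Real.log (wt nb ρ e.1) - Real.log (wt nb (ρ + 1) e.2) := by linarith
  positivity

/-- The residual pairs near `c`, weighted by `wt`, form an admissible distribution up to time `T`,
so the antitone optimum never falls below its objective. `card_steps_le` then counts the updates.
Drops by `τ / (2 * K)` share the whole initial gap, drops by `log (K / 3)` only the gap left once
the plan is on hit receivers. -/
theorem card_times_le (hG : IsGraph nb V) (hK : 3 < par.K) (hτ : 0 < par.τ)
    (hM : Residual nb par (state nb par lab T) Mb) {ρ c : ℕ} (hne : (near nb Mb ρ c).Nonempty) :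
    ((times ρ T).card : ℝ) ≤
      (par.τ * (Real.log (uSum nb par ρ c) - Real.log (mass nb Mb ρ c)) +
        (Real.log (wSum nb ρ c) - Real.log (mass nb Mb ρ c)) +
        costSum nb par lab Mb ρ T c / mass nb Mb ρ c) / (par.τ / (2 * par.K)) +
      (par.τ * (Real.log (uSum nb par ρ c) - Real.log (mass nb Mb ρ c)) + Real.log 2 +
        (Real.log (mass nb Mb ρ c + hitSum nb par lab ρ T c) - Real.log (mass nb Mb ρ c)) +
        2 / par.K * (Real.log (mass nb Mb ρ c + wSum nb ρ c) - Real.log (mass nb Mb ρ c)) +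
        costSum nb par lab Mb ρ T c / mass nb Mb ρ c) / Real.log (par.K / 3) := by
  have hm := mass_pos hne
  set m := mass nb Mb ρ c with hmdef
  have hedge : ∀ t ≤ T, (edges nb par (state nb par lab t) ρ c).Nonempty :=
    fun t ht => hne.mono (near_subset_edges hM ht)
  set z : ℕ × ℕ → ℝ := fun e => if e ∈ near nb Mb ρ c then wt nb ρ e.1 / m else 0 with hz
  have hzd : IsDist (near nb Mb ρ c) z := by
    refine ⟨fun e => ?_, fun e he => if_neg he, ?_⟩
    · simp only [hz]; split_ifs
      · exact div_nonneg (wt_pos _ _).le hm.le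
      · exact le_rfl
    · rw [Finset.sum_congr rfl fun e he => if_pos he, ← Finset.sum_div, div_eq_one_iff_eq hm.ne']
      rfl
  have hsub := near_subset_edges hM (le_refl T) (ρ := ρ) (c := c)
  -- The pairs form a matching, so every fibre is a single pair and both marginals are `z` itself.
  have hmarg : ∀ {π : ℕ × ℕ → ℕ}, (∀ e ∈ Mb, ∀ e' ∈ Mb, π e = π e' → e = e') →
      ∀ e ∈ near nb Mb ρ c, marg (edges nb par (state nb par lab T) ρ c) π z (π e) = z e := by
    intro π hπ e he
    rw [marg_mono_set hzd.supp hsub, marg]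
    refine Finset.sum_eq_single_of_mem e (by simpa using he) fun e' he' hne => ?_
    simp only [Finset.mem_filter] at he'
    exact absurd (hπ e' (Finset.mem_filter.1 he'.1).1 e (Finset.mem_filter.1 he).1 he'.2) hne
  have hK0 : 0 < par.K := by linarith
  have hf : obj (edges nb par (state nb par lab T) ρ c) Prod.fst Prod.snd par.τ
      ((state nb par lab T).u ρ c) ((state nb par lab T).w ρ) z =
      (par.τ + 1) * Real.log m - costSum nb par lab Mb ρ T c / m := by
    have h1 : costSum nb par lab Mb ρ T c / m =
        ∑ e ∈ near nb Mb ρ c, z e * cost nb par lab ρ T c e := by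
      rw [costSum, Finset.sum_div]
      refine Finset.sum_congr rfl fun e he => ?_
      simp only [hz, if_pos he]; ring
    have h2 : (par.τ + 1) * Real.log m =
        ∑ e ∈ near nb Mb ρ c, z e * ((par.τ + 1) * Real.log m) := by
      rw [← Finset.sum_mul, hzd.sum_eq, one_mul]
    rw [h1, h2, ← Finset.sum_sub_distrib, obj]
    symm
    refine Finset.sum_subset_zero_on_sdiff hsub (fun e he => ?_) fun e he => ?_
    · rw [hzd.supp e (Finset.mem_sdiff.1 he).2, zero_mul]
    · rw [hmarg hM.fst_inj e he, hmarg hM.snd_inj e he, log_u, log_w hK0]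
      have : Real.log (z e) = Real.log (wt nb ρ e.1) - Real.log m := by
        simp only [hz, if_pos he]
        exact Real.log_div (wt_pos _ _).ne' hm.ne'
      rw [this, cost]
      simp only [wt]; ring
  have hfT : (par.τ + 1) * Real.log m - costSum nb par lab Mb ρ T c / m ≤
      value nb par lab ρ c T := by
    rw [← hf]; exact (plan_spec (hedge T le_rfl)).2 z (hzd.mono hsub)
  have hcost : 0 ≤ costSum nb par lab Mb ρ T c / m := by
    refine div_nonneg (Finset.sum_nonneg fun e he => mul_nonneg (wt_pos _ _).le ?_) hm.le
    exact cost_nonneg hG (by linarith) hτ.le ρ c (hM.adj e (Finset.mem_filter.1 he).1)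
  have hu : Real.log m ≤ Real.log (uSum nb par ρ c) :=
    Real.log_le_log hm (mass_le_uSum hM ρ c)
  have hh : Real.log m ≤ Real.log (m + hitSum nb par lab ρ T c) :=
    Real.log_le_log hm (le_add_of_nonneg_right (Finset.sum_nonneg fun _ _ => (wt_pos _ _).le))
  have hw : Real.log m ≤ Real.log (m + wSum nb ρ c) :=
    Real.log_le_log hm (le_add_of_nonneg_right (Finset.sum_nonneg fun _ _ => (wt_pos _ _).le))
  refine card_steps_le (O := value nb par lab ρ c) (T := T)
    (f := (par.τ + 1) * Real.log m - costSum nb par lab Mb ρ T c / m) (times ρ T)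
    (fun t ht => Finset.mem_range.1 (Finset.mem_filter.1 ht).1) (by positivity)
    (Real.log_pos (by linarith)) ?_ (fun t ht => value_anti hK hτ.le (hedge _ ht)) hfT ?_ ?_
  · have := mul_nonneg hτ.le (sub_nonneg.2 hu)
    have := mul_nonneg (div_nonneg zero_le_two hK0.le) (sub_nonneg.2 hw)
    have := Real.log_nonneg (x := 2) (by norm_num)
    linarith
  · have := value_le (lab := lab) (by linarith) hτ.le (hedge 0 (Nat.zero_le T))
    linarith
  · intro t ht
    have htT : t < T := Finset.mem_range.1 (Finset.mem_filter.1 ht).1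
    refine (value_succ_le_or hK hτ.le (Finset.mem_filter.1 ht).2 (hedge _ htT)).imp_right ?_
    rintro ⟨h1, h2⟩
    refine ⟨h1, ?_⟩
    have := value_le_of_killMass (T := T) hK hτ.le hm ht (hedge t htT.le) h2
    linarith

end Proposal

/-! ### Averaging over all learners of one type -/

/-- The log sum inequality. -/
theorem sum_mul_log_sub_log_le {ι : Type*} (s : Finset ι) (m x : ι → ℝ) (hm : ∀ i ∈ s, 0 ≤ m i)
    (hx : ∀ i ∈ s, 0 ≤ x i) (hpos : ∀ i ∈ s, 0 < m i → 0 < x i) (h : 0 < ∑ i ∈ s, m i) {X : ℝ}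
    (hX : ∑ i ∈ s, x i ≤ X) :
    ∑ i ∈ s, m i * (Real.log (x i) - Real.log (m i)) ≤
      (∑ i ∈ s, m i) * (Real.log X - Real.log (∑ i ∈ s, m i)) := by
  set M := ∑ i ∈ s, m i with hM
  have hX0 : 0 < X := by
    refine lt_of_lt_of_le ?_ hX
    obtain ⟨i, hi, hmi⟩ : ∃ i ∈ s, 0 < m i := by
      by_contra! h'
      exact absurd (Finset.sum_nonpos h') (not_le.2 h)
    exact Finset.sum_pos' hx ⟨i, hi, hpos i hi hmi⟩
  have key : ∀ i ∈ s, m i * (Real.log (x i) - Real.log (m i)) ≤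
      m i * (Real.log X - Real.log M) + (x i * (M / X) - m i) := by
    intro i hi
    rcases (hm i hi).eq_or_lt with h0 | h0
    · rw [← h0]; have := hx i hi; simp; positivity
    · have hxi := hpos i hi h0
      have := Real.log_le_sub_one_of_pos (x := x i / m i * (M / X)) (by positivity)
      rw [Real.log_mul (by positivity) (by positivity), Real.log_div hxi.ne' h0.ne',
        Real.log_div h.ne' hX0.ne'] at this
      have h2 := mul_le_mul_of_nonneg_left this h0.le
      have e : m i * (x i / m i * (M / X) - 1) = x i * (M / X) - m i := by field_simp
      rw [e] at h2
      linarith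
  refine (Finset.sum_le_sum key).trans ?_
  rw [Finset.sum_add_distrib, ← Finset.sum_mul, Finset.sum_sub_distrib, ← Finset.sum_mul, ← hM]
  have : (∑ i ∈ s, x i) * (M / X) ≤ X * (M / X) :=
    mul_le_mul_of_nonneg_right hX (by positivity)
  have e : X * (M / X) = M := by field_simp
  linarith

namespace Proposal

open scoped Classical

variable {nb : ℕ → Finset ℕ} {V : Finset ℕ} {par : Par} {lab : ℕ → ℕ → Lab} {T : ℕ}
  {Mb : Finset (ℕ × ℕ)}

theorem sum_ball_comm (hG : IsGraph nb V) {ι : Type*} (r : ℕ) (S : Finset ι) (π : ι → ℕ)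
    (hπ : ∀ x ∈ S, π x ∈ V) (F : ℕ → ι → ℝ) :
    ∑ c ∈ V, ∑ x ∈ S.filter (fun x => π x ∈ ball nb r c), F c x =
      ∑ x ∈ S, ∑ c ∈ ball nb r (π x), F c x := by
  refine Finset.sum_comm' fun c x => ?_
  rw [Finset.mem_filter]
  constructor
  · rintro ⟨_, hx, h⟩; exact ⟨hG.ball_symm h, hx⟩
  · rintro ⟨h, hx⟩; exact ⟨hG.mem_of_mem_ball h (hπ x hx), hx, hG.ball_symm h⟩

theorem sum_wt (r v : ℕ) : ∑ _c ∈ ball nb r v, wt nb r v = 1 := by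
  have := ball_card_pos (nb := nb) r v
  rw [Finset.sum_const, wt, nsmul_eq_mul, mul_one_div, div_self (by positivity)]

/-- Double counting: each vertex spreads total weight one over the centres whose balls contain it.
-/
theorem sum_filter_wt (hG : IsGraph nb V) (r : ℕ) (p : ℕ → Prop) :
    ∑ c ∈ V, ∑ a ∈ (ball nb r c).filter p, wt nb r a = (V.filter p).card := by
  have h1 : ∀ c ∈ V, ∑ a ∈ (ball nb r c).filter p, wt nb r a =
      ∑ a ∈ (V.filter p).filter (fun a => a ∈ ball nb r c), wt nb r a := by
    intro c hc
    congr 1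
    ext a
    simp only [Finset.mem_filter]
    constructor
    · rintro ⟨h1, h2⟩; exact ⟨⟨hG.ball_subset hc r h1, h2⟩, h1⟩
    · rintro ⟨⟨_, h2⟩, h1⟩; exact ⟨h1, h2⟩
  rw [Finset.sum_congr rfl h1]
  refine (sum_ball_comm hG r (V.filter p) (fun a => a)
    (fun x hx => (Finset.mem_filter.1 hx).1) fun _ a => wt nb r a).trans ?_
  rw [Finset.sum_congr rfl fun x _ => sum_wt r x]
  simp

theorem sum_mass (hG : IsGraph nb V) {st : St} (hM : Residual nb par st Mb) (ρ : ℕ) :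
    ∑ c ∈ V, mass nb Mb ρ c = Mb.card := by
  have := sum_ball_comm hG ρ Mb Prod.fst (fun e he => hG.sub _ (hG.symm (hM.adj e he)))
    fun _ e => wt nb ρ e.1
  unfold mass near
  rw [this, Finset.sum_congr rfl fun e _ => sum_wt ρ e.1]
  simp

/-- The expected activity at `v` of the learners of type `ρ`. -/
noncomputable def act (nb : ℕ → Finset ℕ) (par : Par) (st : St) (ρ v : ℕ) : ℝ :=
  (if 1 ≤ load nb par st ρ v then 1 else 0) +
    if inCover nb par v then ∑ b ∈ (nb v).filter (free nb par st ρ), qt nb par st ρ v b else 0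

noncomputable def stepAct (nb : ℕ → Finset ℕ) (par : Par) (st : St) (t v : ℕ) : ℝ :=
  ∑ ρ ∈ (Finset.range par.R).filter (· + 1 ∣ t), act nb par st ρ v

noncomputable def totalAct (nb : ℕ → Finset ℕ) (par : Par) (lab : ℕ → ℕ → Lab) (T v : ℕ) : ℝ :=
  ∑ t ∈ Finset.range T, stepAct nb par (state nb par lab t) t v

theorem act_nonneg (st : St) (ρ v : ℕ) : 0 ≤ act nb par st ρ v := by
  have : 0 ≤ ∑ b ∈ (nb v).filter (free nb par st ρ), qt nb par st ρ v b :=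
    Finset.sum_nonneg fun _ _ => qt_nonneg _ _ _
  unfold act
  split_ifs <;> positivity

theorem sum_act_le_totalAct {ρ : ℕ} (hρ : ρ < par.R) (v : ℕ) :
    ∑ t ∈ times ρ T, act nb par (state nb par lab t) ρ v ≤ totalAct nb par lab T v := by
  rw [times, Finset.sum_filter, totalAct]
  refine Finset.sum_le_sum fun t _ => ?_
  split_ifs with h
  · exact Finset.single_le_sum (f := fun ρ => act nb par (state nb par lab t) ρ v)
      (fun ρ _ => act_nonneg _ ρ v) (Finset.mem_filter.2 ⟨Finset.mem_range.2 hρ, h⟩)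
  · exact Finset.sum_nonneg fun ρ _ => act_nonneg _ ρ v

/-- An unmatched vertex fails to be free only by overload, and each overload adds one to its
activity. -/
theorem killCount_le {ρ : ℕ} (hρ : ρ < par.R) {b : ℕ} (hb : alive (state nb par lab T) b) :
    (killCount nb par lab ρ T b : ℝ) ≤ totalAct nb par lab T b := by
  refine le_trans ?_ (sum_act_le_totalAct hρ b)
  rw [killCount, ← Finset.sum_boole]
  refine Finset.sum_le_sum fun t ht => ?_
  by_cases h : free nb par (state nb par lab t) ρ b
  · rw [if_neg (not_not.2 h)]; exact act_nonneg _ _ _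
  · have ht' : t < T := Finset.mem_range.1 (Finset.mem_filter.1 ht).1
    have hl : 1 ≤ load nb par (state nb par lab t) ρ b := by
      by_contra! hl; exact h ⟨alive_anti ht'.le hb, hl⟩
    have : 0 ≤ ∑ x ∈ (nb b).filter (free nb par (state nb par lab t) ρ),
        qt nb par (state nb par lab t) ρ b x := Finset.sum_nonneg fun _ _ => qt_nonneg _ _ _
    rw [act, if_pos hl, if_pos h]
    split_ifs <;> linarith

/-- For an unmatched sender each gold event is paid by slack at least `1 / K`. Averaged over the
learners around it, the slack is the mass it proposes to free receivers, hence at most its activity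
up to rounding. Rounding loses at most `N / M` per step, in all at most 1; this is the added 1. -/
theorem sum_goldCount_le (hG : IsGraph nb V) (hK : 0 < par.K) (hM0 : 0 < par.M)
    (hMT : T * par.N ≤ par.M) (hV : V.card ≤ par.N) {ρ : ℕ} (hρ : ρ < par.R) {a : ℕ}
    (ha : alive (state nb par lab T) a) (hc : inCover nb par a) :
    ∑ c ∈ ball nb ρ a, wt nb ρ a * goldCount nb par lab ρ T c a ≤
      par.K * (totalAct nb par lab T a + 1) := by
  have hM' : (0 : ℝ) < par.M := by exact_mod_cast hM0
  have h1 : ∀ c, (goldCount nb par lab ρ T c a : ℝ) ≤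
      ∑ t ∈ times ρ T, par.K * slack nb par (state nb par lab t) ρ c a := by
    intro c
    rw [goldCount, ← Finset.sum_boole]
    refine Finset.sum_le_sum fun t ht => ?_
    have ht' : t < T := Finset.mem_range.1 (Finset.mem_filter.1 ht).1
    split_ifs with h
    · have := h.resolve_left (fun h => h (alive_anti ht'.le ha))
      rw [div_le_iff₀ hK] at this; linarith
    · exact mul_nonneg hK.le (Finset.sum_nonneg fun _ _ => send_nonneg _ _ _ _)
  have h2 : ∀ t, ∑ c ∈ ball nb ρ a, wt nb ρ a * slack nb par (state nb par lab t) ρ c a ≤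
      act nb par (state nb par lab t) ρ a + par.N / par.M := by
    intro t
    have e : ∑ c ∈ ball nb ρ a, wt nb ρ a * slack nb par (state nb par lab t) ρ c a =
        ∑ b ∈ (nb a).filter (free nb par (state nb par lab t) ρ),
          avg nb par (state nb par lab t) ρ a b := by
      simp only [slack, avg, wt]
      rw [← Finset.mul_sum, Finset.sum_comm, ← Finset.sum_div]
      ring
    rw [e]
    calc _ ≤ ∑ b ∈ (nb a).filter (free nb par (state nb par lab t) ρ),
            (qt nb par (state nb par lab t) ρ a b + 1 / par.M) :=
          Finset.sum_le_sum fun b _ => avg_le_qt_add hM0 ρ a b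
      _ ≤ _ := by
        rw [Finset.sum_add_distrib, Finset.sum_const, nsmul_eq_mul, mul_one_div]
        refine add_le_add ?_ (div_le_div_of_nonneg_right ?_ hM'.le)
        · rw [act, if_pos hc]
          split_ifs <;> linarith
        · exact_mod_cast (Finset.card_filter_le _ _).trans
            ((Finset.card_le_card (hG.sub a)).trans hV)
  calc _ ≤ ∑ c ∈ ball nb ρ a, wt nb ρ a * ∑ t ∈ times ρ T,
          par.K * slack nb par (state nb par lab t) ρ c a :=
        Finset.sum_le_sum fun c _ => mul_le_mul_of_nonneg_left (h1 c) (wt_pos _ _).le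
    _ = par.K * ∑ t ∈ times ρ T, ∑ c ∈ ball nb ρ a,
          wt nb ρ a * slack nb par (state nb par lab t) ρ c a := by
        simp_rw [Finset.mul_sum]
        rw [Finset.sum_comm]
        exact Finset.sum_congr rfl fun _ _ => Finset.sum_congr rfl fun _ _ => by ring
    _ ≤ par.K * ∑ t ∈ times ρ T, (act nb par (state nb par lab t) ρ a + par.N / par.M) :=
        mul_le_mul_of_nonneg_left (Finset.sum_le_sum fun t _ => h2 t) hK.le
    _ ≤ _ := by
        refine mul_le_mul_of_nonneg_left ?_ hK.le
        rw [Finset.sum_add_distrib, Finset.sum_const, nsmul_eq_mul]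
        refine add_le_add (sum_act_le_totalAct hρ a) ?_
        have h3 : ((times ρ T).card : ℝ) ≤ T := by
          exact_mod_cast (Finset.card_filter_le _ _).trans (Finset.card_range T).le
        rw [mul_div_assoc', div_le_one hM']
        calc _ ≤ (T : ℝ) * par.N := mul_le_mul_of_nonneg_right h3 (Nat.cast_nonneg _)
          _ ≤ _ := by exact_mod_cast hMT

/-- Bounds the mismatch of initial weights along a pair, because the ball of radius `ρ + 1` at the
receiver lies in the ball of radius `ρ + 2` at the sender. -/
noncomputable def growth (nb : ℕ → Finset ℕ) (ρ a : ℕ) : ℝ :=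
  Real.log (ball nb (ρ + 2) a).card - Real.log (ball nb ρ a).card

theorem sum_costSum_le (hG : IsGraph nb V) (hK : 1 ≤ par.K) (hτ : 0 ≤ par.τ) (hM0 : 0 < par.M)
    (hMT : T * par.N ≤ par.M) (hV : V.card ≤ par.N) {ρ : ℕ} (hρ : ρ < par.R)
    (hM : Residual nb par (state nb par lab T) Mb) {s0 : ℝ}
    (h1 : ∀ e ∈ Mb, totalAct nb par lab T e.1 ≤ s0)
    (h2 : ∀ e ∈ Mb, totalAct nb par lab T e.2 ≤ s0) :
    ∑ c ∈ V, costSum nb par lab Mb ρ T c ≤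
      Mb.card * (par.τ * par.K * (s0 + 1) + s0 * Real.log par.K) + ∑ e ∈ Mb, growth nb ρ e.1 := by
  have := sum_ball_comm hG ρ Mb Prod.fst (fun e he => hG.sub _ (hG.symm (hM.adj e he)))
    fun c e => wt nb ρ e.1 * cost nb par lab ρ T c e
  unfold costSum near
  rw [this, ← nsmul_eq_mul, ← Finset.sum_const, ← Finset.sum_add_distrib]
  refine Finset.sum_le_sum fun e he => ?_
  have e1 : ∑ c ∈ ball nb ρ e.1, wt nb ρ e.1 * cost nb par lab ρ T c e =
      par.τ * (∑ c ∈ ball nb ρ e.1, wt nb ρ e.1 * goldCount nb par lab ρ T c e.1) +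
      (Real.log (wt nb ρ e.1) - Real.log (wt nb (ρ + 1) e.2)) +
      killCount nb par lab ρ T e.2 * Real.log par.K := by
    have hone := sum_wt (nb := nb) ρ e.1
    simp only [cost, mul_add, Finset.sum_add_distrib]
    rw [← Finset.sum_mul, ← Finset.sum_mul, hone, one_mul, one_mul, Finset.mul_sum]
    congr 2
    exact Finset.sum_congr rfl fun _ _ => by ring
  rw [e1]
  have hg := sum_goldCount_le hG (by linarith) hM0 hMT hV hρ (hM.alive_fst e he) (hM.cover e he)
  have hk := (killCount_le hρ (hM.alive_snd e he)).trans (h2 e he)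
  have hw : Real.log (wt nb ρ e.1) - Real.log (wt nb (ρ + 1) e.2) ≤ growth nb ρ e.1 := by
    have : Real.log (ball nb (ρ + 1) e.2).card ≤ Real.log (ball nb (ρ + 2) e.1).card := by
      refine Real.log_le_log (by exact_mod_cast ball_card_pos _ _) ?_
      exact_mod_cast Finset.card_le_card (ball_adj_subset (hM.adj e he) (ρ + 1))
    simp only [wt, growth, one_div, Real.log_inv]
    linarith
  have hl := mul_le_mul_of_nonneg_right hk (Real.log_nonneg hK)
  have hg' := mul_le_mul_of_nonneg_left hg hτ
  have h3 : par.τ * (par.K * (totalAct nb par lab T e.1 + 1)) ≤ par.τ * (par.K * (s0 + 1)) := by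
    have := h1 e he
    gcongr
  linarith

/-- The differences telescope with stride two, leaving the two largest balls minus the two smallest.
-/
theorem sum_growth_le (hG : IsGraph nb V) (hV : V.card ≤ par.N) (n : ℕ) {a : ℕ} (ha : a ∈ V) :
    ∑ ρ ∈ Finset.range n, growth nb ρ a ≤ 2 * Real.log par.N := by
  have hb : ∀ r, Real.log (ball nb r a).card ≤ Real.log par.N := fun r =>
    Real.log_le_log (by exact_mod_cast ball_card_pos r a)
      (by exact_mod_cast (Finset.card_le_card (hG.ball_subset ha r)).trans hV)
  have h0 : ∀ r, 0 ≤ Real.log (ball nb r a).card := fun r =>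
    Real.log_nonneg (by exact_mod_cast ball_card_pos r a)
  have : ∑ ρ ∈ Finset.range n, growth nb ρ a =
      Real.log (ball nb (n + 1) a).card + Real.log (ball nb n a).card -
        (Real.log (ball nb 1 a).card + Real.log (ball nb 0 a).card) := by
    induction n with
    | zero => simp
    | succ n ih => rw [Finset.sum_range_succ, ih, growth]; ring
  rw [this]
  linarith [hb (n + 1), hb n, h0 1, h0 0]

theorem sum_load_le (hG : IsGraph nb V) (st : St) (ρ : ℕ) :
    ∑ b ∈ V, load nb par st ρ b ≤ (cover nb par V).card := by
  have : ∑ b ∈ V, load nb par st ρ b = ∑ a ∈ (cover nb par V).filter (alive st),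
      ∑ b ∈ nb a, qt nb par st ρ a b := by
    unfold load
    refine Finset.sum_comm' fun b a => ?_
    simp only [senders, cover, Finset.mem_filter]
    constructor
    · rintro ⟨_, h1, h2, h3⟩; exact ⟨hG.symm h1, ⟨hG.sub _ h1, h3⟩, h2⟩
    · rintro ⟨h1, ⟨_, h3⟩, h2⟩; exact ⟨hG.sub _ h1, hG.symm h1, h2, h3⟩
  rw [this]
  refine (Finset.sum_le_card_nsmul _ _ 1 fun a _ => sum_qt_le ρ a).trans ?_
  rw [nsmul_eq_mul, mul_one]
  exact_mod_cast Finset.card_filter_le _ _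

theorem card_killed_le (hG : IsGraph nb V) (st : St) (ρ : ℕ) :
    (V.filter fun b => 1 ≤ load nb par st ρ b).card ≤ (cover nb par V).card := by
  have : ((V.filter fun b => 1 ≤ load nb par st ρ b).card : ℝ) ≤ (cover nb par V).card := by
    refine le_trans ?_ (sum_load_le hG st ρ)
    rw [← Finset.sum_boole]
    refine Finset.sum_le_sum fun b _ => ?_
    split_ifs with h
    · exact h
    · exact Finset.sum_nonneg fun _ _ => qt_nonneg _ _ _
  exact_mod_cast this

theorem card_dead_le {st : St} (h : IsPartial nb par st.ptn) (hG : IsGraph nb V) :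
    (V.filter fun b => ¬ alive st b).card ≤ 2 * (cover nb par V).card := by
  have hs : V.filter (fun b => ¬ alive st b) ⊆ cover nb par V ∪
      (cover nb par V).image fun a => (st.ptn a).getD 0 := by
    intro b hb
    obtain ⟨hbV, hb⟩ := Finset.mem_filter.1 hb
    obtain ⟨a, ha⟩ := Option.ne_none_iff_exists'.1 hb
    rw [Finset.mem_union]
    rcases h.cover ha with hc | hc
    · exact Or.inl (Finset.mem_filter.2 ⟨hbV, hc⟩)
    · right
      refine Finset.mem_image.2 ⟨a, Finset.mem_filter.2 ⟨hG.sub _ (h.adj ha), hc⟩, ?_⟩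
      rw [h.symm ha]; rfl
  refine (Finset.card_le_card hs).trans ((Finset.card_union_le _ _).trans ?_)
  have := Finset.card_image_le (s := cover nb par V) (f := fun a => (st.ptn a).getD 0)
  omega

/-- Only cover vertices send, each with total mass at most 1, so a step overloads at most as many
vertices as the cover has. Matched edges all meet the cover, so at most twice the cover is matched;
this explains `T + 2`. -/
theorem card_hit_le (hG : IsGraph nb V) (ρ : ℕ) :
    (V.filter (hit nb par lab ρ T)).card ≤ (T + 2) * (cover nb par V).card := by
  have hs : V.filter (hit nb par lab ρ T) ⊆ V.filter (fun b => ¬ alive (state nb par lab T) b) ∪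
      (times ρ T).biUnion fun t =>
        V.filter fun b => 1 ≤ load nb par (state nb par lab t) ρ b := by
    intro b hb
    obtain ⟨hbV, t, ht, hf⟩ := Finset.mem_filter.1 hb
    rw [Finset.mem_union, Finset.mem_biUnion]
    by_cases ha : alive (state nb par lab T) b
    · right
      refine ⟨t, ht, Finset.mem_filter.2 ⟨hbV, ?_⟩⟩
      by_contra! hl
      exact hf ⟨alive_anti (Finset.mem_range.1 (Finset.mem_filter.1 ht).1).le ha, hl⟩
    · exact Or.inl (Finset.mem_filter.2 ⟨hbV, ha⟩)
  have h1 := card_dead_le (state_isPartial (par := par) hG lab T) hG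
  have h2 := Finset.card_biUnion_le_card_mul (times ρ T)
    (fun t => V.filter fun b => 1 ≤ load nb par (state nb par lab t) ρ b)
    (cover nb par V).card fun t _ => card_killed_le hG _ ρ
  have h3 : (times ρ T).card ≤ T := (Finset.card_filter_le _ _).trans (Finset.card_range T).le
  have h4 := Nat.mul_le_mul_right (cover nb par V).card h3
  have h5 := (Finset.card_le_card hs).trans (Finset.card_union_le _ _)
  nlinarith

end Proposal

/-! ### The total number of updates under a large residual matching -/

namespace Proposal

open scoped Classical

variable {nb : ℕ → Finset ℕ} {V : Finset ℕ} {par : Par} {lab : ℕ → ℕ → Lab} {T : ℕ}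
  {Mb : Finset (ℕ × ℕ)}

/-- The number of steps of the learners of type `ρ` is bounded as long as a large matching
remains. -/
theorem card_times_le_of_residual (hG : IsGraph nb V) (hK : 3 < par.K) (hτ : 0 < par.τ)
    (hM0 : 0 < par.M) (hMT : T * par.N ≤ par.M) (hV : V.card ≤ par.N)
    (hM : Residual nb par (state nb par lab T) Mb) (hne : Mb.Nonempty) {s s0 : ℝ}
    (h1 : ∀ e ∈ Mb, totalAct nb par lab T e.1 ≤ s0)
    (h2 : ∀ e ∈ Mb, totalAct nb par lab T e.2 ≤ s0)
    (hs : (cover nb par V).card ≤ Real.exp s * Mb.card) {ρ : ℕ} (hρ : ρ < par.R) :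
    ((times ρ T).card : ℝ) ≤
      2 * par.K / par.τ * (par.τ * s + Real.log par.N +
        (par.τ * par.K * (s0 + 1) + s0 * Real.log par.K +
          (∑ e ∈ Mb, growth nb ρ e.1) / Mb.card)) +
      1 / Real.log (par.K / 3) * (par.τ * s + Real.log 2 + Real.log (1 + (T + 2) * Real.exp s) +
        2 / par.K * Real.log (1 + par.N) +
        (par.τ * par.K * (s0 + 1) + s0 * Real.log par.K +
          (∑ e ∈ Mb, growth nb ρ e.1) / Mb.card)) := by
  set m : ℝ := (Mb.card : ℝ) with hm
  have hm1 : 1 ≤ m := by rw [hm]; exact_mod_cast hne.card_pos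
  have hm0 : 0 < m := by linarith
  have hlK : 0 < Real.log (par.K / 3) := Real.log_pos (by linarith)
  have hK0 : 0 < par.K := by linarith
  set H := ∑ c ∈ V, costSum nb par lab Mb ρ T c with hH
  have hHle := sum_costSum_le hG (by linarith) hτ.le hM0 hMT hV hρ hM h1 h2
  have hsum : ∑ c ∈ V, mass nb Mb ρ c = m := sum_mass hG hM ρ
  have hU : ∑ c ∈ V, uSum nb par ρ c = (cover nb par V).card := sum_filter_wt hG ρ _
  have hW : ∑ c ∈ V, wSum nb ρ c = V.card := by
    have := sum_filter_wt hG (ρ + 1) (fun _ => True)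
    simpa only [Finset.filter_true, wSum] using this
  have hHit : ∑ c ∈ V, hitSum nb par lab ρ T c = (V.filter (hit nb par lab ρ T)).card :=
    sum_filter_wt hG (ρ + 1) _
  have uN : ∀ c, 0 ≤ uSum nb par ρ c := fun c => Finset.sum_nonneg fun _ _ => (wt_pos _ _).le
  have wN : ∀ c, 0 ≤ wSum nb ρ c := fun c => Finset.sum_nonneg fun _ _ => (wt_pos _ _).le
  have hN : ∀ c, 0 ≤ hitSum nb par lab ρ T c := fun c =>
    Finset.sum_nonneg fun _ _ => (wt_pos _ _).le
  have mN : ∀ c, 0 ≤ mass nb Mb ρ c := mass_nonneg ρ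
  have wP : ∀ c, 0 < wSum nb ρ c := fun c =>
    Finset.sum_pos (fun _ _ => wt_pos _ _) ⟨c, mem_ball_self _ c⟩
  -- The local bounds are summed with weights `mass c`. By the log sum inequality, uneven ratios
  -- among the learners cost no more than the global ratio.
  have L : ∀ x : ℕ → ℝ, (∀ c, 0 ≤ x c) → (∀ c, 0 < mass nb Mb ρ c → 0 < x c) →
      ∀ X, ∑ c ∈ V, x c ≤ X →
      ∑ c ∈ V, mass nb Mb ρ c * (Real.log (x c) - Real.log (mass nb Mb ρ c)) ≤
        m * (Real.log X - Real.log m) := by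
    intro x hx hx' X hX
    have := sum_mul_log_sub_log_le V (mass nb Mb ρ) x (fun c _ => mN c)
      (fun c _ => hx c) (fun c _ => hx' c) (hsum ▸ hm0) hX
    rwa [hsum] at this
  have LU := L (uSum nb par ρ) uN (fun c h => h.trans_le (mass_le_uSum hM ρ c)) _ hU.le
  have LW := L (wSum nb ρ) wN (fun c _ => wP c) _ hW.le
  have LH := L (fun c => mass nb Mb ρ c + hitSum nb par lab ρ T c)
    (fun c => add_nonneg (mN c) (hN c)) (fun c h => add_pos_of_pos_of_nonneg h (hN c))
    (m + (V.filter (hit nb par lab ρ T)).card)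
    (by rw [Finset.sum_add_distrib, hsum, hHit])
  have LW' := L (fun c => mass nb Mb ρ c + wSum nb ρ c)
    (fun c => add_nonneg (mN c) (wN c)) (fun c h => add_pos_of_pos_of_nonneg h (wN c)) (m + V.card)
    (by rw [Finset.sum_add_distrib, hsum, hW])
  -- weighted sum of the bounds for the learners
  have key : ∀ c ∈ V, mass nb Mb ρ c * ((times ρ T).card : ℝ) ≤
      (par.τ * (mass nb Mb ρ c * (Real.log (uSum nb par ρ c) - Real.log (mass nb Mb ρ c))) +
        mass nb Mb ρ c * (Real.log (wSum nb ρ c) - Real.log (mass nb Mb ρ c)) +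
        costSum nb par lab Mb ρ T c) * (2 * par.K / par.τ) +
      (par.τ * (mass nb Mb ρ c * (Real.log (uSum nb par ρ c) - Real.log (mass nb Mb ρ c))) +
        mass nb Mb ρ c * Real.log 2 +
        mass nb Mb ρ c * (Real.log (mass nb Mb ρ c + hitSum nb par lab ρ T c) -
          Real.log (mass nb Mb ρ c)) +
        2 / par.K * (mass nb Mb ρ c * (Real.log (mass nb Mb ρ c + wSum nb ρ c) -
          Real.log (mass nb Mb ρ c))) +
        costSum nb par lab Mb ρ T c) * (1 / Real.log (par.K / 3)) := by
    intro c _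
    rcases (near nb Mb ρ c).eq_empty_or_nonempty with h | h
    · simp [mass, costSum, h]
    · have hmc := mass_pos h
      refine (mul_le_mul_of_nonneg_left (card_times_le hG hK hτ hM h) hmc.le).trans (le_of_eq ?_)
      field_simp
  have S := Finset.sum_le_sum key
  rw [← Finset.sum_mul, hsum, Finset.sum_add_distrib, ← Finset.sum_mul, ← Finset.sum_mul] at S
  simp only [Finset.sum_add_distrib] at S
  rw [← Finset.mul_sum, ← Finset.mul_sum, ← Finset.sum_mul, hsum, ← hH] at S
  have hnN : (V.card : ℝ) ≤ par.N := by exact_mod_cast hV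
  have hV0 : (1 : ℝ) ≤ V.card := by
    obtain ⟨e, he⟩ := hne
    exact_mod_cast Finset.card_pos.2 ⟨e.2, hG.sub _ (hM.adj e he)⟩
  have hlm : 0 ≤ Real.log m := Real.log_nonneg hm1
  have bU : Real.log (cover nb par V).card - Real.log m ≤ s := by
    rcases Nat.eq_zero_or_pos (cover nb par V).card with h0 | h0
    · exfalso
      obtain ⟨e, he⟩ := hne
      have : e.1 ∈ cover nb par V :=
        Finset.mem_filter.2 ⟨hG.sub _ (hG.symm (hM.adj e he)), hM.cover e he⟩
      rw [Finset.card_eq_zero.1 h0] at this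
      exact absurd this (Finset.notMem_empty _)
    · have := Real.log_le_log (by exact_mod_cast h0) hs
      rw [Real.log_mul (Real.exp_pos _).ne' hm0.ne', Real.log_exp] at this
      linarith
  have bW : Real.log V.card - Real.log m ≤ Real.log par.N := by
    have := Real.log_le_log (by linarith) hnN
    linarith
  have bH : Real.log (m + (V.filter (hit nb par lab ρ T)).card) - Real.log m ≤
      Real.log (1 + (T + 2) * Real.exp s) := by
    rw [← Real.log_div (by positivity) hm0.ne']
    refine Real.log_le_log (by positivity) ?_
    rw [add_div, div_self hm0.ne', add_le_add_iff_left, div_le_iff₀ hm0]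
    have h : ((V.filter (hit nb par lab ρ T)).card : ℝ) ≤ (T + 2) * (cover nb par V).card := by
      exact_mod_cast card_hit_le hG ρ
    refine h.trans ?_
    rw [mul_assoc]
    exact mul_le_mul_of_nonneg_left hs (by positivity)
  have bW' : Real.log (m + V.card) - Real.log m ≤ Real.log (1 + par.N) := by
    rw [← Real.log_div (by positivity) hm0.ne']
    refine Real.log_le_log (by positivity) ?_
    rw [add_div, div_self hm0.ne', add_le_add_iff_left, div_le_iff₀ hm0]
    nlinarith
  set h := par.τ * par.K * (s0 + 1) + s0 * Real.log par.K + (∑ e ∈ Mb, growth nb ρ e.1) / m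
    with hh
  have bC : H ≤ m * h := by
    refine hHle.trans (le_of_eq ?_)
    rw [hh, ← hm]; field_simp
  have hα : 0 ≤ 2 * par.K / par.τ := by positivity
  have hβ : 0 ≤ 1 / Real.log (par.K / 3) := by positivity
  have cU := mul_le_mul_of_nonneg_left (LU.trans (mul_le_mul_of_nonneg_left bU hm0.le)) hτ.le
  have cW := LW.trans (mul_le_mul_of_nonneg_left bW hm0.le)
  have cH := LH.trans (mul_le_mul_of_nonneg_left bH hm0.le)
  have cW' := mul_le_mul_of_nonneg_left (LW'.trans (mul_le_mul_of_nonneg_left bW' hm0.le))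
    (by positivity : 0 ≤ 2 / par.K)
  refine le_of_mul_le_mul_left (S.trans ?_) hm0
  have A := mul_le_mul_of_nonneg_right (add_le_add (add_le_add cU cW) bC) hα
  have B := mul_le_mul_of_nonneg_right (add_le_add (add_le_add (add_le_add (add_le_add cU
    (le_refl (m * Real.log 2))) cH) cW') bC) hβ
  refine (add_le_add A B).trans (le_of_eq ?_)
  ring

/-- A large residual matching all of whose vertices have seen little activity forces the total
number of learning steps to be small. -/
theorem sum_card_times_le (hG : IsGraph nb V) (hK : 3 < par.K) (hτ : 0 < par.τ)
    (hM0 : 0 < par.M) (hMT : T * par.N ≤ par.M) (hV : V.card ≤ par.N)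
    (hM : Residual nb par (state nb par lab T) Mb) (hne : Mb.Nonempty) {s s0 : ℝ}
    (h1 : ∀ e ∈ Mb, totalAct nb par lab T e.1 ≤ s0)
    (h2 : ∀ e ∈ Mb, totalAct nb par lab T e.2 ≤ s0)
    (hs : (cover nb par V).card ≤ Real.exp s * Mb.card) :
    ∑ ρ ∈ Finset.range par.R, ((times ρ T).card : ℝ) ≤
      par.R * (2 * par.K / par.τ * (par.τ * s + Real.log par.N +
        (par.τ * par.K * (s0 + 1) + s0 * Real.log par.K)) +
      1 / Real.log (par.K / 3) * (par.τ * s + Real.log 2 + Real.log (1 + (T + 2) * Real.exp s) +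
        2 / par.K * Real.log (1 + par.N) +
        (par.τ * par.K * (s0 + 1) + s0 * Real.log par.K))) +
      (2 * par.K / par.τ + 1 / Real.log (par.K / 3)) * (2 * Real.log par.N) := by
  have hm0 : (0 : ℝ) < Mb.card := by exact_mod_cast hne.card_pos
  have hlK : 0 < Real.log (par.K / 3) := Real.log_pos (by linarith)
  have hK0 : 0 < par.K := by linarith
  -- The decisive saving: the growth terms of all types together are at most `2 * log N`, rather
  -- than each of them separately.
  have hgr : ∑ ρ ∈ Finset.range par.R, (∑ e ∈ Mb, growth nb ρ e.1) / Mb.card ≤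
      2 * Real.log par.N := by
    rw [← Finset.sum_div, Finset.sum_comm, div_le_iff₀ hm0]
    refine (Finset.sum_le_card_nsmul _ _ _ fun e he =>
      sum_growth_le hG hV par.R (hG.sub _ (hG.symm (hM.adj e he)))).trans ?_
    rw [nsmul_eq_mul, mul_comm]
  have hb := Finset.sum_le_sum fun ρ hρ => card_times_le_of_residual hG hK hτ hM0 hMT hV hM hne
    h1 h2 hs (Finset.mem_range.1 hρ)
  have hαβ : 0 ≤ 2 * par.K / par.τ + 1 / Real.log (par.K / 3) := by positivity
  have hg := mul_le_mul_of_nonneg_left hgr hαβ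
  refine hb.trans ?_
  refine le_trans (le_of_eq ?_) (add_le_add (le_refl _) hg)
  have hc : ∀ x : ℝ, par.R * x = ∑ _ρ ∈ Finset.range par.R, x := by
    intro x; rw [Finset.sum_const, Finset.card_range, nsmul_eq_mul]
  rw [hc, Finset.mul_sum, ← Finset.sum_add_distrib]
  exact Finset.sum_congr rfl fun ρ _ => by ring

end Proposal

/-! ### Counting in product spaces -/

section Product

variable {ι Λ : Type*} [Fintype ι] [DecidableEq ι] [Fintype Λ]

theorem card_box (B : ι → Finset Λ) (c : ι → ℝ)
    (hc : ∀ i, ((B i).card : ℝ) = c i * Fintype.card Λ) :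
    ((Fintype.piFinset B).card : ℝ) = (∏ i, c i) * Fintype.card (ι → Λ) := by
  rw [Fintype.card_piFinset, Fintype.card_fun]
  push_cast
  rw [Finset.prod_congr rfl fun i _ => hc i, Finset.prod_mul_distrib, Finset.prod_const]
  rfl

theorem one_sub_sum_le_prod {ι : Type*} (S : Finset ι) (p : ι → ℝ) (h0 : ∀ i ∈ S, 0 ≤ p i)
    (h1 : ∀ i ∈ S, p i ≤ 1) : 1 - ∑ i ∈ S, p i ≤ ∏ i ∈ S, (1 - p i) := by
  classical
  induction S using Finset.induction_on with
  | empty => simp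
  | insert a S ha ih =>
    rw [Finset.sum_insert ha, Finset.prod_insert ha]
    have := ih (fun i hi => h0 i (Finset.mem_insert_of_mem hi))
      (fun i hi => h1 i (Finset.mem_insert_of_mem hi))
    have ha0 := h0 a (Finset.mem_insert_self _ _)
    have ha1 := h1 a (Finset.mem_insert_self _ _)
    have hS : 0 ≤ ∑ i ∈ S, p i := Finset.sum_nonneg fun i hi => h0 i (Finset.mem_insert_of_mem hi)
    nlinarith [mul_le_mul_of_nonneg_left this (sub_nonneg.2 ha1), mul_nonneg ha0 hS]

theorem half_le_one_sub_prod {ι : Type*} (S : Finset ι) (p : ι → ℝ) (h1 : ∀ i ∈ S, p i ≤ 1)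
    {x : ℝ} (hx0 : 0 ≤ x) (hx1 : x ≤ 1) (hx : x ≤ ∑ i ∈ S, p i) :
    x / 2 ≤ 1 - ∏ i ∈ S, (1 - p i) := by
  have h2 : ∏ i ∈ S, (1 - p i) ≤ Real.exp (-x) := by
    calc ∏ i ∈ S, (1 - p i) ≤ ∏ i ∈ S, Real.exp (-p i) :=
          Finset.prod_le_prod (fun i hi => sub_nonneg.2 (h1 i hi))
            fun i _ => by have := Real.add_one_le_exp (-p i); linarith
      _ = Real.exp (-∑ i ∈ S, p i) := by rw [← Real.exp_sum, Finset.sum_neg_distrib]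
      _ ≤ _ := Real.exp_le_exp.2 (by linarith)
  have h3 : Real.exp (-x) ≤ 1 / (1 + x) := by
    rw [Real.exp_neg, ← one_div]
    exact one_div_le_one_div_of_le (by linarith) (by have := Real.add_one_le_exp x; linarith)
  have h4 : 1 / (1 + x) ≤ 1 - x / 2 := by
    rw [div_le_iff₀ (by linarith)]; nlinarith
  linarith

/-- The set is a box: coordinates in `A` and in `S` are restricted independently and the others are
arbitrary, so its density is a product. -/
theorem card_box_avoid (A S : Finset ι) (hAS : Disjoint A S) (X H : ι → Finset Λ) (x p : ι → ℝ)
    (hx : ∀ i ∈ A, ((X i).card : ℝ) = x i * Fintype.card Λ)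
    (hp : ∀ i ∈ S, ((H i).card : ℝ) = p i * Fintype.card Λ)
    [DecidablePred fun d : ι → Λ => (∀ i ∈ A, d i ∈ X i) ∧ ∀ i ∈ S, d i ∉ H i] :
    (((Finset.univ : Finset (ι → Λ)).filter fun d =>
      (∀ i ∈ A, d i ∈ X i) ∧ ∀ i ∈ S, d i ∉ H i).card : ℝ) =
      (∏ i ∈ A, x i) * (∏ i ∈ S, (1 - p i)) * Fintype.card (ι → Λ) := by
  classical
  have e : ((Finset.univ : Finset (ι → Λ)).filter fun d =>
      (∀ i ∈ A, d i ∈ X i) ∧ ∀ i ∈ S, d i ∉ H i) =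
      Fintype.piFinset fun i => if i ∈ A then X i else if i ∈ S then (H i)ᶜ else Finset.univ := by
    ext d
    rw [Finset.mem_filter, Fintype.mem_piFinset]
    constructor
    · rintro ⟨_, h1, h2⟩ i
      split_ifs with h3 h4
      · exact h1 i h3
      · exact Finset.mem_compl.2 (h2 i h4)
      · exact Finset.mem_univ _
    · intro h
      refine ⟨Finset.mem_univ _, fun i hi => by simpa [hi] using h i, fun i hi => ?_⟩
      have := h i
      rw [if_neg (Finset.disjoint_right.1 hAS hi), if_pos hi] at this
      exact Finset.mem_compl.1 this
  have hc : ∀ i, ((if i ∈ A then X i else if i ∈ S then (H i)ᶜ else Finset.univ).card : ℝ) =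
      ((if i ∈ A then x i else 1) * (if i ∈ S then 1 - p i else 1)) * Fintype.card Λ := by
    intro i
    split_ifs with h3 h4 h4
    · exact absurd h4 (Finset.disjoint_left.1 hAS h3)
    · rw [hx i h3, mul_one]
    · rw [Finset.card_compl, Nat.cast_sub (Finset.card_le_univ _), hp i h4]; ring
    · rw [one_mul, one_mul]; rfl
  rw [e, card_box _ _ hc, Finset.prod_mul_distrib, Finset.prod_ite_mem, Finset.prod_ite_mem,
    Finset.univ_inter, Finset.univ_inter]

end Product

/-! ### The probability of being matched in one step -/

/-- Labels within the range of the parameters. -/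
abbrev Lb (R M : ℕ) : Type := Bool × Fin R × Fin M

def toLab {R M : ℕ} (x : Lb R M) : Lab := (x.1, x.2.1, x.2.2)

/-- The labels of the identifiers. -/
noncomputable def extLab {ι : Type*} {R M : ℕ} (ident : ι → ℕ) (d : ι → Lb R M) : ℕ → Lab :=
  Function.extend ident (fun i => toLab (d i)) fun _ => default

namespace Proposal

open scoped Classical

variable {nb : ℕ → Finset ℕ} {V : Finset ℕ} {par : Par}

def receivers (R M ρ : ℕ) : Finset (Lb R M) :=
  Finset.univ.filter fun x => x.1 = false ∧ (x.2.1 : ℕ) = ρ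

/-- The labels with which `a` targets `b` for the learners of type `ρ`. -/
noncomputable def hits (nb : ℕ → Finset ℕ) (par : Par) (st : St) (ρ a b : ℕ) :
    Finset (Lb par.R par.M) :=
  Finset.univ.filter fun x => x.1 = true ∧ (x.2.1 : ℕ) = ρ ∧
    pick par.M (nb a) (num nb par st ρ a) x.2.2 = some b

theorem card_receivers {R M ρ : ℕ} (hρ : ρ < R) :
    ((receivers R M ρ).card : ℝ) = 1 / (2 * R) * Fintype.card (Lb R M) := by
  have : receivers R M ρ = {false} ×ˢ {⟨ρ, hρ⟩} ×ˢ Finset.univ := by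
    ext ⟨x, y, z⟩
    simp only [receivers, Finset.mem_filter, Finset.mem_univ, true_and, Finset.mem_product,
      Finset.mem_singleton, Fin.ext_iff, and_true]
  have hR : (0 : ℝ) < R := by exact_mod_cast (by omega : 0 < R)
  rw [this, Finset.card_product, Finset.card_product]
  simp
  field_simp

/-- Role and type have density `1 / (2 * R)`, and `pick` takes the value `b` on a fraction `qt` of
the indices. -/
theorem card_hits {st : St} {ρ a b : ℕ} (hρ : ρ < par.R) (hM : 0 < par.M) (hb : b ∈ nb a) :
    ((hits nb par st ρ a b).card : ℝ) =
      qt nb par st ρ a b / (2 * par.R) * Fintype.card (Lb par.R par.M) := by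
  have : hits nb par st ρ a b = {true} ×ˢ {⟨ρ, hρ⟩} ×ˢ (Finset.univ.filter fun i : Fin par.M =>
      pick par.M (nb a) (num nb par st ρ a) i = some b) := by
    ext ⟨x, y, z⟩
    simp only [hits, Finset.mem_filter, Finset.mem_univ, true_and, Finset.mem_product,
      Finset.mem_singleton, Fin.ext_iff]
  have hc : (Finset.univ.filter fun i : Fin par.M =>
      pick par.M (nb a) (num nb par st ρ a) i = some b).card = num nb par st ρ a b := by
    rw [← card_pick hb, Finset.card_filter, Finset.card_filter,
      Fin.sum_univ_eq_sum_range fun i =>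
        if pick par.M (nb a) (num nb par st ρ a) i = some b then 1 else 0]
  have hR : (0 : ℝ) < par.R := by exact_mod_cast (by omega : 0 < par.R)
  have hM' : (0 : ℝ) < par.M := by exact_mod_cast hM
  rw [this, Finset.card_product, Finset.card_product, hc, qt]
  simp
  field_simp

theorem num_le (st : St) {ρ a b : ℕ} (hb : b ∈ nb a) : num nb par st ρ a b ≤ par.M :=
  (Finset.single_le_sum (f := num nb par st ρ a) (fun _ _ => Nat.zero_le _) hb).trans
    (sum_num_le ρ a)

theorem qt_le_one (st : St) {ρ a b : ℕ} (hb : b ∈ nb a) : qt nb par st ρ a b ≤ 1 :=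
  div_le_one_of_le₀ (by exact_mod_cast num_le st hb) (Nat.cast_nonneg _)

variable {ι : Type*} {ident : ι → ℕ} {st : St} {t : ℕ}

theorem extLab_apply (hid : Function.Injective ident) (d : ι → Lb par.R par.M) (i : ι) :
    extLab ident d (ident i) = toLab (d i) := hid.extend_apply _ _ i

theorem target_of_mem_hits (hid : Function.Injective ident) {d : ι → Lb par.R par.M} {ρ b : ℕ}
    (hρ : ρ + 1 ∣ t) {i : ι} (ha : alive st (ident i)) (hc : inCover nb par (ident i))
    (hd : d i ∈ hits nb par st ρ (ident i) b) :
    target nb par st t (extLab ident d) (ident i) = some b ∧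
      (extLab ident d (ident i)).2.1 = ρ := by
  obtain ⟨_, h1, h2, h3⟩ := Finset.mem_filter.1 hd
  have e := extLab_apply hid d i
  rw [target, e]
  have h4 : (toLab (d i)).2.1 = ρ := h2
  refine ⟨?_, h4⟩
  rw [if_pos ⟨ha, hc, h1, (d i).2.1.isLt, by rw [h4]; exact hρ⟩, h4]
  exact h3

theorem mem_hits_of_target (hid : Function.Injective ident) {d : ι → Lb par.R par.M} {ρ b : ℕ}
    {i : ι} (h : target nb par st t (extLab ident d) (ident i) = some b)
    (hρ : (extLab ident d (ident i)).2.1 = ρ) : d i ∈ hits nb par st ρ (ident i) b := by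
  have hs := target_spec h
  rw [target, if_pos hs] at h
  rw [extLab_apply hid] at *
  have hρ' : ((d i).2.1 : ℕ) = ρ := hρ
  refine Finset.mem_filter.2 ⟨Finset.mem_univ _, hs.2.2.1, hρ', ?_⟩
  rw [hρ] at h; exact h

variable [Fintype ι]

/-- The vertices that may target `b`. -/
noncomputable def sendersIdx (nb : ℕ → Finset ℕ) (par : Par) (st : St) (ident : ι → ℕ) (b : ℕ) :
    Finset ι :=
  Finset.univ.filter fun i => ident i ∈ senders nb par st b

theorem sum_sendersIdx (hG : IsGraph nb V) (hV : V = Finset.univ.image ident)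
    (hid : Function.Injective ident) (b : ℕ) (f : ℕ → ℝ) :
    ∑ i ∈ sendersIdx nb par st ident b, f (ident i) = ∑ a ∈ senders nb par st b, f a := by
  rw [← Finset.sum_image (s := sendersIdx nb par st ident b) (g := ident) (f := f)
    fun x _ y _ h => hid h]
  congr 1
  ext a
  simp only [sendersIdx, Finset.mem_image, Finset.mem_filter, Finset.mem_univ, true_and]
  constructor
  · rintro ⟨i, h, rfl⟩; exact h
  · intro h
    have : a ∈ V := hG.sub _ (Finset.mem_filter.1 h).1
    rw [hV] at this
    obtain ⟨i, _, rfl⟩ := Finset.mem_image.1 this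
    exact ⟨i, h, rfl⟩

/-- Labels for which the receiver `v` gets an offer of type `ρ`. -/
noncomputable def acceptEvent (nb : ℕ → Finset ℕ) (par : Par) (st : St) (ident : ι → ℕ) (ρ : ℕ)
    (v : ι) : Finset (ι → Lb par.R par.M) :=
  Finset.univ.filter fun d => d v ∈ receivers par.R par.M ρ ∧
    ∃ i ∈ sendersIdx nb par st ident (ident v), d i ∈ hits nb par st ρ (ident i) (ident v)

/-- Labels for which `v` is the only vertex that targets the receiver `b` for type `ρ`. -/
noncomputable def sendEvent (nb : ℕ → Finset ℕ) (par : Par) (st : St) (ident : ι → ℕ) (ρ : ℕ)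
    (v : ι) (b : ℕ) : Finset (ι → Lb par.R par.M) :=
  Finset.univ.filter fun d => d v ∈ hits nb par st ρ (ident v) b ∧
    (∃ w, ident w = b ∧ d w ∈ receivers par.R par.M ρ) ∧
    ∀ i ∈ (sendersIdx nb par st ident b).erase v, d i ∉ hits nb par st ρ (ident i) b

/-- The vertex is a receiver of type `ρ` with probability `1 / (2 * R)`. Independently, the senders
hit it with probabilities whose sum is at least `1 / (2 * R)`, so one of them does with probability
at least `1 / (4 * R)`. -/
theorem card_acceptEvent_ge (hG : IsGraph nb V) (hV : V = Finset.univ.image ident)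
    (hid : Function.Injective ident) (hM : 0 < par.M) {ρ : ℕ} (hρ : ρ < par.R) (v : ι)
    (hl : 1 ≤ load nb par st ρ (ident v)) :
    1 / (8 * (par.R : ℝ) ^ 2) * Fintype.card (ι → Lb par.R par.M) ≤
      (acceptEvent nb par st ident ρ v).card := by
  have hR1 : (1 : ℝ) ≤ par.R := by exact_mod_cast (by omega : 1 ≤ par.R)
  set S := sendersIdx nb par st ident (ident v)
  set p : ι → ℝ := fun i => qt nb par st ρ (ident i) (ident v) / (2 * par.R) with hp
  have hadj : ∀ i ∈ S, ident v ∈ nb (ident i) := fun i hi =>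
    hG.symm (Finset.mem_filter.1 (Finset.mem_filter.1 hi).2).1
  have hvS : v ∉ S := fun h => hG.irrefl _ (hadj v h)
  have hc : ∀ i ∈ S, ((hits nb par st ρ (ident i) (ident v)).card : ℝ) =
      p i * Fintype.card (Lb par.R par.M) := fun i hi => card_hits hρ hM (hadj i hi)
  have c0 := card_box_avoid {v} ∅ (by simp) (fun _ => receivers par.R par.M ρ)
    (fun _ => ∅) (fun _ => 1 / (2 * par.R)) (fun _ => 0) (fun _ _ => card_receivers hρ) (by simp)
  have c1 := card_box_avoid {v} S (by simpa using hvS) (fun _ => receivers par.R par.M ρ)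
    (fun i => hits nb par st ρ (ident i) (ident v)) (fun _ => 1 / (2 * par.R)) p
    (fun _ _ => card_receivers hρ) hc
  have hsplit : (acceptEvent nb par st ident ρ v).card +
      (Finset.univ.filter fun d : ι → Lb par.R par.M => (∀ i ∈ ({v} : Finset ι),
        d i ∈ receivers par.R par.M ρ) ∧
        ∀ i ∈ S, d i ∉ hits nb par st ρ (ident i) (ident v)).card =
      (Finset.univ.filter fun d : ι → Lb par.R par.M => (∀ i ∈ ({v} : Finset ι),
        d i ∈ receivers par.R par.M ρ) ∧ ∀ i ∈ (∅ : Finset ι), d i ∉ (∅ : Finset _)).card := by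
    rw [← Finset.card_union_of_disjoint]
    · congr 1
      ext d
      simp only [acceptEvent, Finset.mem_union, Finset.mem_filter, Finset.mem_univ, true_and,
        Finset.mem_singleton, forall_eq, Finset.notMem_empty, IsEmpty.forall_iff, implies_true,
        and_true]
      constructor
      · rintro (h | h) <;> exact h.1
      · intro h
        by_cases h2 : ∃ i ∈ S, d i ∈ hits nb par st ρ (ident i) (ident v)
        · exact Or.inl ⟨h, h2⟩
        · push Not at h2; exact Or.inr ⟨h, h2⟩
    · rw [Finset.disjoint_left]
      intro d h1 h2
      obtain ⟨_, _, i, hi, h⟩ := Finset.mem_filter.1 h1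
      exact (Finset.mem_filter.1 h2).2.2 i hi h
  have hsplit' := congrArg (Nat.cast (R := ℝ)) hsplit
  rw [Nat.cast_add, c0, c1] at hsplit'
  simp only [Finset.prod_singleton, Finset.prod_empty, mul_one] at hsplit'
  have hsum : ∑ i ∈ S, p i = load nb par st ρ (ident v) / (2 * par.R) := by
    simp only [hp]
    rw [← Finset.sum_div, load]
    congr 1
    exact sum_sendersIdx hG hV hid (ident v) fun a => qt nb par st ρ a (ident v)
  have hprod := half_le_one_sub_prod S p (fun i hi => by
      have := qt_le_one (par := par) (ρ := ρ) st (hadj i hi)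
      simp only [hp]
      rw [div_le_one (by linarith)]; linarith) (x := 1 / (2 * par.R)) (by positivity)
    (by rw [div_le_one (by linarith)]; linarith)
    (by rw [hsum]; exact div_le_div_of_nonneg_right hl (by linarith))
  have hD : (0 : ℝ) ≤ Fintype.card (ι → Lb par.R par.M) := Nat.cast_nonneg _
  have e : 1 / (8 * (par.R : ℝ) ^ 2) = 1 / (2 * par.R) * (1 / (2 * par.R) / 2) := by
    field_simp; norm_num
  rw [e]
  have := mul_le_mul_of_nonneg_right (mul_le_mul_of_nonneg_left hprod
    (by positivity : (0 : ℝ) ≤ 1 / (2 * par.R))) hD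
  linarith

/-- The hit has probability `qt / (2 * R)` and the right label of the receiver `1 / (2 * R)`. Load
below 1 keeps the sum of the competitors' probabilities at most `1 / 2`, so with probability at
least `1 / 2` none of them interferes. -/
theorem card_sendEvent_ge (hG : IsGraph nb V) (hV : V = Finset.univ.image ident)
    (hid : Function.Injective ident) (hM : 0 < par.M) {ρ : ℕ} (hρ : ρ < par.R) (v : ι) {b : ℕ}
    (hb : b ∈ nb (ident v)) (hf : load nb par st ρ b < 1) :
    1 / (8 * (par.R : ℝ) ^ 2) * qt nb par st ρ (ident v) b * Fintype.card (ι → Lb par.R par.M) ≤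
      (sendEvent nb par st ident ρ v b).card := by
  have hR1 : (1 : ℝ) ≤ par.R := by exact_mod_cast (by omega : 1 ≤ par.R)
  obtain ⟨w, rfl⟩ : ∃ w, ident w = b := by
    have := hG.sub _ hb
    rw [hV] at this
    obtain ⟨w, _, h⟩ := Finset.mem_image.1 this
    exact ⟨w, h⟩
  have hwv : w ≠ v := fun e => hG.irrefl _ (e ▸ hb)
  set S := (sendersIdx nb par st ident (ident w)).erase v with hS
  set p : ι → ℝ := fun i => qt nb par st ρ (ident i) (ident w) / (2 * par.R) with hp
  have hadj : ∀ i ∈ S, ident w ∈ nb (ident i) := fun i hi =>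
    hG.symm (Finset.mem_filter.1 (Finset.mem_filter.1 (Finset.mem_of_mem_erase hi)).2).1
  have hwS : w ∉ S := fun h => hG.irrefl _ (hadj w h)
  have hvS : v ∉ S := Finset.notMem_erase _ _
  have c1 := card_box_avoid {v, w} S (by
      rw [Finset.disjoint_left]
      intro i hi
      rw [Finset.mem_insert, Finset.mem_singleton] at hi
      rcases hi with rfl | rfl
      · exact hvS
      · exact hwS)
    (fun i => if i = v then hits nb par st ρ (ident v) (ident w) else receivers par.R par.M ρ)
    (fun i => hits nb par st ρ (ident i) (ident w))
    (fun i => if i = v then p v else 1 / (2 * par.R)) p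
    (fun i _ => by
      split_ifs
      · exact card_hits hρ hM hb
      · exact card_receivers hρ) (fun i hi => card_hits hρ hM (hadj i hi))
  have e : sendEvent nb par st ident ρ v (ident w) = Finset.univ.filter
      fun d : ι → Lb par.R par.M => (∀ i ∈ ({v, w} : Finset ι), d i ∈
        if i = v then hits nb par st ρ (ident v) (ident w) else receivers par.R par.M ρ) ∧
        ∀ i ∈ S, d i ∉ hits nb par st ρ (ident i) (ident w) := by
    refine Finset.filter_congr fun d _ => ?_
    rw [← and_assoc]
    refine and_congr ?_ Iff.rfl
    simp only [Finset.mem_insert, Finset.mem_singleton, forall_eq_or_imp, forall_eq, if_true,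
      if_neg hwv]
    refine and_congr Iff.rfl ⟨?_, fun h => ⟨w, rfl, h⟩⟩
    rintro ⟨w', h, h'⟩
    rwa [hid h] at h'
  rw [e, c1, Finset.prod_pair hwv.symm, if_pos rfl, if_neg hwv]
  have hp0 : ∀ i, 0 ≤ p i := fun i => div_nonneg (qt_nonneg _ _ _) (by linarith)
  have hsum : ∑ i ∈ S, p i ≤ 1 / 2 := by
    calc ∑ i ∈ S, p i ≤ ∑ i ∈ sendersIdx nb par st ident (ident w), p i :=
          Finset.sum_le_sum_of_subset_of_nonneg (Finset.erase_subset _ _) fun i _ _ => hp0 i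
      _ = load nb par st ρ (ident w) / (2 * par.R) := by
          simp only [hp]
          rw [← Finset.sum_div, load]
          congr 1
          exact sum_sendersIdx hG hV hid (ident w) fun a => qt nb par st ρ a (ident w)
      _ ≤ 1 / 2 := by
          rw [div_le_div_iff₀ (by linarith) two_pos]; linarith
  have hprod := one_sub_sum_le_prod S p (fun i _ => hp0 i) (fun i hi => by
    have := qt_le_one (par := par) (ρ := ρ) st (hadj i hi)
    simp only [hp]
    rw [div_le_one (by linarith)]; linarith)
  refine mul_le_mul_of_nonneg_right ?_ (Nat.cast_nonneg _)
  have h2 : 1 / (8 * (par.R : ℝ) ^ 2) * qt nb par st ρ (ident v) (ident w) =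
      p v * (1 / (2 * par.R)) * (1 / 2) := by
    simp only [hp]; field_simp; ring
  rw [h2]
  have := hp0 v
  exact mul_le_mul_of_nonneg_left (by linarith) (by positivity)

theorem newPtn_ne_none_of_acceptEvent (hid : Function.Injective ident) {ρ : ℕ} (hρ : ρ + 1 ∣ t)
    {v : ι} (hv : alive st (ident v)) {d : ι → Lb par.R par.M}
    (hd : d ∈ acceptEvent nb par st ident ρ v) :
    newPtn nb par st t (extLab ident d) (ident v) ≠ none := by
  obtain ⟨_, h1, i, hi, h2⟩ := Finset.mem_filter.1 hd
  obtain ⟨_, h3, h4⟩ := Finset.mem_filter.1 h1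
  obtain ⟨h5, h6, h7⟩ := Finset.mem_filter.1 (Finset.mem_filter.1 hi).2
  have ht := target_of_mem_hits hid hρ h6 h7 h2
  have ev := extLab_apply hid d v
  have hne : (offers nb par st t (extLab ident d) (ident v)).Nonempty := by
    refine ⟨ident i, Finset.mem_filter.2 ⟨h5, ht.1, ?_⟩⟩
    rw [ht.2, ev]; exact h4.symm
  have : accept nb par st t (extLab ident d) (ident v) =
      some ((offers nb par st t (extLab ident d) (ident v)).min' hne) := by
    rw [accept, dif_pos ⟨⟨hv, by rw [ev]; exact h3⟩, hne⟩]
  rw [newPtn_eq_some.2 (Or.inl this)]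
  exact Option.some_ne_none _

theorem newPtn_ne_none_of_sendEvent (hG : IsGraph nb V) (hV : V = Finset.univ.image ident)
    (hid : Function.Injective ident) {ρ : ℕ} (hρ : ρ + 1 ∣ t)
    {v : ι} (hv : alive st (ident v)) (hc : inCover nb par (ident v)) {b : ℕ} (hb : alive st b)
    {d : ι → Lb par.R par.M} (hd : d ∈ sendEvent nb par st ident ρ v b) :
    newPtn nb par st t (extLab ident d) (ident v) ≠ none := by
  obtain ⟨_, h1, ⟨w, rfl, hw⟩, h2⟩ := Finset.mem_filter.1 hd
  obtain ⟨_, h3, h4⟩ := Finset.mem_filter.1 hw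
  have ht := target_of_mem_hits hid hρ hv hc h1
  have ew := extLab_apply hid d w
  have ho : offers nb par st t (extLab ident d) (ident w) = {ident v} := by
    ext a
    rw [Finset.mem_singleton]
    constructor
    · intro ha
      obtain ⟨ha1, ha2, ha3⟩ := Finset.mem_filter.1 ha
      have haV := hG.sub _ ha1
      rw [hV] at haV
      obtain ⟨i, _, rfl⟩ := Finset.mem_image.1 haV
      by_contra hne
      have hs := target_spec ha2
      refine h2 i (Finset.mem_erase.2 ⟨fun e => hne (e ▸ rfl), Finset.mem_filter.2
        ⟨Finset.mem_univ _, Finset.mem_filter.2 ⟨ha1, hs.1, hs.2.1⟩⟩⟩) ?_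
      refine mem_hits_of_target hid ha2 ?_
      rw [ha3, ew]; exact h4
    · rintro rfl
      refine Finset.mem_filter.2 ⟨hG.symm (target_mem ht.1), ht.1, ?_⟩
      rw [ht.2, ew]; exact h4.symm
  have : accept nb par st t (extLab ident d) (ident w) = some (ident v) := by
    rw [accept, dif_pos ⟨⟨hb, by rw [ew]; exact h3⟩, by rw [ho]; exact Finset.singleton_nonempty _⟩]
    congr 1
    simp only [ho, Finset.min'_singleton]
  rw [newPtn_eq_some.2 (Or.inr ⟨ht.1, this⟩)]
  exact Option.some_ne_none _

/-- An unmatched vertex is matched in one step with probability at least proportional to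
its activity. -/
theorem card_newPtn_ge (hG : IsGraph nb V) (hV : V = Finset.univ.image ident)
    (hid : Function.Injective ident) (hM : 0 < par.M) {v : ι} (hv : alive st (ident v)) :
    1 / (8 * (par.R : ℝ) ^ 2) * stepAct nb par st t (ident v) *
      Fintype.card (ι → Lb par.R par.M) ≤
    ((Finset.univ.filter fun d : ι → Lb par.R par.M =>
      newPtn nb par st t (extLab ident d) (ident v) ≠ none).card : ℝ) := by
  -- The index `none` stands for `v` as a receiver, `some b` for `v` as a sender to `b`. The label
  -- of `v` alone distinguishes these events, so they are disjoint and their probabilities add up.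
  set E : (_ : ℕ) × Option ℕ → Finset (ι → Lb par.R par.M) := fun x => match x with
    | ⟨ρ, none⟩ => if 1 ≤ load nb par st ρ (ident v) then acceptEvent nb par st ident ρ v else ∅
    | ⟨ρ, some b⟩ => if inCover nb par (ident v) ∧ free nb par st ρ b then
        sendEvent nb par st ident ρ v b else ∅ with hE
  set X := ((Finset.range par.R).filter (· + 1 ∣ t)).sigma
    fun _ => Finset.insertNone (nb (ident v)) with hX
  have hsub : X.biUnion E ⊆ Finset.univ.filter fun d : ι → Lb par.R par.M =>
      newPtn nb par st t (extLab ident d) (ident v) ≠ none := by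
    intro d hd
    obtain ⟨⟨ρ, o⟩, hx, hd⟩ := Finset.mem_biUnion.1 hd
    have hρ := (Finset.mem_filter.1 (Finset.mem_sigma.1 hx).1).2
    refine Finset.mem_filter.2 ⟨Finset.mem_univ _, ?_⟩
    rcases o with _ | b
    · simp only [hE] at hd
      split_ifs at hd
      · exact newPtn_ne_none_of_acceptEvent hid hρ hv hd
      · exact absurd hd (Finset.notMem_empty _)
    · simp only [hE] at hd
      split_ifs at hd with h
      · exact newPtn_ne_none_of_sendEvent hG hV hid hρ hv h.1 h.2.1 hd
      · exact absurd hd (Finset.notMem_empty _)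
  have hlab : ∀ {d ρ o}, d ∈ E ⟨ρ, o⟩ → ((d v).2.1 : ℕ) = ρ ∧
      ((d v).1 = false ∧ o = none ∨ ∃ b, (d v).1 = true ∧ o = some b ∧
        pick par.M (nb (ident v)) (num nb par st ρ (ident v)) (d v).2.2 = some b) := by
    rintro d ρ (_ | b) hd
    · simp only [hE] at hd
      split_ifs at hd
      · have := (Finset.mem_filter.1 (Finset.mem_filter.1 hd).2.1).2
        exact ⟨this.2, Or.inl ⟨this.1, rfl⟩⟩
      · exact absurd hd (Finset.notMem_empty _)
    · simp only [hE] at hd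
      split_ifs at hd
      · have := (Finset.mem_filter.1 (Finset.mem_filter.1 hd).2.1).2
        exact ⟨this.2.1, Or.inr ⟨b, this.1, rfl, this.2.2⟩⟩
      · exact absurd hd (Finset.notMem_empty _)
  have hdisj : (X : Set ((_ : ℕ) × Option ℕ)).PairwiseDisjoint E := by
    rintro ⟨ρ, o⟩ _ ⟨ρ', o'⟩ _ hne
    rw [Function.onFun, Finset.disjoint_left]
    intro d h1 h2
    apply hne
    obtain ⟨e1, k1⟩ := hlab h1
    obtain ⟨e2, k2⟩ := hlab h2
    obtain rfl : ρ = ρ' := e1.symm.trans e2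
    rcases k1 with ⟨a1, rfl⟩ | ⟨b, a1, rfl, b1⟩ <;> rcases k2 with ⟨a2, rfl⟩ | ⟨b', a2, rfl, b2⟩
    · rfl
    · rw [a1] at a2; exact absurd a2 Bool.false_ne_true
    · rw [a2] at a1; exact absurd a1 Bool.false_ne_true
    · rw [b1] at b2; rw [b2]
  have hcard := Finset.card_le_card hsub
  rw [Finset.card_biUnion hdisj] at hcard
  refine le_trans ?_ (Nat.cast_le (α := ℝ).2 hcard)
  push_cast
  rw [hX, Finset.sum_sigma, stepAct, Finset.mul_sum, Finset.sum_mul]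
  refine Finset.sum_le_sum fun ρ hρ => ?_
  have hρR := Finset.mem_range.1 (Finset.mem_filter.1 hρ).1
  rw [Finset.sum_insertNone, act, mul_add, add_mul]
  refine add_le_add ?_ ?_
  · simp only [hE]
    split_ifs with h
    · rw [mul_one]; exact card_acceptEvent_ge hG hV hid hM hρR v h
    · simp
  · by_cases hc : inCover nb par (ident v)
    · rw [if_pos hc, Finset.sum_filter, Finset.mul_sum, Finset.sum_mul]
      refine Finset.sum_le_sum fun b hb => ?_
      simp only [hE, hc, true_and]
      split_ifs with h
      · exact card_sendEvent_ge hG hV hid hM hρR v hb h.2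
      · simp
    · rw [if_neg hc, mul_zero, zero_mul]
      exact Finset.sum_nonneg fun _ _ => Nat.cast_nonneg _

end Proposal

/-! ### The exponential potential of unmatched vertices -/

namespace Proposal

open scoped Classical

variable {nb : ℕ → Finset ℕ} {V : Finset ℕ} {par : Par}

theorem state_congr_lab {lab lab' : ℕ → ℕ → Lab} {t : ℕ}
    (h : ∀ v, ∀ s < t, lab v s = lab' v s) : state nb par lab t = state nb par lab' t := by
  induction t with
  | zero => rfl
  | succ t ih =>
    rw [state, state, ih fun v s hs => h v s (by omega)]
    congr 1
    funext v
    exact h v t (by omega)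

theorem totalAct_congr_lab {lab lab' : ℕ → ℕ → Lab} {t : ℕ}
    (h : ∀ v, ∀ s < t, lab v s = lab' v s) (v : ℕ) :
    totalAct nb par lab t v = totalAct nb par lab' t v := by
  refine Finset.sum_congr rfl fun s hs => ?_
  rw [state_congr_lab fun v r hr => h v r (hr.trans (Finset.mem_range.1 hs))]

theorem stepAct_nonneg (st : St) (t v : ℕ) : 0 ≤ stepAct nb par st t v :=
  Finset.sum_nonneg fun _ _ => act_nonneg _ _ _

theorem totalAct_nonneg (lab : ℕ → ℕ → Lab) (t v : ℕ) : 0 ≤ totalAct nb par lab t v :=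
  Finset.sum_nonneg fun _ _ => stepAct_nonneg _ _ _

theorem sum_act_le (hG : IsGraph nb V) (st : St) (ρ : ℕ) :
    ∑ v ∈ V, act nb par st ρ v ≤ 2 * (cover nb par V).card := by
  unfold act
  rw [Finset.sum_add_distrib, Finset.sum_boole, ← Finset.sum_filter, two_mul]
  refine add_le_add (by exact_mod_cast card_killed_le hG st ρ) ?_
  refine (Finset.sum_le_card_nsmul _ _ 1 fun v _ => ?_).trans_eq ?_
  · exact (Finset.sum_le_sum_of_subset_of_nonneg (Finset.filter_subset _ _)
      fun _ _ _ => qt_nonneg _ _ _).trans (sum_qt_le ρ v)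
  · rw [nsmul_eq_mul, mul_one]; rfl

theorem sum_stepAct_le (hG : IsGraph nb V) (st : St) (t : ℕ) :
    ∑ v ∈ V, stepAct nb par st t v ≤ 2 * par.R * (cover nb par V).card := by
  unfold stepAct
  rw [Finset.sum_comm]
  refine (Finset.sum_le_card_nsmul _ _ _ fun ρ _ => sum_act_le hG st ρ).trans ?_
  rw [nsmul_eq_mul]
  have : (((Finset.range par.R).filter (· + 1 ∣ t)).card : ℝ) ≤ par.R := by
    exact_mod_cast (Finset.card_filter_le _ _).trans (Finset.card_range _).le
  calc _ ≤ (par.R : ℝ) * (2 * (cover nb par V).card) := by gcongr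
    _ = _ := by ring

variable {ι : Type*} {ident : ι → ℕ}

/-- The labels given by finitely many steps. -/
noncomputable def seqLab {R M T : ℕ} (ident : ι → ℕ) (ℓ : Fin T → ι → Lb R M) : ℕ → ℕ → Lab :=
  fun v t => if h : t < T then extLab ident (ℓ ⟨t, h⟩) v else default

theorem seqLab_snoc_lt {R M T : ℕ} (ℓ : Fin T → ι → Lb R M) (d : ι → Lb R M) {v s : ℕ}
    (hs : s < T) : seqLab ident (Fin.snoc (α := fun _ => ι → Lb R M) ℓ d : Fin (T + 1) → ι → Lb R M)
      v s = seqLab ident ℓ v s := by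
  have e : (⟨s, by omega⟩ : Fin (T + 1)) = Fin.castSucc ⟨s, hs⟩ := rfl
  rw [seqLab, seqLab, dif_pos (by omega), dif_pos hs, e, Fin.snoc_castSucc]

theorem seqLab_snoc_self {R M T : ℕ} (ℓ : Fin T → ι → Lb R M) (d : ι → Lb R M) (v : ℕ) :
    seqLab ident (Fin.snoc (α := fun _ => ι → Lb R M) ℓ d : Fin (T + 1) → ι → Lb R M) v T =
      extLab ident d v := by
  have e : (⟨T, by omega⟩ : Fin (T + 1)) = Fin.last T := rfl
  rw [seqLab, dif_pos (by omega), e, Fin.snoc_last]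

variable [Fintype ι]

/-- The exponential potential of the unmatched vertices. -/
noncomputable def potential (nb : ℕ → Finset ℕ) (par : Par) (ident : ι → ℕ) (lab : ℕ → ℕ → Lab)
    (T : ℕ) : ℝ :=
  ∑ i, if alive (state nb par lab T) (ident i) then
    Real.exp (1 / (8 * (par.R : ℝ) ^ 2) * totalAct nb par lab T (ident i)) - 1 else 0

/-- With `c = 1 / (8 * R ^ 2)`, an unmatched vertex of step activity `g` survives with probability
at most `1 - c * g ≤ exp (-(c * g))`, which cancels the growth `exp (c * g)` of its exponential. The
subtracted 1 costs at most `c * g`, and the activities sum to at most `2 * R` times the size of the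
cover. -/
theorem sum_potential_step_le (hG : IsGraph nb V) (hV : V = Finset.univ.image ident)
    (hid : Function.Injective ident) (hM : 0 < par.M) (lab : ℕ → ℕ → Lab) (T : ℕ)
    (lab' : (ι → Lb par.R par.M) → ℕ → ℕ → Lab)
    (h1 : ∀ d v, ∀ s < T, lab' d v s = lab v s) (h2 : ∀ d v, lab' d v T = extLab ident d v) :
    ∑ d, potential nb par ident (lab' d) (T + 1) ≤ Fintype.card (ι → Lb par.R par.M) *
      (potential nb par ident lab T + 1 / (8 * (par.R : ℝ) ^ 2) *
        (2 * par.R * (cover nb par V).card)) := by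
  set c : ℝ := 1 / (8 * (par.R : ℝ) ^ 2) with hc
  have hc0 : 0 ≤ c := by positivity
  set st := state nb par lab T with hst
  have hstate : ∀ d, state nb par (lab' d) (T + 1) = step nb par st T (extLab ident d) := by
    intro d
    rw [state, state_congr_lab (h1 d)]
    congr 1
    funext v
    exact h2 d v
  have hact : ∀ d v, totalAct nb par (lab' d) (T + 1) v =
      totalAct nb par lab T v + stepAct nb par st T v := by
    intro d v
    rw [totalAct, Finset.sum_range_succ, state_congr_lab (h1 d)]
    congr 1
    exact totalAct_congr_lab (h1 d) v
  unfold potential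
  rw [Finset.sum_comm]
  have key : ∀ i, ∑ d, (if alive (state nb par (lab' d) (T + 1)) (ident i) then
      Real.exp (c * totalAct nb par (lab' d) (T + 1) (ident i)) - 1 else 0) ≤
      Fintype.card (ι → Lb par.R par.M) * ((if alive st (ident i) then
        Real.exp (c * totalAct nb par lab T (ident i)) - 1 else 0) +
        c * stepAct nb par st T (ident i)) := by
    intro i
    simp only [hact, hstate]
    set g := stepAct nb par st T (ident i) with hg
    have hg0 : 0 ≤ g := stepAct_nonneg _ _ _
    set G := totalAct nb par lab T (ident i)
    have hG0 : 0 ≤ G := totalAct_nonneg _ _ _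
    by_cases ha : alive st (ident i)
    · rw [if_pos ha, ← Finset.sum_filter, Finset.sum_const, nsmul_eq_mul]
      have hcount : (((Finset.univ : Finset (ι → Lb par.R par.M)).filter fun d =>
          alive (step nb par st T (extLab ident d)) (ident i)).card : ℝ) ≤
          Fintype.card (ι → Lb par.R par.M) * (1 - c * g) := by
        have h3 := card_newPtn_ge (t := T) hG hV hid hM ha
        have h4 := Finset.card_filter_add_card_filter_not
          (s := (Finset.univ : Finset (ι → Lb par.R par.M)))
          (fun d => newPtn nb par st T (extLab ident d) (ident i) ≠ none)
        have h5 : ((Finset.univ : Finset (ι → Lb par.R par.M)).filter fun d =>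
            alive (step nb par st T (extLab ident d)) (ident i)) =
            Finset.univ.filter fun d : ι → Lb par.R par.M =>
              ¬ newPtn nb par st T (extLab ident d) (ident i) ≠ none := by
          refine Finset.filter_congr fun d _ => ?_
          have ha' : st.ptn (ident i) = none := ha
          simp only [alive, step, ha', if_true, not_not, ne_eq]
        rw [h5]
        have h6 := congrArg (Nat.cast (R := ℝ)) h4
        rw [Nat.cast_add, Finset.card_univ] at h6
        linarith
      have hexp : 0 ≤ Real.exp (c * (G + g)) - 1 := by
        have := Real.add_one_le_exp (c * (G + g))
        have : 0 ≤ c * (G + g) := by positivity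
        linarith
      refine (mul_le_mul_of_nonneg_right hcount hexp).trans ?_
      rw [mul_assoc]
      refine mul_le_mul_of_nonneg_left ?_ (Nat.cast_nonneg _)
      have h7 : (1 - c * g) * Real.exp (c * g) ≤ 1 := by
        have := Real.add_one_le_exp (-(c * g))
        calc _ ≤ Real.exp (-(c * g)) * Real.exp (c * g) :=
              mul_le_mul_of_nonneg_right (by linarith) (Real.exp_pos _).le
          _ = 1 := by rw [← Real.exp_add]; simp
      have h8 := mul_le_mul_of_nonneg_left h7 (Real.exp_pos (c * G)).le
      rw [mul_add, Real.exp_add]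
      linarith
    · have : ∀ d : ι → Lb par.R par.M,
          ¬ alive (step nb par st T (extLab ident d)) (ident i) := fun d h =>
        ha (alive_of_alive_step h)
      simp only [this, ha, if_false, Finset.sum_const_zero]
      positivity
  refine (Finset.sum_le_sum fun i _ => key i).trans ?_
  rw [← Finset.mul_sum, Finset.sum_add_distrib, ← Finset.mul_sum]
  refine mul_le_mul_of_nonneg_left (add_le_add le_rfl ?_) (Nat.cast_nonneg _)
  refine mul_le_mul_of_nonneg_left ?_ hc0
  have := sum_stepAct_le (par := par) hG st T
  nth_rw 1 [hV] at this
  rwa [Finset.sum_image fun x _ y _ h => hid h] at this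

theorem sum_potential_le (hG : IsGraph nb V) (hV : V = Finset.univ.image ident)
    (hid : Function.Injective ident) (hM : 0 < par.M) (T : ℕ) :
    ∑ ℓ : Fin T → ι → Lb par.R par.M, potential nb par ident (seqLab ident ℓ) T ≤
      T * (1 / (8 * (par.R : ℝ) ^ 2) * (2 * par.R * (cover nb par V).card)) *
        Fintype.card (Fin T → ι → Lb par.R par.M) := by
  induction T with
  | zero => simp [potential, totalAct]
  | succ T ih =>
    rw [← (Fin.snocEquiv fun _ : Fin (T + 1) => ι → Lb par.R par.M).sum_comp,
      Fintype.sum_prod_type_right]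
    have hstep : ∀ ℓ : Fin T → ι → Lb par.R par.M,
        ∑ d : ι → Lb par.R par.M, potential nb par ident (seqLab ident
          ((Fin.snocEquiv fun _ : Fin (T + 1) => ι → Lb par.R par.M) (d, ℓ))) (T + 1) ≤
        Fintype.card (ι → Lb par.R par.M) * (potential nb par ident (seqLab ident ℓ) T +
          1 / (8 * (par.R : ℝ) ^ 2) * (2 * par.R * (cover nb par V).card)) := fun ℓ =>
      sum_potential_step_le hG hV hid hM (seqLab ident ℓ) T _
        (fun d v s hs => seqLab_snoc_lt ℓ d hs) fun d v => seqLab_snoc_self ℓ d v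
    refine (Finset.sum_le_sum fun ℓ _ => hstep ℓ).trans ?_
    rw [← Finset.mul_sum, Finset.sum_add_distrib, Finset.sum_const, Finset.card_univ, nsmul_eq_mul]
    have e : (Fintype.card (Fin (T + 1) → ι → Lb par.R par.M) : ℝ) =
        Fintype.card (ι → Lb par.R par.M) * Fintype.card (Fin T → ι → Lb par.R par.M) := by
      rw [Fintype.card_fun, Fintype.card_fun (α := Fin T), Fintype.card_fin, Fintype.card_fin,
        pow_succ]
      push_cast; ring
    rw [e]
    have := mul_le_mul_of_nonneg_left ih
      (Nat.cast_nonneg (α := ℝ) (Fintype.card (ι → Lb par.R par.M)))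
    push_cast
    linarith

/-- The unmatched vertices with much activity. -/
noncomputable def lateIdx (nb : ℕ → Finset ℕ) (par : Par) (ident : ι → ℕ) (lab : ℕ → ℕ → Lab)
    (T : ℕ) (s0 : ℝ) : Finset ι :=
  Finset.univ.filter fun i => alive (state nb par lab T) (ident i) ∧
    s0 < totalAct nb par lab T (ident i)

/-- Markov's inequality: a late vertex contributes at least `exp (c * s0) - 1` to the potential. -/
theorem sum_card_lateIdx_le (hG : IsGraph nb V) (hV : V = Finset.univ.image ident)
    (hid : Function.Injective ident) (hM : 0 < par.M) (T : ℕ) (s0 : ℝ) :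
    (∑ ℓ : Fin T → ι → Lb par.R par.M,
      ((lateIdx nb par ident (seqLab ident ℓ) T s0).card : ℝ)) *
        (Real.exp (1 / (8 * (par.R : ℝ) ^ 2) * s0) - 1) ≤
      T * (1 / (8 * (par.R : ℝ) ^ 2) * (2 * par.R * (cover nb par V).card)) *
        Fintype.card (Fin T → ι → Lb par.R par.M) := by
  refine le_trans ?_ (sum_potential_le hG hV hid hM T)
  rw [Finset.sum_mul]
  refine Finset.sum_le_sum fun ℓ _ => ?_
  rw [lateIdx, ← nsmul_eq_mul, ← Finset.sum_const, Finset.sum_filter]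
  refine Finset.sum_le_sum fun i _ => ?_
  have hc : 0 ≤ 1 / (8 * (par.R : ℝ) ^ 2) := by positivity
  by_cases ha : alive (state nb par (seqLab ident ℓ) T) (ident i)
  · rw [if_pos ha]
    split_ifs with h
    · have := mul_le_mul_of_nonneg_left h.2.le hc
      have := Real.exp_le_exp.2 this
      linarith
    · have : 0 ≤ 1 / (8 * (par.R : ℝ) ^ 2) *
          totalAct nb par (seqLab ident ℓ) T (ident i) :=
        mul_nonneg hc (totalAct_nonneg _ _ _)
      linarith [Real.add_one_le_exp (1 / (8 * (par.R : ℝ) ^ 2) *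
          totalAct nb par (seqLab ident ℓ) T (ident i))]
  · rw [if_neg ha, if_neg (fun h => ha h.1)]

end Proposal

/-! ### Maximum matchings -/

section Matching

open scoped Classical

variable {V : Type*} [Fintype V] {G : SimpleGraph V}

theorem exists_max_matching (G : SimpleGraph V) : ∃ M : G.Subgraph, M.IsMatching ∧
    ∀ M' : G.Subgraph, M'.IsMatching → M'.edgeSet.ncard ≤ M.edgeSet.ncard := by
  obtain ⟨M, hM, h⟩ := Set.exists_max_image {M : G.Subgraph | M.IsMatching}
    (fun M => M.edgeSet.ncard) (Set.toFinite _) ⟨⊥, fun v hv => absurd hv (by simp)⟩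
  exact ⟨M, hM, h⟩

theorem card_verts_le {M : G.Subgraph} (hM : M.IsMatching) :
    M.verts.toFinset.card ≤ 2 * M.edgeSet.ncard := by
  have h : M.verts.toFinset ⊆ M.edgeSet.toFinset.biUnion fun e => e.toFinset := by
    intro v hv
    rw [Set.mem_toFinset] at hv
    obtain ⟨w, hw, _⟩ := hM hv
    rw [Finset.mem_biUnion]
    exact ⟨s(v, w), by simpa using hw, by simp⟩
  refine (Finset.card_le_card h).trans ((Finset.card_biUnion_le_card_mul _ _ 2 fun e he => ?_).trans
    ?_)
  · induction e with | _ x y => ?_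
    rw [Sym2.toFinset_mk_eq]
    exact Finset.card_le_two
  · rw [Set.ncard_eq_toFinset_card']; omega

theorem adj_mem_verts_of_max {M : G.Subgraph} (hM : M.IsMatching)
    (hmax : ∀ M' : G.Subgraph, M'.IsMatching → M'.edgeSet.ncard ≤ M.edgeSet.ncard) {a b : V}
    (hab : G.Adj a b) : a ∈ M.verts ∨ b ∈ M.verts := by
  by_contra! h
  have hdis : Disjoint M.support (G.subgraphOfAdj hab).support := by
    rw [SimpleGraph.Subgraph.IsMatching.support_eq_verts hM,
      SimpleGraph.Subgraph.IsMatching.support_eq_verts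
        (SimpleGraph.Subgraph.IsMatching.subgraphOfAdj hab)]
    rw [Set.disjoint_right]
    intro v hv
    rw [SimpleGraph.subgraphOfAdj_verts, Set.mem_insert_iff, Set.mem_singleton_iff] at hv
    rcases hv with rfl | rfl
    · exact h.1
    · exact h.2
  have h1 := hmax _ (hM.sup (SimpleGraph.Subgraph.IsMatching.subgraphOfAdj hab) hdis)
  rw [SimpleGraph.Subgraph.edgeSet_sup, SimpleGraph.edgeSet_subgraphOfAdj,
    Set.union_singleton, Set.ncard_insert_of_notMem] at h1
  · omega
  · intro h'
    exact h.1 (M.edge_vert h')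

end Matching

/-! ### From identifiers back to the graph -/

section Graph

open scoped Classical
open Proposal

variable {V : Type*} [Fintype V] {G : SimpleGraph V} {ident : V → ℕ}

/-- The neighbourhoods of a graph, in terms of identifiers. -/
noncomputable def nbOf (G : SimpleGraph V) (ident : V → ℕ) : ℕ → Finset ℕ :=
  (confOf G ident fun _ _ => default).nb

theorem mem_nbOf (hid : Function.Injective ident) {u v : V} :
    ident u ∈ nbOf G ident (ident v) ↔ G.Adj v u := by
  rw [nbOf, mem_confOf_nb hid]
  constructor
  · rintro ⟨w, h, e⟩; exact hid e ▸ h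
  · exact fun h => ⟨u, h, rfl⟩

theorem exists_of_mem_nbOf {x y : ℕ} (h : x ∈ nbOf G ident y) :
    ∃ u v, ident u = x ∧ ident v = y ∧ G.Adj v u := by
  simp only [nbOf, confOf, Finset.mem_image, Finset.mem_filter] at h
  obtain ⟨u, ⟨_, v, hv, h⟩, hu⟩ := h
  exact ⟨u, v, hu, hv, h⟩

theorem isGraph_nbOf (hid : Function.Injective ident) :
    IsGraph (nbOf G ident) (Finset.univ.image ident) where
  symm {a b} h := by
    obtain ⟨u, v, rfl, rfl, h'⟩ := exists_of_mem_nbOf h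
    exact (mem_nbOf hid).2 h'.symm
  irrefl a h := by
    obtain ⟨u, v, e1, e2, h⟩ := exists_of_mem_nbOf h
    exact h.ne (hid (e2.trans e1.symm))
  sub v x h := by
    obtain ⟨u, _, rfl, _, _⟩ := exists_of_mem_nbOf h
    exact Finset.mem_image_of_mem _ (Finset.mem_univ _)

variable {par : Par}

/-- The matching described by the partners. -/
def matchingOf (hid : Function.Injective ident) {ptn : ℕ → Option ℕ}
    (h : IsPartial (nbOf G ident) par ptn) : G.Subgraph where
  verts := {v | ptn (ident v) ≠ none}
  Adj v u := ptn (ident v) = some (ident u)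
  adj_sub hvu := (mem_nbOf hid).1 (h.adj hvu)
  edge_vert hvu := by
    change ptn _ = _ at hvu
    change ptn _ ≠ none
    rw [hvu]; exact Option.some_ne_none _
  symm := ⟨fun _ _ hvu => h.symm hvu⟩

theorem describes_matchingOf (hid : Function.Injective ident) {ptn : ℕ → Option ℕ}
    (h : IsPartial (nbOf G ident) par ptn) :
    Describes ident (fun v => ptn (ident v)) (matchingOf hid h) := by
  intro v i
  constructor
  · intro hi
    change ptn (ident v) = some i at hi
    obtain ⟨u, _, rfl, _, _⟩ := exists_of_mem_nbOf (h.adj hi)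
    exact ⟨u, hi, rfl⟩
  · rintro ⟨u, hu, rfl⟩; exact hu

theorem isMatching_matchingOf (hid : Function.Injective ident) {ptn : ℕ → Option ℕ}
    (h : IsPartial (nbOf G ident) par ptn) : (matchingOf hid h).IsMatching := by
  intro v hv
  obtain ⟨i, hi⟩ := Option.ne_none_iff_exists'.1 hv
  obtain ⟨u, hu, rfl⟩ := (describes_matchingOf hid h v i).1 hi
  refine ⟨u, hu, fun w hw => ?_⟩
  change ptn _ = _ at hu hw
  rw [hu] at hw
  exact (hid (Option.some.inj hw)).symm

/-- The edges of a matching, oriented such that they begin in the cover. -/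
noncomputable def oriented (par : Par) (ident : V → ℕ) (M : G.Subgraph) : Finset (V × V) :=
  Finset.univ.filter fun p => M.Adj p.1 p.2 ∧ inCover (nbOf G ident) par (ident p.1) ∧
    (inCover (nbOf G ident) par (ident p.2) → ident p.1 < ident p.2)

theorem ncard_edgeSet_le_oriented (hid : Function.Injective ident)
    (hV : Fintype.card V ≤ par.N) (hB : par.N ≤ par.B ^ par.P) (M : G.Subgraph) :
    M.edgeSet.ncard ≤ (oriented par ident M).card := by
  have hcard : (Finset.univ.image ident).card ≤ par.N := by
    rwa [Finset.card_image_of_injective _ hid]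
  rw [Set.ncard_eq_toFinset_card']
  refine (Finset.card_le_card (t := (oriented par ident M).image fun p => s(p.1, p.2)) ?_).trans
    Finset.card_image_le
  intro e he
  rw [Set.mem_toFinset] at he
  induction e with | _ x y => ?_
  have hxy : M.Adj x y := he
  rw [Finset.mem_image]
  have hor : inCover (nbOf G ident) par (ident x) ∨ inCover (nbOf G ident) par (ident y) :=
    inCover_or (isGraph_nbOf hid) hcard hB ((mem_nbOf hid).2 (M.adj_sub hxy).symm)
  have hne : ident x ≠ ident y := fun e => (M.adj_sub hxy).ne (hid e)
  by_cases hx : inCover (nbOf G ident) par (ident x) ∧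
      (inCover (nbOf G ident) par (ident y) → ident x < ident y)
  · exact ⟨(x, y), Finset.mem_filter.2 ⟨Finset.mem_univ _, hxy, hx⟩, rfl⟩
  · refine ⟨(y, x), Finset.mem_filter.2 ⟨Finset.mem_univ _, hxy.symm, ?_⟩, Sym2.eq_swap⟩
    by_cases hx' : inCover (nbOf G ident) par (ident x)
    · by_cases hy : inCover (nbOf G ident) par (ident y)
      · refine ⟨hy, fun _ => ?_⟩
        have h2 : ¬ (ident x < ident y) := fun h => hx ⟨hx', fun _ => h⟩
        change ident y < ident x
        omega
      · exact absurd ⟨hx', fun h => absurd h hy⟩ hx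
    · exact ⟨hor.resolve_left hx', fun h => absurd h hx'⟩

/-- The identifiers break ties when both ends are in the cover, so no edge appears in both
directions; different edges of a matching are disjoint anyway. -/
theorem oriented_eq_of_mem {M : G.Subgraph} (hM : M.IsMatching) {p p' : V × V}
    (hp : p ∈ oriented par ident M) (hp' : p' ∈ oriented par ident M) {z : V}
    (hz : z = p.1 ∨ z = p.2) (hz' : z = p'.1 ∨ z = p'.2) : p = p' := by
  obtain ⟨x, y⟩ := p
  obtain ⟨x', y'⟩ := p'
  obtain ⟨_, h1, h2, h3⟩ := Finset.mem_filter.1 hp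
  obtain ⟨_, h1', h2', h3'⟩ := Finset.mem_filter.1 hp'
  simp only at *
  rcases hz with rfl | rfl <;> rcases hz' with rfl | rfl
  · rw [hM.eq_of_adj_left h1 h1']
  · obtain rfl := hM.eq_of_adj_left h1 h1'.symm
    have := h3 h2'
    have := h3' h2
    omega
  · obtain rfl := hM.eq_of_adj_left h1' h1.symm
    have := h3 h2'
    have := h3' h2
    omega
  · rw [hM.eq_of_adj_right h1 h1']

/-- The oriented edges of `M` which join unmatched vertices with little activity. -/
noncomputable def residualPairs (par : Par) (ident : V → ℕ) (lab : ℕ → ℕ → Lab) (T : ℕ) (s0 : ℝ)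
    (M : G.Subgraph) : Finset (V × V) :=
  (oriented par ident M).filter fun p =>
    (alive (state (nbOf G ident) par lab T) (ident p.1) ∧
      totalAct (nbOf G ident) par lab T (ident p.1) ≤ s0) ∧
    (alive (state (nbOf G ident) par lab T) (ident p.2) ∧
      totalAct (nbOf G ident) par lab T (ident p.2) ≤ s0)

theorem residual_residualPairs (hid : Function.Injective ident) {M : G.Subgraph}
    (hM : M.IsMatching) (lab : ℕ → ℕ → Lab) (T : ℕ) (s0 : ℝ) :
    Residual (nbOf G ident) par (state (nbOf G ident) par lab T)
      ((residualPairs par ident lab T s0 M).image fun p => (ident p.1, ident p.2)) := by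
  have key : ∀ e ∈ (residualPairs par ident lab T s0 M).image fun p => (ident p.1, ident p.2),
      ∃ p ∈ residualPairs par ident lab T s0 M, e = (ident p.1, ident p.2) := by
    intro e he
    obtain ⟨p, hp, rfl⟩ := Finset.mem_image.1 he
    exact ⟨p, hp, rfl⟩
  constructor
  · intro e he
    obtain ⟨p, hp, rfl⟩ := key e he
    exact (mem_nbOf hid).2 (M.adj_sub (Finset.mem_filter.1 (Finset.mem_filter.1 hp).1).2.1)
  · intro e he
    obtain ⟨p, hp, rfl⟩ := key e he
    exact (Finset.mem_filter.1 (Finset.mem_filter.1 hp).1).2.2.1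
  · intro e he
    obtain ⟨p, hp, rfl⟩ := key e he
    exact (Finset.mem_filter.1 hp).2.1.1
  · intro e he
    obtain ⟨p, hp, rfl⟩ := key e he
    exact (Finset.mem_filter.1 hp).2.2.1
  · intro e he e' he' h
    obtain ⟨p, hp, rfl⟩ := key e he
    obtain ⟨p', hp', rfl⟩ := key e' he'
    have : p.1 = p'.1 := hid h
    rw [oriented_eq_of_mem hM (Finset.mem_filter.1 hp).1 (Finset.mem_filter.1 hp').1
      (Or.inl rfl) (Or.inl this)]
  · intro e he e' he' h
    obtain ⟨p, hp, rfl⟩ := key e he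
    obtain ⟨p', hp', rfl⟩ := key e' he'
    have : p.2 = p'.2 := hid h
    rw [oriented_eq_of_mem hM (Finset.mem_filter.1 hp).1 (Finset.mem_filter.1 hp').1
      (Or.inr rfl) (Or.inr this)]

/-- An edge of `M` that is not residual contains a matched or a late vertex, and disjoint edges are
charged to different vertices. Each output edge supplies two matched vertices, whence the factor 2.
-/
theorem ncard_edgeSet_le (hid : Function.Injective ident)
    (hV : Fintype.card V ≤ par.N) (hB : par.N ≤ par.B ^ par.P) {M : G.Subgraph}
    (hM : M.IsMatching) (lab : ℕ → ℕ → Lab) (T : ℕ) (s0 : ℝ)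
    (h : IsPartial (nbOf G ident) par (state (nbOf G ident) par lab T).ptn) :
    M.edgeSet.ncard ≤ 2 * (matchingOf hid h).edgeSet.ncard +
      (lateIdx (nbOf G ident) par ident lab T s0).card +
      (residualPairs par ident lab T s0 M).card := by
  set st := state (nbOf G ident) par lab T
  set bad : Finset V := (matchingOf hid h).verts.toFinset ∪
    lateIdx (nbOf G ident) par ident lab T s0
  refine (ncard_edgeSet_le_oriented hid hV hB M).trans ?_
  rw [← Finset.card_filter_add_card_filter_not (s := oriented par ident M)
    (fun p => (alive st (ident p.1) ∧ totalAct (nbOf G ident) par lab T (ident p.1) ≤ s0) ∧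
      (alive st (ident p.2) ∧ totalAct (nbOf G ident) par lab T (ident p.2) ≤ s0)), add_comm]
  refine add_le_add ?_ le_rfl
  have hbad : ∀ v, v ∉ bad → alive st (ident v) ∧
      totalAct (nbOf G ident) par lab T (ident v) ≤ s0 := by
    intro v hv
    simp only [bad, Finset.mem_union, Set.mem_toFinset, lateIdx, Finset.mem_filter,
      Finset.mem_univ, true_and, not_or, not_and, not_lt] at hv
    have ha : alive st (ident v) := by
      by_contra ha; exact hv.1 ha
    exact ⟨ha, hv.2 ha⟩
  have hle : ((oriented par ident M).filter fun p => ¬ ((alive st (ident p.1) ∧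
      totalAct (nbOf G ident) par lab T (ident p.1) ≤ s0) ∧ (alive st (ident p.2) ∧
      totalAct (nbOf G ident) par lab T (ident p.2) ≤ s0))).card ≤ bad.card := by
    refine Finset.card_le_card_of_injOn (fun p => if p.1 ∈ bad then p.1 else p.2) ?_ ?_
    · intro p hp
      simp only
      split_ifs with h1
      · exact h1
      · by_contra h2
        exact (Finset.mem_filter.1 hp).2 ⟨hbad _ h1, hbad _ h2⟩
    · intro p hp p' hp' he
      refine oriented_eq_of_mem hM (Finset.mem_filter.1 hp).1 (Finset.mem_filter.1 hp').1
        (z := if p.1 ∈ bad then p.1 else p.2) ?_ ?_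
      · split_ifs <;> simp
      · simp only at he
        rw [he]; split_ifs <;> simp
  refine hle.trans ((Finset.card_union_le _ _).trans ?_)
  have := card_verts_le (isMatching_matchingOf hid h)
  omega

/-- The vertices of a maximum matching form a vertex cover with at most two vertices per edge, to
which `card_cover_le` compares the peeled cover. -/
theorem card_cover_le_matching (hid : Function.Injective ident) (hV : Fintype.card V ≤ par.N)
    {M : G.Subgraph} (hM : M.IsMatching)
    (hmax : ∀ M' : G.Subgraph, M'.IsMatching → M'.edgeSet.ncard ≤ M.edgeSet.ncard) :
    (cover (nbOf G ident) par (Finset.univ.image ident)).card ≤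
      4 * par.P * par.B * M.edgeSet.ncard := by
  have hcard : (Finset.univ.image ident).card ≤ par.N := by
    rwa [Finset.card_image_of_injective _ hid]
  have h1 := card_cover_le (isGraph_nbOf (G := G) hid) hcard (M.verts.toFinset.image ident) (by
    intro a b hab
    obtain ⟨u, v, rfl, rfl, h⟩ := exists_of_mem_nbOf hab
    refine (adj_mem_verts_of_max hM hmax h.symm).imp ?_ ?_ <;>
    · intro h'; exact Finset.mem_image_of_mem _ (Set.mem_toFinset.2 h'))
  refine h1.trans ?_
  have h2 := (Finset.card_image_le (s := M.verts.toFinset) (f := ident)).trans (card_verts_le hM)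
  calc _ ≤ par.P * (2 * par.B * (2 * M.edgeSet.ncard)) := by gcongr
    _ = _ := by ring

end Graph

/-! ### Uniform labels from real seeds -/

section Quantize

open scoped Classical

variable {Λ : Type} [Fintype Λ] [Nonempty Λ]

/-- A map from the unit interval to a finite set which takes all values equally often. -/
noncomputable def quantize (Λ : Type) [Fintype Λ] [Nonempty Λ] (x : unitInterval) : Λ :=
  (Fintype.equivFin Λ).symm ⟨min ⌊(x : ℝ) * Fintype.card Λ⌋₊ (Fintype.card Λ - 1), by
    have := Fintype.card_pos (α := Λ); omega⟩

/-- Preimages are half-open intervals, except that the `min` adds the right endpoint 1 to the last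
one. The sandwich between `Ico` and `Icc` lets both cases share one volume computation. -/
theorem quantize_preimage (l : Λ) : ∃ s : Set ℝ, MeasurableSet s ∧
    Set.Ico ((Fintype.equivFin Λ l : ℝ) / Fintype.card Λ)
      (((Fintype.equivFin Λ l : ℝ) + 1) / Fintype.card Λ) ⊆ s ∧
    s ⊆ Set.Icc ((Fintype.equivFin Λ l : ℝ) / Fintype.card Λ)
      (((Fintype.equivFin Λ l : ℝ) + 1) / Fintype.card Λ) ∧
    quantize Λ ⁻¹' {l} = Subtype.val ⁻¹' s := by
  set n := Fintype.card Λ with hn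
  have hn0 : 0 < n := Fintype.card_pos
  have hn' : (0 : ℝ) < n := by exact_mod_cast hn0
  set j := Fintype.equivFin Λ l with hj
  have hjn : (j : ℕ) < n := j.isLt
  have key : ∀ x : unitInterval, quantize Λ x = l ↔
      min ⌊(x : ℝ) * n⌋₊ (n - 1) = j := by
    intro x
    rw [quantize, Equiv.symm_apply_eq, Fin.ext_iff]
  by_cases hlast : (j : ℕ) = n - 1
  · refine ⟨Set.Icc (j / n) ((j + 1) / n), measurableSet_Icc, Set.Ico_subset_Icc_self,
      subset_rfl, ?_⟩
    ext x
    rw [Set.mem_preimage, Set.mem_singleton_iff, key, Set.mem_preimage, Set.mem_Icc,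
      div_le_iff₀ hn', le_div_iff₀ hn']
    have h1 : (x : ℝ) * n ≤ j + 1 := by
      have : (j : ℝ) + 1 = n := by
        have : (j : ℕ) + 1 = n := by omega
        exact_mod_cast this
      rw [this]
      exact mul_le_of_le_one_left hn'.le x.2.2
    have h2 : ((j : ℕ) : ℝ) ≤ (x : ℝ) * n ↔ (j : ℕ) ≤ ⌊(x : ℝ) * n⌋₊ :=
      (Nat.le_floor_iff (mul_nonneg x.2.1 hn'.le)).symm
    rw [h2]
    simp only [h1, and_true]
    omega
  · refine ⟨Set.Ico (j / n) ((j + 1) / n), measurableSet_Ico, subset_rfl,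
      Set.Ico_subset_Icc_self, ?_⟩
    ext x
    rw [Set.mem_preimage, Set.mem_singleton_iff, key, Set.mem_preimage, Set.mem_Ico,
      div_le_iff₀ hn', lt_div_iff₀ hn']
    have h0 : 0 ≤ (x : ℝ) * n := mul_nonneg x.2.1 hn'.le
    have h2 : ((j : ℕ) : ℝ) ≤ (x : ℝ) * n ∧ (x : ℝ) * n < ((j : ℕ) : ℝ) + 1 ↔ ⌊(x : ℝ) * n⌋₊ = j :=
      (Nat.floor_eq_iff h0).symm
    rw [h2]
    omega

theorem measurableSet_quantize_preimage (l : Λ) : MeasurableSet (quantize Λ ⁻¹' {l}) := by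
  obtain ⟨s, hs, _, _, h⟩ := quantize_preimage l
  rw [h]
  exact measurable_subtype_coe hs

theorem volume_quantize_preimage (l : Λ) :
    (volume : Measure unitInterval) (quantize Λ ⁻¹' {l}) = (Fintype.card Λ : ENNReal)⁻¹ := by
  obtain ⟨s, hs, h1, h2, h⟩ := quantize_preimage l
  have hn' : (0 : ℝ) < Fintype.card Λ := by exact_mod_cast Fintype.card_pos
  have hj : ((Fintype.equivFin Λ l : ℕ) : ℝ) + 1 ≤ Fintype.card Λ := by
    exact_mod_cast (Fintype.equivFin Λ l).isLt
  have hsub : s ⊆ Set.Icc 0 1 := by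
    refine h2.trans (Set.Icc_subset_Icc (by positivity) ?_)
    rw [div_le_one hn']; exact hj
  have e : (volume : Measure unitInterval) (Subtype.val ⁻¹' s) = volume s := by
    refine ((MeasurableEmbedding.subtype_coe measurableSet_Icc).comap_apply _ _).trans ?_
    rw [Subtype.image_preimage_coe, Set.inter_eq_right.2 hsub]
  have hl : ((Fintype.equivFin Λ l : ℝ) + 1) / Fintype.card Λ -
      (Fintype.equivFin Λ l : ℝ) / Fintype.card Λ = (Fintype.card Λ : ℝ)⁻¹ := by
    rw [← sub_div, add_sub_cancel_left, one_div]
  rw [h, e]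
  refine le_antisymm ?_ ?_
  · refine (measure_mono h2).trans_eq ?_
    rw [Real.volume_Icc, hl, ENNReal.ofReal_inv_of_pos hn', ENNReal.ofReal_natCast]
  · refine le_trans (le_of_eq ?_) (measure_mono h1)
    rw [Real.volume_Ico, hl, ENNReal.ofReal_inv_of_pos hn', ENNReal.ofReal_natCast]

variable {V : Type}

/-- The labels of all vertices in the first `T` steps. -/
noncomputable def sample (Λ : Type) [Fintype Λ] [Nonempty Λ] (T : ℕ) (ω : V → Seed) :
    Fin T → V → Λ :=
  fun t v => quantize Λ (ω v t)

theorem sample_preimage {T : ℕ} (l : Fin T → V → Λ) : sample Λ T ⁻¹' {l} =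
    Set.pi Set.univ fun v => Set.pi (Finset.range T : Set ℕ) fun t =>
      if h : t < T then quantize Λ ⁻¹' {l ⟨t, h⟩ v} else Set.univ := by
  ext ω
  simp only [Set.mem_preimage, Set.mem_singleton_iff, Set.mem_pi, Set.mem_univ, true_implies,
    Finset.coe_range, Set.mem_Iio]
  constructor
  · rintro rfl v t ht
    rw [dif_pos ht]; rfl
  · intro h
    funext t v
    have := h v t t.2
    rw [dif_pos t.2] at this
    exact this

variable [Fintype V]

theorem measurableSet_sample_preimage_singleton {T : ℕ} (l : Fin T → V → Λ) :
    MeasurableSet (sample Λ T ⁻¹' {l} : Set (V → Seed)) := by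
  rw [sample_preimage]
  refine MeasurableSet.univ_pi fun v => MeasurableSet.pi (Finset.countable_toSet _) fun t _ => ?_
  split_ifs
  · exact measurableSet_quantize_preimage _
  · exact MeasurableSet.univ

theorem measure_sample_preimage_singleton {T : ℕ} (l : Fin T → V → Λ) :
    (Measure.pi fun _ : V => seedMeasure) (sample Λ T ⁻¹' {l}) =
      (Fintype.card (Fin T → V → Λ) : ENNReal)⁻¹ := by
  rw [sample_preimage, Measure.pi_pi]
  have h : ∀ v, seedMeasure (Set.pi (Finset.range T : Set ℕ) fun t =>
      if h : t < T then quantize Λ ⁻¹' {l ⟨t, h⟩ v} else Set.univ) =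
      ((Fintype.card Λ : ENNReal)⁻¹) ^ T := by
    intro v
    rw [seedMeasure, Measure.infinitePi_pi]
    · rw [Finset.prod_congr rfl (g := fun _ => (Fintype.card Λ : ENNReal)⁻¹), Finset.prod_const,
        Finset.card_range]
      intro t ht
      rw [dif_pos (Finset.mem_range.1 ht), volume_quantize_preimage]
    · intro t _
      split_ifs
      · exact measurableSet_quantize_preimage _
      · exact MeasurableSet.univ
  simp only [h, Finset.prod_const, Finset.card_univ]
  rw [Fintype.card_fun, Fintype.card_fun, Fintype.card_fin]
  push_cast
  rw [← ENNReal.inv_pow, ← ENNReal.inv_pow, ← pow_mul, ← pow_mul, mul_comm]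

theorem measurableSet_sample_preimage {T : ℕ} (A : Finset (Fin T → V → Λ)) :
    MeasurableSet (sample Λ T ⁻¹' A : Set (V → Seed)) := by
  rw [← Set.biUnion_of_singleton (A : Set (Fin T → V → Λ)), Set.preimage_iUnion₂]
  exact Finset.measurableSet_biUnion A fun l _ => measurableSet_sample_preimage_singleton l

theorem measureReal_sample_preimage {T : ℕ} (A : Finset (Fin T → V → Λ)) :
    (Measure.pi fun _ : V => seedMeasure).real (sample Λ T ⁻¹' A) =
      A.card / Fintype.card (Fin T → V → Λ) := by
  have : (sample Λ T ⁻¹' A : Set (V → Seed)) = ⋃ l ∈ A, sample Λ T ⁻¹' {l} := by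
    ext ω
    simp
  rw [Measure.real, this, measure_biUnion_finset]
  · simp only [measure_sample_preimage_singleton, Finset.sum_const, nsmul_eq_mul]
    rw [ENNReal.toReal_mul, ENNReal.toReal_natCast, ENNReal.toReal_inv, ENNReal.toReal_natCast,
      div_eq_mul_inv]
  · intro l _ l' _ hne
    exact Disjoint.preimage _ (Set.disjoint_singleton.2 hne)
  · exact fun l _ => measurableSet_sample_preimage_singleton l

end Quantize

/-! ### Success probability for general parameters -/

section Success

open scoped Classical
open Proposal

/-- The algorithm that runs the matching process for `T N` steps with parameters `par N`. -/
noncomputable def processAlgorithm (par : ℕ → Par) (T : ℕ → ℕ) : LocalAlgorithm :=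
  gather (fun N => radius (par N) (T N))
    (fun N ω t => if _h : Nonempty (Lb (par N).R (par N).M) then
      toLab (quantize (Lb (par N).R (par N).M) (ω t)) else default)
    fun N C v => (state C.nb (par N) C.lab (T N)).ptn v

variable {V : Type} [Fintype V] {G : SimpleGraph V} {ident : V → ℕ} {par : ℕ → Par} {T : ℕ → ℕ}

theorem processAlgorithm_result (hid : Function.Injective ident) (N : ℕ)
    [hne : Nonempty (Lb (par N).R (par N).M)] (ω : V → Seed) (v : V) :
    (processAlgorithm par T).result N G ident ω v =
      (state (nbOf G ident) (par N) (seqLab ident (sample (Lb (par N).R (par N).M) (T N) ω))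
        (T N)).ptn (ident v) := by
  rw [processAlgorithm, gather_result hid N]
  · have : ∀ lab : V → ℕ → Lab, (confOf G ident lab).nb = nbOf G ident := fun _ => rfl
    rw [this]
    congr 1
    refine state_congr_lab fun x s hs => ?_
    rw [seqLab, dif_pos hs, extLab]
    simp only [confOf, dif_pos hne, sample]
    by_cases hx : ∃ i, ident i = x
    · obtain ⟨i, rfl⟩ := hx
      rw [hid.extend_apply, hid.extend_apply]
    · rw [Function.extend_apply' _ _ _ hx, Function.extend_apply' _ _ _ hx]
  · intro C C' x h
    exact (state_congr (T N)).1 x h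

/-- With more residual pairs than this, `sum_card_times_le` would bound the number of updates by the
left side of `hnum`. This holds for every choice of labels. -/
theorem card_residualPairs_le (hid : Function.Injective ident) {p : Par} {n : ℕ}
    (hV : Fintype.card V ≤ p.N) (hK : 3 < p.K) (hτ : 0 < p.τ) (hM0 : 0 < p.M)
    (hMT : n * p.N ≤ p.M) {M : G.Subgraph} (hM : M.IsMatching) (lab : ℕ → ℕ → Lab) {s s0 : ℝ}
    (hnum : p.R * (2 * p.K / p.τ * (p.τ * s + Real.log p.N +
        (p.τ * p.K * (s0 + 1) + s0 * Real.log p.K)) +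
      1 / Real.log (p.K / 3) * (p.τ * s + Real.log 2 + Real.log (1 + (n + 2) * Real.exp s) +
        2 / p.K * Real.log (1 + p.N) +
        (p.τ * p.K * (s0 + 1) + s0 * Real.log p.K))) +
      (2 * p.K / p.τ + 1 / Real.log (p.K / 3)) * (2 * Real.log p.N) <
      ∑ ρ ∈ Finset.range p.R, ((times ρ n).card : ℝ)) :
    ((residualPairs p ident lab n s0 M).card : ℝ) ≤
      Real.exp (-s) * (cover (nbOf G ident) p (Finset.univ.image ident)).card := by
  by_contra! hlt
  have hinj : Function.Injective fun q : V × V => (ident q.1, ident q.2) := fun a b h => by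
    simp only [Prod.mk.injEq] at h
    exact Prod.ext (hid h.1) (hid h.2)
  have hc := Finset.card_image_of_injective (residualPairs p ident lab n s0 M) hinj
  refine hnum.not_ge (sum_card_times_le (V := Finset.univ.image ident) (isGraph_nbOf (G := G) hid)
    hK hτ hM0 hMT ?_ (residual_residualPairs hid hM lab n s0) ?_ ?_ ?_ ?_)
  · rwa [Finset.card_image_of_injective _ hid]
  · rw [← Finset.card_pos, hc]
    have : (0 : ℝ) < (residualPairs p ident lab n s0 M).card := lt_of_le_of_lt (by positivity) hlt
    exact_mod_cast this
  · intro e he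
    obtain ⟨q, hq, rfl⟩ := Finset.mem_image.1 he
    exact (Finset.mem_filter.1 hq).2.1.2
  · intro e he
    obtain ⟨q, hq, rfl⟩ := Finset.mem_image.1 he
    exact (Finset.mem_filter.1 hq).2.2.2
  · rw [hc]
    rw [Real.exp_neg, inv_mul_lt_iff₀ (Real.exp_pos s)] at hlt
    exact hlt.le

/-- The process describes an approximate maximum matching unless many edges of a maximum matching
are residual or touch a late vertex. -/
theorem exists_approx_of_card_le (hid : Function.Injective ident) {p : Par} {n : ℕ}
    (hV : Fintype.card V ≤ p.N) (hB : p.N ≤ p.B ^ p.P) {M : G.Subgraph} (hM : M.IsMatching)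
    (hmax : ∀ M' : G.Subgraph, M'.IsMatching → M'.edgeSet.ncard ≤ M.edgeSet.ncard)
    (lab : ℕ → ℕ → Lab) (s0 : ℝ) {ε : ℝ} (hε : 0 < ε)
    (h : ((lateIdx (nbOf G ident) p ident lab n s0).card +
      (residualPairs p ident lab n s0 M).card : ℝ) * (2 + ε) ≤ ε * M.edgeSet.ncard) :
    ∃ M' : G.Subgraph,
      Describes ident (fun v => (state (nbOf G ident) p lab n).ptn (ident v)) M' ∧
      IsApproxMaxMatching G (2 + ε) M' := by
  have hp := state_isPartial (par := p) (isGraph_nbOf (G := G) hid) lab n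
  refine ⟨matchingOf hid hp, describes_matchingOf hid hp, isMatching_matchingOf hid hp,
    fun M' hM' => ?_⟩
  have h1 : (M'.edgeSet.ncard : ℝ) ≤ M.edgeSet.ncard := by exact_mod_cast hmax M' hM'
  have h2 : (M.edgeSet.ncard : ℝ) ≤ 2 * (matchingOf hid hp).edgeSet.ncard +
      (lateIdx (nbOf G ident) p ident lab n s0).card +
      (residualPairs p ident lab n s0 M).card := by
    exact_mod_cast ncard_edgeSet_le hid hV hB hM lab n s0 hp
  refine h1.trans ?_
  nlinarith

/-- Markov's inequality over the finitely many label sequences. On average at most `η` times the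
optimum is lost to late vertices, and always at most as much to residual pairs. Failure requires the
loss times `2 + ε ≤ 3` to exceed `ε` times the optimum; hence `6 * η / ε`. -/
theorem success_probability (hid : Function.Injective ident) {N : ℕ} (hN : (par N).N = N)
    (hV : Fintype.card V ≤ N) (hR : 0 < (par N).R) (hM0 : 0 < (par N).M)
    (hB : N ≤ (par N).B ^ (par N).P) (hK : 3 < (par N).K) (hτ : 0 < (par N).τ)
    (hMT : T N * N ≤ (par N).M) {s s0 η : ℝ}
    (hnum : (par N).R * (2 * (par N).K / (par N).τ * ((par N).τ * s + Real.log N +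
        ((par N).τ * (par N).K * (s0 + 1) + s0 * Real.log (par N).K)) +
      1 / Real.log ((par N).K / 3) * ((par N).τ * s + Real.log 2 +
        Real.log (1 + (T N + 2) * Real.exp s) + 2 / (par N).K * Real.log (1 + N) +
        ((par N).τ * (par N).K * (s0 + 1) + s0 * Real.log (par N).K))) +
      (2 * (par N).K / (par N).τ + 1 / Real.log ((par N).K / 3)) * (2 * Real.log N) <
      ∑ ρ ∈ Finset.range (par N).R, ((times ρ (T N)).card : ℝ))
    (hs0 : 0 < s0)
    (hη1 : Real.exp (-s) * (4 * (par N).P * (par N).B) ≤ η)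
    (hη2 : T N * (4 * (par N).P * (par N).B) ≤
      η * (Real.exp (1 / (8 * ((par N).R : ℝ) ^ 2) * s0) - 1))
    {ε : ℝ} (hε : 0 < ε) (hε1 : ε < 1) :
    MeasurableSet ((processAlgorithm par T).successEvent N G ident (2 + ε)) ∧
    1 - 6 * η / ε ≤ (Measure.pi fun _ : V => seedMeasure).real
      ((processAlgorithm par T).successEvent N G ident (2 + ε)) := by
  set p := par N with hp
  set n := T N with hn
  have hne : Nonempty (Lb p.R p.M) := ⟨(true, ⟨0, hR⟩, ⟨0, hM0⟩)⟩
  set A : Finset (Fin n → V → Lb p.R p.M) := Finset.univ.filter fun ℓ => ∃ M' : G.Subgraph,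
      Describes ident (fun v => (state (nbOf G ident) p (seqLab ident ℓ) n).ptn (ident v)) M' ∧
      IsApproxMaxMatching G (2 + ε) M' with hA
  have hev : (processAlgorithm par T).successEvent N G ident (2 + ε) =
      sample (Lb p.R p.M) n ⁻¹' A := by
    ext ω
    rw [LocalAlgorithm.successEvent, Set.mem_ofPred_eq,
      funext (processAlgorithm_result (par := par) (T := T) (G := G) hid N ω)]
    simp only [hA, Set.mem_preimage, Finset.coe_filter, Finset.mem_univ, true_and,
      Set.mem_ofPred_eq]
    exact Iff.rfl
  rw [hev]
  refine ⟨measurableSet_sample_preimage A, ?_⟩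
  rw [measureReal_sample_preimage]
  set D := Fintype.card (Fin n → V → Lb p.R p.M) with hD
  have hD0 : (0 : ℝ) < D := by exact_mod_cast Fintype.card_pos
  obtain ⟨M, hM, hmax⟩ := exists_max_matching G
  have hc0 : 0 < Real.exp (1 / (8 * (p.R : ℝ) ^ 2) * s0) - 1 := by
    have : 0 < 1 / (8 * (p.R : ℝ) ^ 2) * s0 := by positivity
    linarith [Real.add_one_le_exp (1 / (8 * (p.R : ℝ) ^ 2) * s0)]
  have hη0 : 0 ≤ η := le_trans (by positivity) hη1
  have hVp : Fintype.card V ≤ p.N := by rw [hN]; exact hV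
  have hBp : p.N ≤ p.B ^ p.P := by rw [hN]; exact hB
  set Y := cover (nbOf G ident) p (Finset.univ.image ident)
  have hY : (Y.card : ℝ) ≤ 4 * p.P * p.B * M.edgeSet.ncard := by
    exact_mod_cast card_cover_le_matching hid hVp hM hmax
  have hlate : ∑ ℓ : Fin n → V → Lb p.R p.M,
      ((lateIdx (nbOf G ident) p ident (seqLab ident ℓ) n s0).card : ℝ) ≤
        η * M.edgeSet.ncard * D := by
    have h := sum_card_lateIdx_le (isGraph_nbOf (G := G) hid) rfl hid hM0 n s0 (par := p)
    refine le_of_mul_le_mul_right (h.trans ?_) hc0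
    have hR1 : (1 : ℝ) ≤ p.R := by exact_mod_cast hR
    have h1 : 1 / (8 * (p.R : ℝ) ^ 2) * (2 * p.R * Y.card) ≤ Y.card := by
      rw [one_div, inv_mul_le_iff₀ (by positivity)]
      nlinarith [mul_nonneg (Nat.cast_nonneg (α := ℝ) Y.card) (sub_nonneg.2 hR1),
        mul_nonneg (mul_nonneg (Nat.cast_nonneg (α := ℝ) Y.card) (sub_nonneg.2 hR1))
          (Nat.cast_nonneg (α := ℝ) p.R)]
    calc (n : ℝ) * (1 / (8 * (p.R : ℝ) ^ 2) * (2 * p.R * Y.card)) * D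
        ≤ n * (4 * p.P * p.B * M.edgeSet.ncard) * D :=
          mul_le_mul_of_nonneg_right (mul_le_mul_of_nonneg_left (h1.trans hY)
            (Nat.cast_nonneg _)) hD0.le
      _ = n * (4 * p.P * p.B) * M.edgeSet.ncard * D := by ring
      _ ≤ η * (Real.exp (1 / (8 * (p.R : ℝ) ^ 2) * s0) - 1) * M.edgeSet.ncard * D := by gcongr
      _ = _ := by ring
  have hres : ∀ ℓ : Fin n → V → Lb p.R p.M,
      ((residualPairs p ident (seqLab ident ℓ) n s0 M).card : ℝ) ≤ η * M.edgeSet.ncard := by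
    intro ℓ
    refine (card_residualPairs_le hid hVp hK hτ hM0 (by rw [hN]; exact hMT) hM _
      (by rw [hN]; exact hnum)).trans ?_
    calc Real.exp (-s) * (Y.card : ℝ) ≤ Real.exp (-s) * (4 * p.P * p.B * M.edgeSet.ncard) := by
          gcongr
      _ = Real.exp (-s) * (4 * p.P * p.B) * M.edgeSet.ncard := by ring
      _ ≤ _ := by gcongr
  have hfail : (((Aᶜ).card : ℝ)) * (ε * M.edgeSet.ncard) ≤ 6 * η * M.edgeSet.ncard * D := by
    calc (((Aᶜ).card : ℝ)) * (ε * M.edgeSet.ncard)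
        = ∑ ℓ ∈ Aᶜ, ε * (M.edgeSet.ncard : ℝ) := by rw [Finset.sum_const, nsmul_eq_mul]
      _ ≤ ∑ ℓ ∈ Aᶜ, (((lateIdx (nbOf G ident) p ident (seqLab ident ℓ) n s0).card : ℝ) +
          (residualPairs p ident (seqLab ident ℓ) n s0 M).card) * 3 := by
        refine Finset.sum_le_sum fun ℓ hℓ => ?_
        by_contra! hlt
        refine Finset.mem_compl.1 hℓ (Finset.mem_filter.2 ⟨Finset.mem_univ _,
          exists_approx_of_card_le hid hVp hBp hM hmax (seqLab ident ℓ) s0 hε ?_⟩)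
        refine le_trans ?_ hlt.le
        gcongr
        linarith
      _ ≤ ∑ ℓ, (((lateIdx (nbOf G ident) p ident (seqLab ident ℓ) n s0).card : ℝ) +
          (residualPairs p ident (seqLab ident ℓ) n s0 M).card) * 3 :=
        Finset.sum_le_sum_of_subset_of_nonneg (Finset.subset_univ _) fun _ _ _ => by positivity
      _ ≤ (η * M.edgeSet.ncard * D + ∑ _ℓ : Fin n → V → Lb p.R p.M, η * M.edgeSet.ncard) * 3 := by
        rw [← Finset.sum_mul, Finset.sum_add_distrib]
        gcongr with ℓ
        exact hres ℓ
      _ = 6 * η * M.edgeSet.ncard * D := by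
        rw [Finset.sum_const, nsmul_eq_mul, Finset.card_univ, ← hD]
        ring
  have hcompl : (A.card : ℝ) = D - (Aᶜ).card := by
    rw [Finset.card_compl, ← hD, Nat.cast_sub (Finset.card_le_univ A)]
    ring
  have hAc : ((Aᶜ).card : ℝ) * ε ≤ 6 * η * D := by
    rcases Nat.eq_zero_or_pos M.edgeSet.ncard with h0 | h0
    -- With optimum 0 the averaged bound carries no information, but then every matching is empty
    -- and no sequence fails.
    · have : Aᶜ = ∅ := by
        rw [Finset.compl_eq_empty_iff, Finset.eq_univ_iff_forall]
        intro ℓ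
        have hpt := state_isPartial (par := p) (isGraph_nbOf (G := G) hid) (seqLab ident ℓ) n
        refine Finset.mem_filter.2 ⟨Finset.mem_univ _, matchingOf hid hpt,
          describes_matchingOf hid hpt, isMatching_matchingOf hid hpt, fun M' hM' => ?_⟩
        have := hmax M' hM'
        rw [h0, Nat.le_zero] at this
        rw [this]
        push_cast
        positivity
      rw [this]
      simp only [Finset.card_empty, Nat.cast_zero, zero_mul]
      positivity
    · have h0' : (0 : ℝ) < M.edgeSet.ncard := by exact_mod_cast h0
      refine le_of_mul_le_mul_right ?_ h0'
      linarith
  rw [hcompl, le_div_iff₀ hD0]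
  have : ((Aᶜ).card : ℝ) ≤ 6 * η / ε * D := by
    rw [div_mul_eq_mul_div, le_div_iff₀ hε]
    exact hAc
  linarith

end Success

/-! ### Numerical estimates -/

section Numeric

theorem le_card_times_mul (ρ T : ℕ) : T ≤ (Proposal.times ρ T).card * (ρ + 1) := by
  rw [← Finset.card_range (ρ + 1), ← Finset.card_product]
  conv_lhs => rw [← Finset.card_range T]
  refine Finset.card_le_card_of_injOn (fun x => ((ρ + 1) * (x / (ρ + 1)), x % (ρ + 1))) ?_ ?_
  · intro x hx
    have hx : x < T := Finset.mem_range.1 hx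
    simp only [Finset.coe_product, Set.mem_prod, Finset.mem_coe, Proposal.times, Finset.mem_filter,
      Finset.mem_range]
    exact ⟨⟨(Nat.mul_div_le x _).trans_lt hx, dvd_mul_right _ _⟩, Nat.mod_lt _ (by omega)⟩
  · intro x _ y _ h
    simp only [Prod.mk.injEq] at h
    rw [← Nat.div_add_mod x (ρ + 1), ← Nat.div_add_mod y (ρ + 1), h.1, h.2]

/-- Type `ρ` is updated at least `T / (ρ + 1)` times, and the harmonic sum supplies one of the two
factors of order `log log N`. -/
theorem mul_log_le_sum_card_times (R T : ℕ) : (T : ℝ) * Real.log (R + 1) ≤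
    ∑ ρ ∈ Finset.range R, ((Proposal.times ρ T).card : ℝ) := by
  have h := log_add_one_le_harmonic R
  calc (T : ℝ) * Real.log (R + 1) ≤ T * ((harmonic R : ℚ) : ℝ) := by gcongr; exact_mod_cast h
    _ = ∑ ρ ∈ Finset.range R, (T : ℝ) * ((ρ + 1 : ℕ) : ℝ)⁻¹ := by
        rw [harmonic, ← Finset.mul_sum]; push_cast; rfl
    _ ≤ _ := by
        refine Finset.sum_le_sum fun ρ _ => ?_
        rw [← div_eq_mul_inv, div_le_iff₀ (by positivity)]
        exact_mod_cast le_card_times_mul ρ T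

-- This is the update bound for `K = X ^ 2`, `τ = X ^ 4`, `s = 3 * u`, `s0 = 32 * R ^ 2 * u`. With
-- `a = L / X ^ 2`, the terms inside the factor `R ≤ 2 * X` are `O(a)`, and `hlX` makes `O(a * X)`
-- at most `L / log X`. The growth term supplies the main part `2 * L / log X`.
set_option maxHeartbeats 800000 in
theorem numeric_bound {X u L N R T : ℝ} (hX : 10000 ≤ X) (hlX : 1700 * Real.log X ≤ X)
    (hL : L = u * X ^ 12) (hu : X ^ 12 ≤ u) (hN : 1 ≤ N) (hNL : Real.log N = L) (hR1 : X ≤ R)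
    (hR2 : R ≤ 2 * X) (hT0 : 0 ≤ T) (hTL : T ≤ L) :
    R * (2 * X ^ 2 / X ^ 4 * (X ^ 4 * (3 * u) + Real.log N +
        (X ^ 4 * X ^ 2 * (32 * R ^ 2 * u + 1) + 32 * R ^ 2 * u * Real.log (X ^ 2))) +
      1 / Real.log (X ^ 2 / 3) * (X ^ 4 * (3 * u) + Real.log 2 +
        Real.log (1 + (T + 2) * Real.exp (3 * u)) + 2 / X ^ 2 * Real.log (1 + N) +
        (X ^ 4 * X ^ 2 * (32 * R ^ 2 * u + 1) + 32 * R ^ 2 * u * Real.log (X ^ 2)))) +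
      (2 * X ^ 2 / X ^ 4 + 1 / Real.log (X ^ 2 / 3)) * (2 * Real.log N) ≤ 3 * L / Real.log X := by
  have hX0 : 0 < X := by linarith
  have hX1 : 1 ≤ X := by linarith
  have pow_le : ∀ {i j : ℕ}, i ≤ j → X ^ i ≤ X ^ j := fun h => pow_le_pow_right₀ hX1 h
  have hu1 : 1 ≤ u := (one_le_pow₀ hX1).trans hu
  have hu0 : 0 < u := by linarith
  set a := u * X ^ 10 with ha
  have hmul : ∀ {i : ℕ}, i ≤ 10 → u * X ^ i ≤ a := fun h =>
    mul_le_mul_of_nonneg_left (pow_le h) hu0.le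
  have haL : a * X ^ 2 = L := by rw [hL, ha]; ring
  have ha0 : 0 < a := by positivity
  have haL' : a ≤ L := by
    rw [← haL]; exact le_mul_of_one_le_right ha0.le (one_le_pow₀ hX1)
  have ha1 : 1 ≤ a := one_le_mul_of_one_le_of_one_le hu1 (one_le_pow₀ hX1)
  have hlogX : 1 ≤ Real.log X := by
    rw [Real.le_log_iff_exp_le hX0]
    linarith [Real.exp_one_lt_d9]
  have hlog3 : Real.log 3 ≤ Real.log X := Real.log_le_log (by norm_num) (by linarith)
  have hlK : Real.log X ≤ Real.log (X ^ 2 / 3) := by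
    rw [Real.log_div (by positivity) (by norm_num), Real.log_pow]
    push_cast; linarith
  have hR0 : 0 < R := by linarith
  have hs0 : 32 * R ^ 2 * u ≤ 128 * (u * X ^ 2) := by
    have : R ^ 2 ≤ (2 * X) ^ 2 := by gcongr
    nlinarith
  have hlogK : Real.log (X ^ 2) ≤ X ^ 2 := (Real.log_le_self (by positivity))
  have hlogK0 : 0 ≤ Real.log (X ^ 2) := Real.log_nonneg (one_le_pow₀ hX1)
  have e1 : X ^ 4 * (3 * u) ≤ 3 * a := by
    have := hmul (i := 4) (by norm_num); linarith
  have e2 : X ^ 4 * X ^ 2 * (32 * R ^ 2 * u + 1) ≤ 129 * a := by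
    have h1 : X ^ 4 * X ^ 2 * (32 * R ^ 2 * u + 1) ≤
        X ^ 4 * X ^ 2 * (128 * (u * X ^ 2) + u * X ^ 2) := by
      gcongr
      exact one_le_mul_of_one_le_of_one_le hu1 (one_le_pow₀ hX1)
    have := hmul (i := 8) (by norm_num)
    nlinarith
  have e3 : 32 * R ^ 2 * u * Real.log (X ^ 2) ≤ 128 * a := by
    have h1 : 32 * R ^ 2 * u * Real.log (X ^ 2) ≤ 128 * (u * X ^ 2) * X ^ 2 := by gcongr
    have := hmul (i := 4) (by norm_num)
    nlinarith
  have e4 : Real.log (1 + (T + 2) * Real.exp (3 * u)) ≤ 7 * a := by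
    have h1 : 1 + (T + 2) * Real.exp (3 * u) ≤ (4 * L) * Real.exp (3 * u) := by
      have : 1 ≤ Real.exp (3 * u) := Real.one_le_exp (by positivity)
      nlinarith
    have h2 : Real.log (4 * L) ≤ 4 * a := by
      have hL0 : 0 < L := by linarith
      have h3 : Real.log (4 * L) = 2 * Real.log (Real.sqrt (4 * L)) := by
        rw [Real.log_sqrt (by positivity)]; ring
      have h4 := Real.log_le_self (Real.sqrt_nonneg (4 * L))
      have h5 : Real.sqrt (4 * L) ≤ 2 * u := by
        rw [Real.sqrt_le_iff]
        refine ⟨by positivity, ?_⟩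
        rw [hL]; nlinarith
      have := hmul (i := 0) (by norm_num)
      rw [pow_zero, mul_one] at this
      linarith
    have h3 := Real.log_le_log (by positivity) h1
    rw [Real.log_mul (by linarith) (Real.exp_pos _).ne', Real.log_exp] at h3
    have := hmul (i := 0) (by norm_num)
    rw [pow_zero, mul_one] at this
    linarith
  have e5 : 2 / X ^ 2 * Real.log (1 + N) ≤ 4 * a := by
    have h1 : Real.log (1 + N) ≤ 2 * L := by
      have h2 : Real.log (1 + N) ≤ Real.log (2 * N) := Real.log_le_log (by positivity) (by linarith)
      rw [Real.log_mul (by norm_num) (by positivity), hNL] at h2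
      have := Real.log_two_lt_d9
      linarith
    rw [div_mul_eq_mul_div, div_le_iff₀ (by positivity)]
    nlinarith
  have e6 : Real.log 2 ≤ a := by linarith [Real.log_two_lt_d9]
  set E1 := X ^ 4 * (3 * u)
  set E2 := X ^ 4 * X ^ 2 * (32 * R ^ 2 * u + 1)
  set E3 := 32 * R ^ 2 * u * Real.log (X ^ 2)
  set E4 := Real.log (1 + (T + 2) * Real.exp (3 * u))
  set E5 := 2 / X ^ 2 * Real.log (1 + N)
  set Q := Real.log (X ^ 2 / 3)
  have hQ0 : 0 < Q := by linarith
  have hQ : 1 / Q ≤ 1 := by rw [div_le_one hQ0]; linarith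
  have hQ' : 1 / Q ≤ 1 / Real.log X := one_div_le_one_div_of_le (by linarith) hlK
  have hpos : 0 ≤ E1 + Real.log 2 + E4 + E5 + (E2 + E3) := by
    have h1 : 0 ≤ E1 := by positivity
    have h2 : 0 ≤ E2 := by positivity
    have h3 : 0 ≤ E3 := by positivity
    have h4 : 0 ≤ E4 := Real.log_nonneg (by
      have : 0 ≤ (T + 2) * Real.exp (3 * u) := by positivity
      linarith)
    have h5 : 0 ≤ E5 := mul_nonneg (by positivity) (Real.log_nonneg (by linarith))
    have h6 : 0 ≤ Real.log 2 := Real.log_nonneg (by norm_num)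
    linarith
  have hKτ : 2 * X ^ 2 / X ^ 4 = 2 / X ^ 2 := by field_simp
  rw [hKτ, hNL]
  have hA : 2 / X ^ 2 * (E1 + L + (E2 + E3)) ≤ 2 / X ^ 2 * (261 * L) := by
    gcongr; linarith
  have hA' : 2 / X ^ 2 * (261 * L) = 522 * a := by rw [← haL]; field_simp; norm_num
  have hB : 1 / Q * (E1 + Real.log 2 + E4 + E5 + (E2 + E3)) ≤ 272 * a := by
    calc _ ≤ 1 * (E1 + Real.log 2 + E4 + E5 + (E2 + E3)) := by gcongr
      _ ≤ _ := by linarith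
  have hL0 : 0 ≤ L := ha0.le.trans haL'
  have hC : (2 / X ^ 2 + 1 / Q) * (2 * L) ≤ 4 * a + 2 * L / Real.log X := by
    have h1 : 2 / X ^ 2 * (2 * L) = 4 * a := by rw [← haL]; field_simp; norm_num
    have h2 : 1 / Q * (2 * L) ≤ 1 / Real.log X * (2 * L) := by gcongr
    have h3 : 1 / Real.log X * (2 * L) = 2 * L / Real.log X := by ring
    linarith
  have hAB : R * (2 / X ^ 2 * (E1 + L + (E2 + E3)) +
      1 / Q * (E1 + Real.log 2 + E4 + E5 + (E2 + E3))) ≤ 2 * X * (794 * a) :=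
    (mul_le_mul_of_nonneg_left (by linarith) hR0.le).trans
      (mul_le_mul_of_nonneg_right hR2 (by positivity))
  have hlast : 1700 * (a * X) ≤ L / Real.log X := by
    rw [le_div_iff₀ (by linarith), ← haL]
    calc 1700 * (a * X) * Real.log X = a * X * (1700 * Real.log X) := by ring
      _ ≤ a * X * X := mul_le_mul_of_nonneg_left hlX (by positivity)
      _ = a * X ^ 2 := by ring
  have h3 : 3 * L / Real.log X = 2 * L / Real.log X + L / Real.log X := by ring
  have h4 : a ≤ a * X := le_mul_of_one_le_right ha0.le hX1
  linarith

end Numeric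

/-! ### Choice of the parameters -/

section Parameters

open Proposal

/-- The scale `(log N) ^ (d / 12)` of the number of learner types. -/
noncomputable def scale (d : ℝ) (N : ℕ) : ℝ := Real.log N ^ (d / 12)

/-- The number of steps of the process. -/
noncomputable def steps (d : ℝ) (N : ℕ) : ℕ := ⌈4 * Real.log N / Real.log (scale d N) ^ 2⌉₊

/-- The parameters of the process. -/
noncomputable def params (d : ℝ) (N : ℕ) : Par where
  R := ⌈scale d N⌉₊
  -- Fine enough that rounding the proposals costs at most 1 over the whole run.
  M := steps d N * N + 1
  -- The exponents satisfy `(log N) ^ (1 - d) * scale ^ 12 = log N`, so `B ^ P` reaches `N`. There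
  -- are only about `(log N) ^ d` phases, and `B` is dominated by the aimed failure probability.
  B := ⌈Real.exp (Real.log N ^ (1 - d))⌉₊
  P := ⌈scale d N ^ 12⌉₊
  N := N
  -- `log K` is of order `log log N`, the second such factor, and `τ = K ^ 2` makes `2 * K / τ`
  -- negligible.
  K := scale d N ^ 2
  τ := scale d N ^ 4

variable {d : ℝ} {N : ℕ}

/-- `N` is so large that the estimates below hold. -/
structure IsLarge (d : ℝ) (N : ℕ) : Prop where
  one_le : 1 ≤ Real.log N
  le_scale : 10000 ≤ scale d N
  log_scale_le : 1700 * Real.log (scale d N) ≤ scale d N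

theorem eventually_isLarge (hd : 0 < d) : ∀ᶠ N in Filter.atTop, IsLarge d N := by
  have h1 : Filter.Tendsto (fun N : ℕ => Real.log N) Filter.atTop Filter.atTop :=
    Real.tendsto_log_atTop.comp tendsto_natCast_atTop_atTop
  have h2 : Filter.Tendsto (scale d) Filter.atTop Filter.atTop :=
    (tendsto_rpow_atTop (by positivity)).comp h1
  have h3 : ∀ᶠ x : ℝ in Filter.atTop, 1700 * Real.log x ≤ x := by
    filter_upwards [Real.isLittleO_log_id_atTop.bound (show (0 : ℝ) < 1 / 1700 by norm_num),
      Filter.eventually_ge_atTop 1] with x hx hx1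
    rw [Real.norm_of_nonneg (Real.log_nonneg hx1), id, Real.norm_of_nonneg (by linarith)] at hx
    linarith
  filter_upwards [h1.eventually_ge_atTop 1, h2.eventually_ge_atTop 10000, h2.eventually h3]
    with N a b c using ⟨a, b, c⟩

namespace IsLarge

theorem log_scale (h : IsLarge d N) : Real.log (scale d N) = d / 12 * Real.log (Real.log N) :=
  Real.log_rpow (by linarith [h.one_le]) _

theorem three_le_log_scale (h : IsLarge d N) : 3 ≤ Real.log (scale d N) := by
  have := h.le_scale
  rw [Real.le_log_iff_exp_le (by linarith)]
  have h3 : Real.exp 3 = Real.exp 1 ^ 3 := by rw [← Real.exp_nat_mul]; norm_num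
  have h1 : Real.exp 1 ^ 3 ≤ 3 ^ 3 := by
    gcongr; linarith [Real.exp_one_lt_d9]
  rw [h3]; linarith

theorem scale_pow (h : IsLarge d N) : scale d N ^ 12 = Real.log N ^ d := by
  rw [scale, ← Real.rpow_natCast, ← Real.rpow_mul (by linarith [h.one_le])]
  norm_num

theorem log_eq (h : IsLarge d N) : Real.log N = Real.log N ^ (1 - d) * scale d N ^ 12 := by
  rw [h.scale_pow, ← Real.rpow_add (by linarith [h.one_le]), sub_add_cancel, Real.rpow_one]

theorem scale_pow_le (h : IsLarge d N) (hd : d ≤ 1 / 2) :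
    scale d N ^ 12 ≤ Real.log N ^ (1 - d) := by
  rw [h.scale_pow]
  exact Real.rpow_le_rpow_of_exponent_le h.one_le (by linarith)

theorem large_le (h : IsLarge d N) (hd : d ≤ 1 / 2) : 10000 ≤ Real.log N ^ (1 - d) :=
  h.le_scale.trans ((le_self_pow₀ (by linarith [h.le_scale]) (by norm_num)).trans
    (h.scale_pow_le hd))

theorem large_le_log (h : IsLarge d N) (hd : d ≤ 1 / 2) : 10000 ≤ Real.log N := by
  refine (h.large_le hd).trans ?_
  conv_rhs => rw [h.log_eq]
  exact le_mul_of_one_le_right (by linarith [h.large_le hd])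
    (one_le_pow₀ (by linarith [h.le_scale]))

theorem le_steps : 4 * Real.log N / Real.log (scale d N) ^ 2 ≤ steps d N := Nat.le_ceil _

theorem steps_le (h : IsLarge d N) :
    (steps d N : ℝ) ≤ 4 * Real.log N / Real.log (scale d N) ^ 2 + 1 :=
  (Nat.ceil_lt_add_one (by have := h.one_le; positivity)).le

theorem steps_le_log (h : IsLarge d N) (hd : d ≤ 1 / 2) : (steps d N : ℝ) ≤ Real.log N := by
  have h3 := h.three_le_log_scale
  have hL := h.large_le_log hd
  refine h.steps_le.trans ?_
  have : 4 * Real.log N / Real.log (scale d N) ^ 2 ≤ 4 * Real.log N / 9 := by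
    gcongr; nlinarith
  linarith

theorem R_le (h : IsLarge d N) : ((params d N).R : ℝ) ≤ 2 * scale d N := by
  have := h.le_scale
  have h1 := (Nat.ceil_lt_add_one (show 0 ≤ scale d N by linarith)).le
  change (⌈scale d N⌉₊ : ℝ) ≤ _
  linarith

theorem P_le (h : IsLarge d N) : ((params d N).P : ℝ) ≤ 2 * scale d N ^ 12 := by
  have : 1 ≤ scale d N ^ 12 := one_le_pow₀ (by linarith [h.le_scale])
  have h1 := (Nat.ceil_lt_add_one (show 0 ≤ scale d N ^ 12 by linarith)).le
  change (⌈scale d N ^ 12⌉₊ : ℝ) ≤ _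
  linarith

theorem B_le (h : IsLarge d N) :
    ((params d N).B : ℝ) ≤ 2 * Real.exp (Real.log N ^ (1 - d)) := by
  have h0 : 0 ≤ Real.log N := by linarith [h.one_le]
  have : 1 ≤ Real.exp (Real.log N ^ (1 - d)) := Real.one_le_exp (by positivity)
  have h1 := (Nat.ceil_lt_add_one (Real.exp_pos (Real.log N ^ (1 - d))).le).le
  change (⌈Real.exp (Real.log N ^ (1 - d))⌉₊ : ℝ) ≤ _
  linarith

theorem P_mul_B_le (h : IsLarge d N) (hd : d ≤ 1 / 2) :
    (4 * (params d N).P * (params d N).B : ℝ) ≤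
      16 * Real.log N ^ (1 - d) * Real.exp (Real.log N ^ (1 - d)) := by
  have := h.scale_pow_le hd
  calc (4 * (params d N).P * (params d N).B : ℝ)
      ≤ 4 * (2 * Real.log N ^ (1 - d)) * (2 * Real.exp (Real.log N ^ (1 - d))) := by
        have := h.P_le
        have := h.B_le
        gcongr
        linarith
    _ = _ := by ring

theorem exp_bound {u : ℝ} (hu : 10000 ≤ u) :
    16 * u ≤ Real.exp u ∧ 17 * u ^ 3 ≤ Real.exp u ^ 2 := by
  have h := Real.quadratic_le_exp_of_nonneg (show 0 ≤ u by linarith)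
  have h1 : 100 * u ≤ Real.exp u := by nlinarith
  have h2 : u ^ 2 / 2 ≤ Real.exp u := by linarith
  refine ⟨by linarith, ?_⟩
  calc 17 * u ^ 3 ≤ 100 * u * (u ^ 2 / 2) := by nlinarith [pow_pos (show 0 < u by linarith) 3]
    _ ≤ Real.exp u * Real.exp u := by gcongr
    _ = Real.exp u ^ 2 := by ring

/-- Of the three factors `exp (-u)`, two absorb the approximation factor `4 * P * B` of the cover
and one remains. -/
theorem residual_failure_le (h : IsLarge d N) (hd : d ≤ 1 / 2) :
    Real.exp (-(3 * Real.log N ^ (1 - d))) * (4 * (params d N).P * (params d N).B) ≤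
      Real.exp (-Real.log N ^ (1 - d)) := by
  have hPB := h.P_mul_B_le hd
  have hu := h.large_le hd
  set u := Real.log N ^ (1 - d)
  calc _ ≤ Real.exp (-(3 * u)) * (16 * u * Real.exp u) := by gcongr
    _ ≤ Real.exp (-(3 * u)) * (Real.exp u * Real.exp u) := by
        gcongr; exact (exp_bound hu).1
    _ = _ := by rw [← Real.exp_add, ← Real.exp_add]; congr 1; ring

/-- The threshold is such that the exponent becomes `4 * u`: one `exp u` pays for `B`, two for the
polynomial factors in `T` and `P`, and one is left. -/
theorem late_failure_le (h : IsLarge d N) (hd : d ≤ 1 / 2) :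
    steps d N * (4 * (params d N).P * (params d N).B) ≤
      Real.exp (-Real.log N ^ (1 - d)) * (Real.exp (1 / (8 * ((params d N).R : ℝ) ^ 2) *
        (32 * ((params d N).R : ℝ) ^ 2 * Real.log N ^ (1 - d))) - 1) := by
  have hPB := h.P_mul_B_le hd
  have hu := h.large_le hd
  have hT := h.steps_le_log hd
  have hL := h.log_eq
  have hX := h.scale_pow_le hd
  have hR : (0 : ℝ) < (params d N).R :=
    lt_of_lt_of_le (by linarith [h.le_scale]) (Nat.le_ceil (scale d N))
  have he : 1 / (8 * ((params d N).R : ℝ) ^ 2) *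
      (32 * ((params d N).R : ℝ) ^ 2 * Real.log N ^ (1 - d)) = 4 * Real.log N ^ (1 - d) := by
    field_simp; norm_num
  rw [he]
  set u := Real.log N ^ (1 - d)
  have hLu : Real.log N ≤ u * u := by
    rw [hL]; gcongr
  have hE : 1 ≤ Real.exp u := Real.one_le_exp (by linarith)
  have hE2 := (exp_bound hu).2
  have h1 : Real.exp (-u) ≤ 1 := Real.exp_le_one_iff.2 (by linarith)
  have h2 : Real.exp (-u) * Real.exp (4 * u) = Real.exp u ^ 3 := by
    rw [← Real.exp_add, ← Real.exp_nat_mul]; congr 1; push_cast; ring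
  have h3 : 1 ≤ u ^ 3 * Real.exp u := one_le_mul_of_one_le_of_one_le
    (one_le_pow₀ (by linarith)) hE
  calc (steps d N : ℝ) * (4 * (params d N).P * (params d N).B)
      ≤ (u * u) * (16 * u * Real.exp u) := by gcongr; exact hT.trans hLu
    _ ≤ 17 * u ^ 3 * Real.exp u - 1 := by linarith
    _ ≤ Real.exp u ^ 2 * Real.exp u - 1 := by gcongr
    _ ≤ _ := by rw [mul_sub, h2]; linarith

theorem le_B_pow (h : IsLarge d N) : N ≤ (params d N).B ^ (params d N).P := by
  have hN : (0 : ℝ) < N := by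
    by_contra hn
    have : (N : ℝ) = 0 := le_antisymm (not_lt.1 hn) (Nat.cast_nonneg N)
    have h1 := h.one_le
    rw [this, Real.log_zero] at h1
    linarith
  have h0 : 0 ≤ Real.log N ^ (1 - d) := Real.rpow_nonneg (by linarith [h.one_le]) _
  have key : (N : ℝ) ≤ ((params d N).B : ℝ) ^ (params d N).P := by
    calc (N : ℝ) = Real.exp (Real.log N) := (Real.exp_log hN).symm
      _ = Real.exp (Real.log N ^ (1 - d) * scale d N ^ 12) := by rw [← h.log_eq]
      _ ≤ Real.exp (((params d N).P : ℝ) * Real.log N ^ (1 - d)) := by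
          rw [mul_comm]
          gcongr
          exact Nat.le_ceil (scale d N ^ 12)
      _ = Real.exp (Real.log N ^ (1 - d)) ^ (params d N).P := Real.exp_nat_mul _ _
      _ ≤ _ := by
          gcongr
          exact Nat.le_ceil (Real.exp (Real.log N ^ (1 - d)))
  exact_mod_cast key

theorem steps_mul_log_gt (h : IsLarge d N) : 3 * Real.log N / Real.log (scale d N) <
    ∑ ρ ∈ Finset.range (params d N).R, ((times ρ (steps d N)).card : ℝ) := by
  refine lt_of_lt_of_le ?_ (mul_log_le_sum_card_times _ _)
  have h3 := h.three_le_log_scale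
  have h1 := h.one_le
  have hR : Real.log (scale d N) ≤ Real.log ((params d N).R + 1) := by
    refine Real.log_le_log (by linarith [h.le_scale]) ?_
    have : scale d N ≤ (params d N).R := Nat.le_ceil (scale d N)
    linarith
  calc 3 * Real.log N / Real.log (scale d N) < 4 * Real.log N / Real.log (scale d N) := by
        gcongr; norm_num
    _ = 4 * Real.log N / Real.log (scale d N) ^ 2 * Real.log (scale d N) := by field_simp
    _ ≤ _ := by gcongr; exact le_steps

/-- The steps themselves cost `16 * log N / log (scale) ^ 2`; peeling, the initial radius and
rounding up fit into one more such unit. The denominator comes from `log (scale) = d / 12 * log (log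
N)`. -/
theorem radius_le (h : IsLarge d N) (hd0 : 0 < d) (hd : d ≤ 1 / 2) :
    (radius (params d N) (steps d N) : ℝ) ≤
      17 / (d / 12) ^ 2 * (Real.log N / Real.log (Real.log N) ^ 2) := by
  have h3 := h.three_le_log_scale
  have hX := h.le_scale
  have hlX : Real.log (scale d N) ≤ scale d N := Real.log_le_self (by linarith)
  have hP := h.P_le
  have hR := h.R_le
  have hT := h.steps_le
  have e : 17 / (d / 12) ^ 2 * (Real.log N / Real.log (Real.log N) ^ 2) =
      17 * (Real.log N / Real.log (scale d N) ^ 2) := by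
    rw [h.log_scale, mul_pow]
    field_simp
  rw [e, radius]
  push_cast
  have h12 : scale d N ≤ scale d N ^ 12 := le_self_pow₀ (by linarith) (by norm_num)
  have hbig : 15 * scale d N ^ 12 ≤ Real.log N / Real.log (scale d N) ^ 2 := by
    rw [le_div_iff₀ (by positivity)]
    calc 15 * scale d N ^ 12 * Real.log (scale d N) ^ 2
        ≤ scale d N * scale d N ^ 12 * scale d N ^ 2 := by
          gcongr
          linarith
      _ = scale d N ^ 12 * scale d N ^ 3 := by ring
      _ ≤ scale d N ^ 12 * scale d N ^ 12 := by
          gcongr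
          · linarith
          · norm_num
      _ ≤ Real.log N ^ (1 - d) * scale d N ^ 12 := by
          gcongr; exact h.scale_pow_le hd
      _ = Real.log N := h.log_eq.symm
  rw [mul_div_assoc] at hT
  linarith

end IsLarge

end Parameters

/-! ### The main theorem -/

theorem theorem1 (δ : ℝ) (hδ : 0 < δ) :
    ∃ (A : LocalAlgorithm) (C c : ℝ) (n₀ : ℕ), 0 < C ∧ 0 < c ∧
      ∀ N : ℕ, n₀ ≤ N →
        (A.rounds N : ℝ) ≤ C * (Real.log N / Real.log (Real.log N) ^ 2) ∧
        ∀ ε : ℝ, 0 < ε → ε < 1 →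
        ∀ (V : Type) [Fintype V] (G : SimpleGraph V) (ident : V → ℕ),
          Fintype.card V ≤ N → Function.Injective ident →
          MeasurableSet (A.successEvent N G ident (2 + ε)) ∧
          1 - 1 / ε * Real.exp (-(c * Real.log N ^ (1 - δ))) ≤
            (Measure.pi fun _ : V => seedMeasure).real (A.successEvent N G ident (2 + ε)) := by
  -- A smaller exponent only improves the failure probability, and `d ≤ 1 / 2` gives `(log N) ^ d ≤
  -- (log N) ^ (1 - d)`.
  set d := min δ (1 / 2)
  have hd0 : 0 < d := lt_min hδ (by norm_num)
  have hd : d ≤ 1 / 2 := min_le_right _ _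
  obtain ⟨n₀, hn₀⟩ := Filter.eventually_atTop.1 (eventually_isLarge hd0)
  refine ⟨processAlgorithm (params d) (steps d), 17 / (d / 12) ^ 2, 1 / 2, n₀, by positivity,
    by norm_num, fun N hN => ?_⟩
  have h := hn₀ N hN
  refine ⟨h.radius_le hd0 hd, fun ε hε hε1 V _ G ident hV hid => ?_⟩
  have hX := h.le_scale
  have hu := h.large_le hd
  have hN1 : (1 : ℝ) ≤ N := by
    have : N ≠ 0 := by
      rintro rfl
      have := h.one_le
      rw [Nat.cast_zero, Real.log_zero] at this
      linarith
    exact_mod_cast Nat.one_le_iff_ne_zero.2 this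
  have hXR : scale d N ≤ (params d N).R := Nat.le_ceil (scale d N)
  have hR0 : (0 : ℝ) < (params d N).R := by linarith
  obtain ⟨hm, hp⟩ := success_probability (par := params d) (T := steps d) (G := G) hid (N := N) rfl
    hV (by exact_mod_cast hR0) (Nat.succ_pos _) h.le_B_pow
    (show 3 < scale d N ^ 2 by nlinarith) (show 0 < scale d N ^ 4 by positivity)
    (Nat.le_succ _) (s := 3 * Real.log N ^ (1 - d))
    (s0 := 32 * ((params d N).R : ℝ) ^ 2 * Real.log N ^ (1 - d))
    (η := Real.exp (-Real.log N ^ (1 - d)))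
    (lt_of_le_of_lt (numeric_bound hX h.log_scale_le h.log_eq (h.scale_pow_le hd) hN1 rfl hXR
      h.R_le (Nat.cast_nonneg _) (h.steps_le_log hd)) h.steps_mul_log_gt)
    (by positivity) (h.residual_failure_le hd) (h.late_failure_le hd) hε hε1
  refine ⟨hm, le_trans ?_ hp⟩
  have hle : Real.log N ^ (1 - δ) ≤ Real.log N ^ (1 - d) :=
    Real.rpow_le_rpow_of_exponent_le h.one_le (by linarith [min_le_left δ (1 / 2)])
  -- Halving the constant in the exponent absorbs the factor 6.
  have h6 : 6 * Real.exp (-Real.log N ^ (1 - d)) ≤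
      Real.exp (-(1 / 2 * Real.log N ^ (1 - δ))) := by
    have h1 : 6 ≤ Real.exp (1 / 2 * Real.log N ^ (1 - d)) := by
      linarith [Real.add_one_le_exp (1 / 2 * Real.log N ^ (1 - d))]
    calc 6 * Real.exp (-Real.log N ^ (1 - d))
        ≤ Real.exp (1 / 2 * Real.log N ^ (1 - d)) * Real.exp (-Real.log N ^ (1 - d)) := by gcongr
      _ = Real.exp (-(1 / 2 * Real.log N ^ (1 - d))) := by
          rw [← Real.exp_add]; congr 1; ring
      _ ≤ _ := by gcongr
  have : 6 * Real.exp (-Real.log N ^ (1 - d)) / ε ≤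
      1 / ε * Real.exp (-(1 / 2 * Real.log N ^ (1 - δ))) := by
    rw [div_eq_mul_one_div, mul_comm]
    gcongr
  linarith
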